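/- All polygons are simple polygons in the plane with vertices in general position (no three vertices are collinear). A diagonal of $P$ is a segment joining two vertices of $P$ whose relative interior lies in the interior of $P$; a triangulation of $P$ is a maximal set of pairwise non-crossing diagonals. A diagonal of a triangulation $T$ of $P$ is flippable if the two triangles of $T$ incident to it form a convex quadrilateral. A set $F$ of diagonals in $T$ is ps-flippable if its members are diagonals of interior-disjoint convex polygons whose boundaries consist of sides of $P$ and diagonals in $T$. The polynomial $1+4x^2-4x^3$ has a unique real root $x$, and $x\approx 1.17965$ (correct to five decimal places). If a polygon $P$ has a triangulation with exactly $k$ flippable diagonals, and some $l\le k$ of these flippable diagonals form a ps-flippable set, then $P$ has at least $2^l x^{k-l}$ triangulations. Moreover, let $c_{\mathrm{gon}}$ be the maximum real number $c$ with the property that every polygon having a triangulation with exactly $k$ flippable diagonals, some $l\le k$ of which form a ps-flippable set, has at least $2^l c^{\,k-l}$ triangulations. This maximum exists, and $x\le c_{\mathrm{gon}}\le \frac54$. -/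

import Mathlib

noncomputable section

namespace PolyTri

/-- The Euclidean plane. -/
abbrev Plane : Type := EuclideanSpace ℝ (Fin 2)

variable {n : ℕ}

/-- A simple polygon: at least three vertices, all distinct, and two different
sides meet only in common endpoints. -/
structure IsSimple (P : Polygon Plane n) : Prop where
  three_le : 3 ≤ n
  injective : Function.Injective P.vertices
  inter_subset : ∀ i j : Fin n, i ≠ j →
    P.edgeSet ℝ i ∩ P.edgeSet ℝ j ⊆
      ({P i, P (finRotate n i)} ∩ {P j, P (finRotate n j)} : Set Plane)

/-- General position: no three vertices are collinear. -/
def InGeneralPosition (P : Polygon Plane n) : Prop :=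
  ∀ i j k : Fin n, i ≠ j → i ≠ k → j ≠ k →
    ¬ Collinear ℝ ({P i, P j, P k} : Set Plane)

/-- The interior of a simple polygon: the points off the boundary whose connected component
in the complement of the boundary is bounded. -/
def interiorRegion (P : Polygon Plane n) : Set Plane :=
  {p | p ∉ P.boundary ℝ ∧
    Bornology.IsBounded (connectedComponentIn (P.boundary ℝ)ᶜ p)}

/-- The open segment spanned by an unordered pair of points. -/
def openSeg (e : Sym2 Plane) : Set Plane :=
  Sym2.lift ⟨fun a b => openSegment ℝ a b, fun a b => openSegment_symm ℝ a b⟩ e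

/-- The sides of the polygon, as unordered pairs of points. -/
def sides (P : Polygon Plane n) : Set (Sym2 Plane) :=
  {e | ∃ i : Fin n, e = s(P i, P (finRotate n i))}

/-- The diagonals of the polygon: the pairs of distinct vertices whose open segment lies in the
interior of the polygon. -/
def diagonals (P : Polygon Plane n) : Set (Sym2 Plane) :=
  {e | ∃ i j : Fin n, i ≠ j ∧ e = s(P i, P j) ∧ openSeg e ⊆ interiorRegion P}

/-- A set of pairwise non-crossing diagonals of the polygon. -/
structure IsNonCrossing (P : Polygon Plane n) (T : Finset (Sym2 Plane)) : Prop where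
  subset_diagonals : ∀ e ∈ T, e ∈ diagonals P
  disjoint : ∀ e ∈ T, ∀ f ∈ T, e ≠ f → Disjoint (openSeg e) (openSeg f)

/-- A triangulation of the polygon, given by its set of diagonals: a maximal set of pairwise
non-crossing diagonals. -/
def IsTriangulation (P : Polygon Plane n) (T : Finset (Sym2 Plane)) : Prop :=
  Maximal (IsNonCrossing P) T

/-- The number of triangulations of the polygon. -/
def numTriangulations (P : Polygon Plane n) : ℕ :=
  {T : Finset (Sym2 Plane) | IsTriangulation P T}.ncard

/-- All edges of a triangulation: the sides of the polygon and the diagonals in `T`. -/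
def edges (P : Polygon Plane n) (T : Finset (Sym2 Plane)) : Set (Sym2 Plane) :=
  sides P ∪ ↑T

/-- `W` is the vertex set of a convex polygon: at least three points in convex position. -/
def IsConvexPolygon (W : Set Plane) : Prop :=
  W.Finite ∧ 3 ≤ W.ncard ∧ ConvexIndependent ℝ ((↑) : W → Plane)

/-- The sides of the convex polygon with vertex set `W`: the segments between two of its vertices
that run along the boundary of its convex hull. -/
def hullSides (W : Set Plane) : Set (Sym2 Plane) :=
  {e | ∃ a ∈ W, ∃ b ∈ W, a ≠ b ∧ e = s(a, b) ∧ segment ℝ a b ⊆ frontier (convexHull ℝ W)}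

/-- The diagonals of the convex polygon with vertex set `W`: the pairs of vertices whose open
segment runs in the interior of its convex hull. -/
def hullDiagonals (W : Set Plane) : Set (Sym2 Plane) :=
  {e | ∃ a ∈ W, ∃ b ∈ W, a ≠ b ∧ e = s(a, b) ∧ openSegment ℝ a b ⊆ interior (convexHull ℝ W)}

/-- A diagonal `e = ab` of the triangulation is flippable if its two incident triangles `abc`, `abd`
form a convex quadrilateral (of which `ab` then is a diagonal). In a triangulation of a polygon,
three pairwise joined vertices always bound a triangle of the triangulation. -/
def IsFlippable (P : Polygon Plane n) (T : Finset (Sym2 Plane)) (e : Sym2 Plane) : Prop :=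
  ∃ a b c d : Plane, e = s(a, b) ∧ c ≠ d ∧
    s(a, c) ∈ edges P T ∧ s(b, c) ∈ edges P T ∧
    s(a, d) ∈ edges P T ∧ s(b, d) ∈ edges P T ∧
    IsConvexPolygon {a, b, c, d} ∧ s(a, b) ∈ hullDiagonals {a, b, c, d}

open Classical in
/-- The set of flippable diagonals of a triangulation. -/
def flippableDiagonals (P : Polygon Plane n) (T : Finset (Sym2 Plane)) : Finset (Sym2 Plane) :=
  T.filter (IsFlippable P T)

/-- `F` is ps-flippable (pseudo simultaneously flippable) in the triangulation `T`: its members are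
diagonals in `T` that are diagonals of interior-disjoint convex polygons whose boundaries are
parts of the triangulation. -/
def IsPsFlippable (P : Polygon Plane n) (T F : Finset (Sym2 Plane)) : Prop :=
  F ⊆ T ∧ ∃ Q : Set (Set Plane),
    (∀ W ∈ Q, W ⊆ Set.range P.vertices ∧ IsConvexPolygon W ∧ hullSides W ⊆ edges P T) ∧
    (∀ W ∈ Q, ∀ W' ∈ Q, W ≠ W' →
      Disjoint (interior (convexHull ℝ W)) (interior (convexHull ℝ W'))) ∧
    ∀ e ∈ F, ∃ W ∈ Q, e ∈ hullDiagonals W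

/-- The property defining the constant `c_gon`: every simple polygon (in general position) that has
a triangulation with `k` flippable diagonals, `l` of which form a ps-flippable set, has at least
`2 ^ l * c ^ (k - l)` triangulations. Here `l ≤ k` because `F` consists of flippable diagonals. -/
def GonProperty (c : ℝ) : Prop :=
  ∀ (n : ℕ) (P : Polygon Plane n), IsSimple P → InGeneralPosition P →
    ∀ T : Finset (Sym2 Plane), IsTriangulation P T →
      ∀ F : Finset (Sym2 Plane), F ⊆ flippableDiagonals P T → IsPsFlippable P T F →
        (2 : ℝ) ^ F.card * c ^ ((flippableDiagonals P T).card - F.card) ≤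
          (numTriangulations P : ℝ)

end PolyTri

end

/-! Lower bound. For a set `A` of diagonals of `T`, the family `Fam P T F A` keeps every diagonal of
`T` outside `A` and leaves the rest free. Induction on a set `A` of flippable diagonals shows that
it has at least 2^|A ∩ F| * x^|A \ F| members (`two_pow_mul_pow_le_fam_flippable`); the case of all
flippable diagonals is the theorem.

Suppose that some ab in A \ F lies in a convex quadrilateral of T with triangles abc and abd,
neither of which has both its other sides in A ∩ F. The members that keep ab, and the flips of the
members that keep ab and the four sides around it, are disjoint subfamilies (`ncard_fam_flip`).
Fixing these five edges costs a factor of at most 4x^3: at most two of them count 2, the others x.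
The induction closes if x ≤ 1 + x / (4x^3), that is 4x^3 ≤ 4x^2 + 1, and the root of the cubic gives
equality.

Otherwise every member of A \ F closes a triangle with two members of A ∩ F, and varying A ∩ F alone
suffices (`two_pow_mul_pow_le_fam`). Inside a convex region some uw is a leaf: a triangle uwv on it
has no further side in the set. However the rest of the region is triangulated, convexity allows uw
to be flipped, so making uw free doubles the family (`IsLeaf.two_mul_le`). This suffices unless it
spoils a closed triangle with sides uw, wz, uz. Then a third disjoint subfamily arises by flipping
uw and then wz (`IsLeaf.two_mul_add_le`). The resulting recursion closes if x^2 ≤ x + 1/4, which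
leaves room at the root.

Geometry. The interior of P is defined by bounded components. In place of the Jordan curve theorem
it is enough that every boundary point is a limit of points of the unbounded part
(`Good.boundary_subset_closure`). Hence a convex region bounded by edges of T has its interior in P
(`Good.region_subset`), and an edge that enters such a region joins two of its vertices. This makes
triangles on a given side of an edge unique (`Good.apex_unique`) and shows that flips preserve
maximality (`IsFlip.triangulation`). That every diagonal has a triangle on each side is never proved
in general: flippable diagonals have them by definition, and flips preserve the property
(`IsFlip.hasApexes`), so `Fam` carries it as an invariant for F.

Upper bound. A hexagon with one reflex vertex has at most five triangulations. In its fan all three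
diagonals are flippable and two of them form a ps-flippable set, so 4c ≤ 5. The admissible c form a
closed set, so the supremum is attained. -/

namespace PolyTri

/-! ### Orientation and crossing segments. -/

/-- Twice the signed area of the triangle `abc`. -/
def cr (a b c : Plane) : ℝ := (b 0 - a 0) * (c 1 - a 1) - (b 1 - a 1) * (c 0 - a 0)

lemma cr_swap (a b c : Plane) : cr b a c = -cr a b c := by unfold cr; ring

lemma cr_rotate (a b c : Plane) : cr b c a = cr a b c := by unfold cr; ring

lemma cr_self_left (a b : Plane) : cr a b a = 0 := by unfold cr; ring

lemma cr_self_right (a b : Plane) : cr a b b = 0 := by unfold cr; ring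

lemma cr_comb (p q a b : Plane) {s t : ℝ} (h : s + t = 1) :
    cr p q (s • a + t • b) = s * cr p q a + t * cr p q b := by
  obtain rfl : t = 1 - s := by linarith
  simp only [cr, PiLp.add_apply, PiLp.smul_apply, smul_eq_mul]; ring

lemma continuous_cr (a b : Plane) : Continuous (cr a b) := by
  unfold cr; fun_prop

lemma plane_ext {a b : Plane} (h0 : a 0 = b 0) (h1 : a 1 = b 1) : a = b := by
  ext i; fin_cases i <;> assumption

lemma collinear_of_cr_eq_zero {a b c : Plane} (h : cr a b c = 0) :
    Collinear ℝ ({a, b, c} : Set Plane) := by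
  by_cases hab : a = b
  · subst hab; simpa using collinear_pair ℝ a c
  rw [collinear_iff_of_mem (p₀ := a) (by simp)]
  refine ⟨b - a, ?_⟩
  have hne : b 0 - a 0 ≠ 0 ∨ b 1 - a 1 ≠ 0 := by
    by_contra! hh
    exact hab (plane_ext (by linarith [hh.1]) (by linarith [hh.2]))
  intro p hp
  simp only [Set.mem_insert_iff, Set.mem_singleton_iff] at hp
  rcases hp with rfl | rfl | rfl
  · exact ⟨0, by simp⟩
  · exact ⟨1, by simp⟩
  · unfold cr at h
    rcases hne with h0 | h0
    · refine ⟨(p 0 - a 0) / (b 0 - a 0), plane_ext ?_ ?_⟩ <;>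
        simp only [vadd_eq_add, PiLp.add_apply, PiLp.smul_apply, PiLp.sub_apply, smul_eq_mul] <;>
        field_simp <;> linarith
    · refine ⟨(p 1 - a 1) / (b 1 - a 1), plane_ext ?_ ?_⟩ <;>
        simp only [vadd_eq_add, PiLp.add_apply, PiLp.smul_apply, PiLp.sub_apply, smul_eq_mul] <;>
        field_simp <;> linarith

lemma cr_eq_zero_of_collinear {a b c : Plane} (h : Collinear ℝ ({a, b, c} : Set Plane)) :
    cr a b c = 0 := by
  obtain ⟨v, hv⟩ := (collinear_iff_of_mem (p₀ := a) (by simp)).1 h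
  obtain ⟨s, rfl⟩ := hv b (by simp)
  obtain ⟨t, rfl⟩ := hv c (by simp)
  simp [cr]; ring

/-- Two open segments meet. -/
def Cross (a b c d : Plane) : Prop := (openSegment ℝ a b ∩ openSegment ℝ c d).Nonempty

lemma Cross.symm {a b c d : Plane} (h : Cross a b c d) : Cross c d a b := by
  unfold Cross at *; rwa [Set.inter_comm]

lemma Cross.swap_left {a b c d : Plane} (h : Cross a b c d) : Cross b a c d := by
  unfold Cross at *; rwa [openSegment_symm]

lemma Cross.swap_right {a b c d : Plane} (h : Cross a b c d) : Cross a b d c := by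
  unfold Cross at *; rwa [openSegment_symm ℝ d c]

lemma cross_of_signs {a b c d : Plane} (h1 : cr a b c * cr a b d < 0)
    (h2 : cr c d a * cr c d b < 0) : Cross a b c d := by
  have e : cr a b c - cr a b d = cr c d b - cr c d a := by unfold cr; ring
  set α := cr a b c with hα
  set β := cr a b d with hβ
  set γ := cr c d a with hγ
  set δ := cr c d b with hδ
  have hne : α - β ≠ 0 := by rintro h; rw [sub_eq_zero.1 h] at h1; nlinarith [mul_self_nonneg β]
  have hd0 : δ ≠ 0 := by rintro h; simp [h] at h2
  have hc0 : γ ≠ 0 := by rintro h; simp [h] at h2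
  have ha0 : α ≠ 0 := by rintro h; simp [h] at h1
  have hb0 : β ≠ 0 := by rintro h; simp [h] at h1
  have pos : ∀ u v : ℝ, u * v < 0 → u - v ≠ 0 → 0 < u / (u - v) := by
    intro u v huv hn
    rw [div_pos_iff]
    rcases lt_or_ge 0 u with hu | hu
    · left; exact ⟨hu, by nlinarith⟩
    · right; have : u < 0 := lt_of_le_of_ne hu (by rintro rfl; simp at huv)
      exact ⟨this, by nlinarith⟩
  have e3 : δ - γ ≠ 0 := by rwa [← e]
  -- The point on the line ab where `cr c d` vanishes, and the point on cd where `cr a b` vanishes;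
  -- the identity `e` makes them the same point.
  refine ⟨(δ / (δ - γ)) • a + (γ / (γ - δ)) • b,
    ⟨_, _, pos _ _ (by linarith) e3, pos _ _ (by linarith) (by intro h; apply e3; linarith), ?_, rfl⟩,
    ⟨β / (β - α), α / (α - β), pos _ _ (by linarith) (by intro h; apply hne; linarith),
      pos _ _ h1 hne, ?_, ?_⟩⟩
  · rw [show γ - δ = -(δ - γ) by ring]; field_simp; ring
  · rw [show β - α = -(α - β) by ring]; field_simp; ring
  · rw [show γ - δ = -(α - β) by linarith, show β - α = -(α - β) by ring, ← e]
    apply plane_ext <;>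
      simp only [PiLp.add_apply, PiLp.smul_apply, smul_eq_mul] <;> field_simp <;>
      rw [hα, hβ, hγ, hδ] <;> unfold cr <;> ring

lemma signs_of_cross {a b c d : Plane} (h : Cross a b c d) (hc : cr a b c ≠ 0) :
    cr a b c * cr a b d < 0 := by
  obtain ⟨x, ⟨s, t, hs, ht, hst, rfl⟩, ⟨s', t', hs', ht', hst', h⟩⟩ := h
  have := congrArg (cr a b) h
  rw [cr_comb _ _ _ _ hst, cr_comb _ _ _ _ hst', cr_self_left, cr_self_right] at this
  have h2 : 0 < cr a b c * cr a b c := mul_self_pos.2 hc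
  have : t' * (cr a b c * cr a b d) = - (s' * (cr a b c * cr a b c)) := by linear_combination cr a b c * this
  have h3 : 0 < s' * (cr a b c * cr a b c) := by positivity
  by_contra! h4
  nlinarith

lemma mem_convexHull_triple {a b c p : Plane} {s t u : ℝ} (hs : 0 ≤ s) (ht : 0 ≤ t) (hu : 0 ≤ u)
    (h : s + t + u = 1) (hp : s • a + t • b + u • c = p) :
    p ∈ convexHull ℝ ({a, b, c} : Set Plane) := by
  rw [convexHull_insert (by simp), convexHull_pair, mem_convexJoin]
  rcases eq_or_lt_of_le (by linarith : s ≤ 1) with h1 | h1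
  · refine ⟨a, by simp, b, left_mem_segment _ _ _, ?_⟩
    have : t = 0 := by linarith
    have : u = 0 := by linarith
    subst_vars; simp [left_mem_segment]
  · refine ⟨a, by simp, (t / (1 - s)) • b + (u / (1 - s)) • c,
      ⟨_, _, div_nonneg ht (by linarith), div_nonneg hu (by linarith), ?_, rfl⟩,
      ⟨s, 1 - s, hs, by linarith, by ring, ?_⟩⟩
    · rw [← add_div, div_eq_one_iff_eq (by linarith)]; linarith
    · have : 1 - s ≠ 0 := by linarith
      rw [← hp, smul_add, smul_smul, smul_smul, mul_div_cancel₀ _ this, mul_div_cancel₀ _ this,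
        add_assoc]

lemma mem_interior_triangle {a b c p : Plane} (h1 : 0 < cr a b p) (h2 : 0 < cr b c p)
    (h3 : 0 < cr c a p) : p ∈ interior (convexHull ℝ ({a, b, c} : Set Plane)) := by
  rw [mem_interior]
  refine ⟨{q | 0 < cr a b q} ∩ {q | 0 < cr b c q} ∩ {q | 0 < cr c a q}, ?_, ?_, ⟨⟨h1, h2⟩, h3⟩⟩
  · rintro q ⟨⟨g1, g2⟩, g3⟩
    simp only [Set.mem_ofPred_eq] at g1 g2 g3
    -- The three areas add up to the whole triangle, so their quotients by it are the barycentric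
    -- coordinates of q.
    have hD : cr a b q + cr b c q + cr c a q = cr a b c := by unfold cr; ring
    have hD0 : 0 < cr a b c := by linarith
    refine mem_convexHull_triple (s := cr b c q / cr a b c) (t := cr c a q / cr a b c)
      (u := cr a b q / cr a b c) (by positivity) (by positivity) (by positivity) ?_ ?_
    · rw [← add_div, ← add_div, div_eq_one_iff_eq hD0.ne']; linarith
    · apply plane_ext <;>
        simp only [PiLp.add_apply, PiLp.smul_apply, smul_eq_mul] <;> field_simp <;>
        unfold cr <;> ring
  · exact ((isOpen_lt continuous_const (continuous_cr _ _)).inter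
      (isOpen_lt continuous_const (continuous_cr _ _))).inter
      (isOpen_lt continuous_const (continuous_cr _ _))

/-- Two points on the same side of `ab`: the triangles over `ab` are nested or two of their sides
cross. -/
lemma same_side_cases {a b c p : Plane} (hs : 0 < cr a b c * cr a b p) (h1 : cr b c p ≠ 0)
    (h2 : cr a c p ≠ 0) :
    p ∈ interior (convexHull ℝ ({a, b, c} : Set Plane)) ∨
    c ∈ interior (convexHull ℝ ({a, b, p} : Set Plane)) ∨ Cross a p b c ∨ Cross b p a c := by
  have key : ∀ a b : Plane, 0 < cr a b c → 0 < cr a b p → cr b c p ≠ 0 → cr a c p ≠ 0 →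
      p ∈ interior (convexHull ℝ ({a, b, c} : Set Plane)) ∨
      c ∈ interior (convexHull ℝ ({a, b, p} : Set Plane)) ∨ Cross a p b c ∨ Cross b p a c := by
    intro a b hc hp h1 h2
    have e1 : cr c a p = -cr a c p := by unfold cr; ring
    -- The sides of bc and of ac on which p lies decide between the four outcomes.
    rcases lt_or_gt_of_ne h1 with h1 | h1 <;> rcases lt_or_gt_of_ne h2 with h2 | h2
    · right; right; left
      refine cross_of_signs ?_ ?_
      · rw [show cr a p b = -cr a b p by unfold cr; ring, show cr a p c = -cr a c p by unfold cr; ring]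
        nlinarith
      · rw [cr_rotate]; nlinarith
    · right; left
      refine mem_interior_triangle hc ?_ ?_
      · rw [show cr b p c = -cr b c p by unfold cr; ring]; linarith
      · rw [← cr_rotate]; linarith
    · left; exact mem_interior_triangle hp h1 (by linarith)
    · right; right; right
      refine cross_of_signs ?_ ?_
      · rw [cr_rotate, show cr b p c = -cr b c p by unfold cr; ring]; nlinarith
      · rw [show cr a c b = -cr a b c by unfold cr; ring]; nlinarith
  rcases lt_or_gt_of_ne (left_ne_zero_of_mul hs.ne') with h | h
  · have hp : cr a b p < 0 := by nlinarith
    rcases key b a (by rw [cr_swap]; linarith) (by rw [cr_swap]; linarith) h2 h1 with k | k | k | k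
    · left; rwa [Set.insert_comm] 
    · right; left; rwa [Set.insert_comm]
    · right; right; right; exact k
    · right; right; left; exact k
  · exact key a b h (by nlinarith) h1 h2

/-- In convex position, points on different sides of `ab` span a segment that crosses `ab`. -/
lemma cross_of_opposite {a b c d : Plane} (hs : cr a b c * cr a b d < 0)
    (ha : a ∉ interior (convexHull ℝ ({b, c, d} : Set Plane)))
    (hb : b ∉ interior (convexHull ℝ ({a, c, d} : Set Plane)))
    (h1 : cr c d a ≠ 0) (h2 : cr c d b ≠ 0) : Cross a b c d := by
  have key : ∀ c d : Plane, 0 < cr a b c → cr a b d < 0 →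
      a ∉ interior (convexHull ℝ ({b, c, d} : Set Plane)) →
      b ∉ interior (convexHull ℝ ({a, c, d} : Set Plane)) →
      cr c d a ≠ 0 → cr c d b ≠ 0 → Cross a b c d := by
    intro c d hc hd ha hb h1 h2
    refine cross_of_signs (by nlinarith) ?_
    -- If a were on the wrong side of cd, it would lie inside the triangle bcd; likewise b below.
    have h3 : cr c d a < 0 := by
      by_contra! h
      refine ha (mem_interior_triangle (by rwa [cr_rotate]) (lt_of_le_of_ne h h1.symm) ?_)
      rw [show cr d b a = -cr a b d by unfold cr; ring]; linarith
    have h4 : 0 < cr c d b := by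
      by_contra! h
      refine hb ?_
      rw [Set.insert_comm]
      refine mem_interior_triangle (a := c) (b := a) (c := d) ?_ ?_ ?_
      · rwa [show cr c a b = cr a b c by unfold cr; ring]
      · rw [show cr a d b = -cr a b d by unfold cr; ring]; linarith
      · rw [cr_swap]; have := lt_of_le_of_ne h h2; linarith
    nlinarith
  rcases lt_or_gt_of_ne (left_ne_zero_of_mul hs.ne) with h | h
  · refine (key d c (by nlinarith) h ?_ ?_ ?_ ?_).swap_right
    · rwa [Set.pair_comm]
    · rwa [Set.pair_comm]
    · rw [cr_swap]; simpa
    · rw [cr_swap]; simpa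
  · exact key c d h (by nlinarith) ha hb h1 h2

end PolyTri

/-! ### Convex hulls of finite sets without collinear triples. -/

namespace PolyTri

/-- No three points of `V` are collinear. -/
def NoThree (V : Set Plane) : Prop :=
  ∀ a ∈ V, ∀ b ∈ V, ∀ c ∈ V, a ≠ b → a ≠ c → b ≠ c → cr a b c ≠ 0

lemma NoThree.mono {V W : Set Plane} (h : NoThree V) (hW : W ⊆ V) : NoThree W :=
  fun a ha b hb c hc => h a (hW ha) b (hW hb) c (hW hc)

/-- A level set of a nonzero functional on the plane is a line. -/
lemma cr_eq_zero_of_functional {f : Plane →L[ℝ] ℝ} (hf : f ≠ 0) {a b c : Plane}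
    (hb : f b = f a) (hc : f c = f a) : cr a b c = 0 := by
  have hx : ∀ p : Plane, f p = p 0 * f (EuclideanSpace.single 0 1) +
      p 1 * f (EuclideanSpace.single 1 1) := by
    intro p
    have : p = p 0 • EuclideanSpace.single 0 (1 : ℝ) + p 1 • EuclideanSpace.single 1 (1 : ℝ) := by
      apply plane_ext <;> simp
    conv_lhs => rw [this]
    simp
  set u := f (EuclideanSpace.single 0 1)
  set v := f (EuclideanSpace.single 1 1)
  rw [hx b, hx a] at hb
  rw [hx c, hx a] at hc
  have huv : u ≠ 0 ∨ v ≠ 0 := by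
    by_contra! h
    exact hf (by ext p; rw [hx p, h.1, h.2]; simp)
  unfold cr
  rcases huv with h | h
  · apply mul_left_cancel₀ h; linear_combination (c 1 - a 1) * hb - (b 1 - a 1) * hc
  · apply mul_left_cancel₀ h; linear_combination (b 0 - a 0) * hc - (c 0 - a 0) * hb

section Hull

variable {V : Set Plane}

/-- Separate x from the open interior; the weak inequality passes to the whole hull because the hull
lies in the closure of its nonempty interior. -/
lemma exists_support (hi : (interior (convexHull ℝ V)).Nonempty)
    {x : Plane} (hx : x ∉ interior (convexHull ℝ V)) :
    ∃ f : Plane →L[ℝ] ℝ, f ≠ 0 ∧ (∀ y ∈ interior (convexHull ℝ V), f y < f x) ∧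
      ∀ y ∈ convexHull ℝ V, f y ≤ f x := by
  have hc := convex_convexHull ℝ V
  obtain ⟨f, hf⟩ := geometric_hahn_banach_open_point hc.interior isOpen_interior hx
  refine ⟨f, ?_, hf, ?_⟩
  · rintro rfl
    obtain ⟨y, hy⟩ := hi
    simpa using hf y hy
  · intro y hy
    have hy' : y ∈ closure (interior (convexHull ℝ V)) := by
      rw [hc.closure_interior_eq_closure_of_nonempty_interior hi]; exact subset_closure hy
    exact closure_minimal (s := interior (convexHull ℝ V)) (t := {y | f y ≤ f x})
      (fun z hz => (hf z hz).le) (isClosed_le f.continuous continuous_const) hy'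

lemma eq_of_openSegment_le {f : Plane →L[ℝ] ℝ} {a b x : Plane} (hx : x ∈ openSegment ℝ a b)
    (ha : f a ≤ f x) (hb : f b ≤ f x) : f a = f x ∧ f b = f x := by
  obtain ⟨s, t, hs, ht, hst, rfl⟩ := hx
  simp only [map_add, map_smul, smul_eq_mul] at *
  obtain rfl : s = 1 - t := by linarith
  constructor <;> nlinarith

lemma segment_subset_frontier (hV : V.Finite) {f : Plane →L[ℝ] ℝ} {x : Plane}
    (hf : ∀ y ∈ interior (convexHull ℝ V), f y < f x) {a b : Plane} (ha : a ∈ V) (hb : b ∈ V)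
    (hfa : f a = f x) (hfb : f b = f x) : segment ℝ a b ⊆ frontier (convexHull ℝ V) := by
  intro y hy
  rw [(hV.isClosed_convexHull (𝕜 := ℝ)).frontier_eq]
  refine ⟨(convex_convexHull ℝ V).segment_subset (subset_convexHull ℝ V ha)
    (subset_convexHull ℝ V hb) hy, fun h => ?_⟩
  have := hf y h
  obtain ⟨s, t, hs, ht, hst, rfl⟩ := hy
  simp only [map_add, map_smul, smul_eq_mul, hfa, hfb] at this
  rw [← add_mul, hst, one_mul] at this
  exact this.false

lemma mem_hullSides_iff {a b : Plane} : s(a, b) ∈ hullSides V ↔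
    a ∈ V ∧ b ∈ V ∧ a ≠ b ∧ segment ℝ a b ⊆ frontier (convexHull ℝ V) := by
  constructor
  · rintro ⟨a', ha, b', hb, hne, he, h⟩
    rcases Sym2.eq_iff.1 he with ⟨rfl, rfl⟩ | ⟨rfl, rfl⟩
    · exact ⟨ha, hb, hne, h⟩
    · exact ⟨hb, ha, hne.symm, by rwa [segment_symm]⟩
  · rintro ⟨ha, hb, hne, h⟩
    exact ⟨a, ha, b, hb, hne, rfl, h⟩

lemma mem_hullDiagonals_iff {a b : Plane} : s(a, b) ∈ hullDiagonals V ↔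
    a ∈ V ∧ b ∈ V ∧ a ≠ b ∧ openSegment ℝ a b ⊆ interior (convexHull ℝ V) := by
  constructor
  · rintro ⟨a', ha, b', hb, hne, he, h⟩
    rcases Sym2.eq_iff.1 he with ⟨rfl, rfl⟩ | ⟨rfl, rfl⟩
    · exact ⟨ha, hb, hne, h⟩
    · exact ⟨hb, ha, hne.symm, by rwa [openSegment_symm]⟩
  · rintro ⟨ha, hb, hne, h⟩
    exact ⟨a, ha, b, hb, hne, rfl, h⟩

lemma openSegment_nonempty (a b : Plane) : (openSegment ℝ a b).Nonempty :=
  ⟨_, 1 / 2, 1 / 2, by norm_num, by norm_num, by norm_num, rfl⟩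

/-- A supporting line at a point of ab outside the interior must contain all of ab, since its
functional is maximal at a relative interior point of ab. -/
lemma hullSide_or_hullDiagonal (hV : V.Finite) (hi : (interior (convexHull ℝ V)).Nonempty)
    {a b : Plane} (ha : a ∈ V) (hb : b ∈ V) (hab : a ≠ b) :
    s(a, b) ∈ hullSides V ∨ s(a, b) ∈ hullDiagonals V := by
  by_cases h : openSegment ℝ a b ⊆ interior (convexHull ℝ V)
  · exact Or.inr (mem_hullDiagonals_iff.2 ⟨ha, hb, hab, h⟩)
  · left
    obtain ⟨x, hx, hxi⟩ := Set.not_subset.1 h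
    obtain ⟨f, -, hf, hf'⟩ := exists_support hi hxi
    obtain ⟨h1, h2⟩ := eq_of_openSegment_le hx (hf' a (subset_convexHull ℝ V ha))
      (hf' b (subset_convexHull ℝ V hb))
    exact mem_hullSides_iff.2 ⟨ha, hb, hab, segment_subset_frontier hV hf ha hb h1 h2⟩

/-- A frontier point lies in the face cut out by a supporting line. The face is the hull of the
points of V on that line, of which there are at most two. -/
lemma frontier_cases (hV : V.Finite) (h3 : NoThree V)
    (hi : (interior (convexHull ℝ V)).Nonempty) {x : Plane}
    (hx : x ∈ frontier (convexHull ℝ V)) :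
    x ∈ V ∨ ∃ a b, s(a, b) ∈ hullSides V ∧ x ∈ openSegment ℝ a b := by
  rw [(hV.isClosed_convexHull (𝕜 := ℝ)).frontier_eq] at hx
  obtain ⟨hxK, hxi⟩ := hx
  obtain ⟨f, hf0, hf, hf'⟩ := exists_support hi hxi
  have hface : x ∈ convexHull ℝ {v ∈ V | f v = f x} := by
    have hxK' := hxK
    rw [← hV.coe_toFinset, Finset.mem_convexHull'] at hxK'
    obtain ⟨w, hw0, hw1, hwx⟩ := hxK'
    -- In a convex combination equal to x, only points where f is maximal can carry weight.
    have hsum : ∑ v ∈ hV.toFinset, w v * (f x - f v) = 0 := by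
      have := congrArg f hwx
      simp only [map_sum, map_smul, smul_eq_mul] at this
      simp only [mul_sub, Finset.sum_sub_distrib, this, ← Finset.sum_mul, hw1]; ring
    rw [Finset.sum_eq_zero_iff_of_nonneg (fun v hv => mul_nonneg (hw0 v hv) (by
      linarith [hf' v (subset_convexHull ℝ V (hV.mem_toFinset.1 hv))]))] at hsum
    classical
    have hsupp : ∀ v ∈ hV.toFinset, w v ≠ 0 → f v = f x := by
      intro v hv hw
      have := (mul_eq_zero.1 (hsum v hv)).resolve_left hw
      linarith
    refine convexHull_mono (s := ((hV.toFinset.filter (w · ≠ 0) : Finset Plane) : Set Plane)) ?_ ?_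
    · intro v hv
      simp only [Finset.coe_filter, Set.mem_ofPred_eq, Set.Finite.mem_toFinset] at hv
      exact ⟨hv.1, hsupp v (hV.mem_toFinset.2 hv.1) hv.2⟩
    · rw [Finset.mem_convexHull']
      refine ⟨w, fun v hv => hw0 v (Finset.mem_filter.1 hv).1, ?_, ?_⟩
      · rw [Finset.sum_filter_ne_zero]; exact hw1
      · rw [← hwx]
        refine Finset.sum_filter_of_ne fun v hv h h0 => h ?_
        rw [h0, zero_smul]
  obtain ⟨a, ha⟩ : {v ∈ V | f v = f x}.Nonempty := by
    rw [← convexHull_nonempty_iff (𝕜 := ℝ)]; exact ⟨x, hface⟩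
  by_cases hb : ∃ b ∈ V, f b = f x ∧ b ≠ a
  · obtain ⟨b, hbV, hb, hba⟩ := hb
    have hsub : {v ∈ V | f v = f x} ⊆ {a, b} := by
      rintro c ⟨hc, hfc⟩
      by_contra hcn
      simp only [Set.mem_insert_iff, Set.mem_singleton_iff, not_or] at hcn
      exact h3 a ha.1 b hbV c hc hba.symm (Ne.symm hcn.1) (Ne.symm hcn.2)
        (cr_eq_zero_of_functional hf0 (hb.trans ha.2.symm) (hfc.trans ha.2.symm))
    have hxs := convexHull_mono hsub hface
    rw [convexHull_pair, ← insert_endpoints_openSegment] at hxs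
    rcases hxs with rfl | rfl | hxs
    · exact Or.inl ha.1
    · exact Or.inl hbV
    · exact Or.inr ⟨a, b, mem_hullSides_iff.2 ⟨ha.1, hbV, hba.symm,
        segment_subset_frontier hV hf ha.1 hbV ha.2 hb⟩, hxs⟩
  · push Not at hb
    have hsub : {v ∈ V | f v = f x} ⊆ {a} := fun c hc => hb c hc.1 hc.2
    have hxs := convexHull_mono hsub hface
    rw [convexHull_singleton] at hxs
    rw [Set.mem_singleton_iff.1 hxs]; exact Or.inl ha.1

/-- Otherwise the hull lies in a closed half-plane of the line ab, but one can move a little from x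
perpendicularly to ab without leaving the hull. -/
lemma exists_cr_pos {a b x : Plane} (hab : a ≠ b) (hx : x ∈ openSegment ℝ a b)
    (hxi : x ∈ interior (convexHull ℝ V)) : ∃ p ∈ V, 0 < cr a b p := by
  by_contra! h
  have hK : convexHull ℝ V ⊆ {y | cr a b y ≤ 0} := by
    refine convexHull_min h ?_
    intro y hy z hz s t hs ht hst
    simp only [Set.mem_ofPred_eq] at *
    rw [cr_comb _ _ _ _ hst]
    nlinarith
  have hx0 : cr a b x = 0 := by
    obtain ⟨s, t, hs, ht, hst, rfl⟩ := hx
    rw [cr_comb _ _ _ _ hst, cr_self_left, cr_self_right]; simp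
  let g : ℝ → Plane := fun t => x + t • !₂[-(b 1 - a 1), b 0 - a 0]
  have hg : Continuous g := by fun_prop
  have hcr : ∀ t, cr a b (g t) = t * ((b 0 - a 0) ^ 2 + (b 1 - a 1) ^ 2) := by
    intro t
    have : cr a b (g t) = cr a b x + t * ((b 0 - a 0) ^ 2 + (b 1 - a 1) ^ 2) := by
      simp [g, cr]; ring
    rw [this, hx0, zero_add]
  have hpos : 0 < (b 0 - a 0) ^ 2 + (b 1 - a 1) ^ 2 := by
    by_contra! h
    have h0 : b 0 - a 0 = 0 := by nlinarith [sq_nonneg (b 0 - a 0), sq_nonneg (b 1 - a 1)]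
    have h1 : b 1 - a 1 = 0 := by nlinarith [sq_nonneg (b 0 - a 0), sq_nonneg (b 1 - a 1)]
    exact hab (plane_ext (by linarith) (by linarith))
  have hev : ∀ᶠ t in nhds (0 : ℝ), g t ∈ interior (convexHull ℝ V) :=
    hg.continuousAt.eventually (by simpa [g] using isOpen_interior.mem_nhds hxi)
  obtain ⟨t, ht, ht0⟩ :=
    ((hev.filter_mono nhdsWithin_le_nhds).and (self_mem_nhdsWithin (s := Set.Ioi 0))).exists
  have := hK (interior_subset ht)
  rw [Set.mem_ofPred_eq, hcr] at this
  have : 0 < t * ((b 0 - a 0) ^ 2 + (b 1 - a 1) ^ 2) := mul_pos ht0 hpos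
  linarith

lemma exists_cr_neg {a b x : Plane} (hab : a ≠ b) (hx : x ∈ openSegment ℝ a b)
    (hxi : x ∈ interior (convexHull ℝ V)) : ∃ p ∈ V, cr a b p < 0 := by
  obtain ⟨p, hp, h⟩ := exists_cr_pos hab.symm (by rwa [openSegment_symm]) hxi
  exact ⟨p, hp, by rw [cr_swap] at h; linarith⟩

/-- A supporting line at x would contain both segments, making a, b, c collinear. -/
lemma crossing_mem_interior (hi : (interior (convexHull ℝ V)).Nonempty) {a b c d x : Plane}
    (ha : a ∈ V) (hb : b ∈ V) (hc : c ∈ V) (hd : d ∈ V) (h1 : x ∈ openSegment ℝ a b)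
    (h2 : x ∈ openSegment ℝ c d) (h : cr a b c ≠ 0) : x ∈ interior (convexHull ℝ V) := by
  by_contra hx
  obtain ⟨f, hf0, -, hf'⟩ := exists_support hi hx
  obtain ⟨ha, hb⟩ := eq_of_openSegment_le h1 (hf' a (subset_convexHull ℝ V ha))
      (hf' b (subset_convexHull ℝ V hb))
  obtain ⟨hc, -⟩ := eq_of_openSegment_le h2 (hf' c (subset_convexHull ℝ V hc))
      (hf' d (subset_convexHull ℝ V hd))
  exact h (cr_eq_zero_of_functional hf0 (hb.trans ha.symm) (hc.trans ha.symm))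

lemma mem_hullDiagonals_of_mem_interior (hV : V.Finite) {a b x : Plane} (ha : a ∈ V) (hb : b ∈ V)
    (hab : a ≠ b) (hx : x ∈ openSegment ℝ a b) (hxi : x ∈ interior (convexHull ℝ V)) :
    s(a, b) ∈ hullDiagonals V := by
  refine (hullSide_or_hullDiagonal hV ⟨x, hxi⟩ ha hb hab).resolve_left fun h => ?_
  exact (mem_hullSides_iff.1 h).2.2.2 (openSegment_subset_segment ℝ a b hx) |>.2 hxi

lemma interior_nonempty_of_cr_ne {a b c : Plane} (ha : a ∈ V) (hb : b ∈ V) (hc : c ∈ V)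
    (h : cr a b c ≠ 0) : (interior (convexHull ℝ V)).Nonempty := by
  have key : ∀ a ∈ V, ∀ b ∈ V, 0 < cr a b c → (interior (convexHull ℝ V)).Nonempty := by
    intro a ha b hb h
    let p : Plane := (1 / 3 : ℝ) • a + (1 / 3 : ℝ) • b + (1 / 3 : ℝ) • c
    have e1 : cr a b p = cr a b c / 3 := by simp [p, cr]; ring
    have e2 : cr b c p = cr a b c / 3 := by simp [p, cr]; ring
    have e3 : cr c a p = cr a b c / 3 := by simp [p, cr]; ring
    refine ⟨p, interior_mono (convexHull_mono ?_) (mem_interior_triangle (a := a) (b := b)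
      (c := c) (by linarith) (by linarith) (by linarith))⟩
    rintro x (rfl | rfl | rfl) <;> assumption
  rcases lt_or_gt_of_ne h with h | h
  · exact key b hb a ha (by rw [cr_swap]; linarith)
  · exact key a ha b hb h

end Hull

end PolyTri

/-! ### The unbounded part of the complement of a closed curve. -/

namespace PolyTri

open Topology

variable {n : ℕ}

/-- The points off the set `C` whose component in the complement of `C` is unbounded. -/
def unboundedPart (C : Set Plane) : Set Plane :=
  {p | p ∉ C ∧ ¬ Bornology.IsBounded (connectedComponentIn Cᶜ p)}

lemma subset_unboundedPart {C S : Set Plane} (hS : IsPreconnected S) (hSC : S ⊆ Cᶜ) {y : Plane}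
    (hy : y ∈ S) (hyU : y ∈ unboundedPart C) : S ⊆ unboundedPart C := by
  intro z hz
  refine ⟨hSC hz, ?_⟩
  rw [← connectedComponentIn_eq (hS.subset_connectedComponentIn hy hSC hz)]
  exact hyU.2

lemma isOpen_unboundedPart {C : Set Plane} (hC : IsClosed C) : IsOpen (unboundedPart C) := by
  rw [isOpen_iff_mem_nhds]
  intro p hp
  have h1 : p ∈ connectedComponentIn Cᶜ p := mem_connectedComponentIn hp.1
  exact Filter.mem_of_superset (hC.isOpen_compl.connectedComponentIn.mem_nhds h1)
    (subset_unboundedPart isPreconnected_connectedComponentIn (connectedComponentIn_subset _ _)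
      h1 hp)

lemma mem_unboundedPart_of_ray {C : Set Plane} {p v : Plane} (hv : v ≠ 0)
    (h : ∀ t : ℝ, 0 ≤ t → p + t • v ∉ C) : p ∈ unboundedPart C := by
  have hp : p ∉ C := by simpa using h 0 le_rfl
  refine ⟨hp, fun hb => ?_⟩
  have hray : (fun t : ℝ => p + t • v) '' Set.Ici 0 ⊆ connectedComponentIn Cᶜ p := by
    refine IsPreconnected.subset_connectedComponentIn ?_ ⟨0, by simp, by simp⟩ ?_
    · exact isPreconnected_Ici.image _ (by fun_prop)
    · rintro _ ⟨t, ht, rfl⟩; exact h t ht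
  obtain ⟨R, hR⟩ := (hb.subset hray).exists_norm_le
  have hv' : 0 < ‖v‖ := norm_pos_iff.2 hv
  have h1 := hR _ ⟨(‖p‖ + |R| + 1) / ‖v‖, by simp only [Set.mem_Ici]; positivity, rfl⟩
  have h2 := norm_sub_norm_le (((‖p‖ + |R| + 1) / ‖v‖) • v) (-p)
  rw [norm_smul, Real.norm_of_nonneg (by positivity), div_mul_cancel₀ _ hv'.ne', norm_neg,
    sub_neg_eq_add, add_comm _ p] at h2
  have := le_abs_self R
  linarith

lemma unboundedPart_nonempty {C : Set Plane} (hC : Bornology.IsBounded C) :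
    (unboundedPart C).Nonempty := by
  obtain ⟨R, hR⟩ := hC.exists_norm_le
  refine ⟨!₂[|R| + 1, 0], mem_unboundedPart_of_ray (v := !₂[1, 0]) (fun h => ?_) fun t ht hm => ?_⟩
  · simpa using congrArg (fun q : Plane => q 0) h
  · have h1 := hR _ hm
    have h2 := PiLp.norm_apply_le (!₂[|R| + 1, 0] + t • !₂[1, 0] : Plane) 0
    simp only [PiLp.add_apply, PiLp.smul_apply, smul_eq_mul, Real.norm_eq_abs] at h2
    simp at h2
    have := le_abs_self R
    have := le_abs_self (|R| + 1 + t)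
    linarith

/-- A connected compact set that locally splits the plane into two connected parts, both of them
adherent to all of the set, lies in the closure of the unbounded part of its complement. -/
lemma subset_closure_unboundedPart {C : Set Plane} (hC : IsCompact C) (hne : C.Nonempty)
    (hconn : IsPreconnected C)
    (hloc : ∀ q ∈ C, ∃ O S₁ S₂ : Set Plane, IsOpen O ∧ q ∈ O ∧ IsPreconnected S₁ ∧
      IsPreconnected S₂ ∧ S₁ ⊆ Cᶜ ∧ S₂ ⊆ Cᶜ ∧ O \ C ⊆ S₁ ∪ S₂ ∧ C ∩ O ⊆ closure S₁ ∧
      C ∩ O ⊆ closure S₂) : C ⊆ closure (unboundedPart C) := by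
  set U := unboundedPart C
  have hUo : IsOpen U := isOpen_unboundedPart hC.isClosed
  -- Off C, components are open and lie either inside U or outside it.
  have hfr : frontier U ⊆ C := by
    intro q hq
    by_contra hqC
    have h1 : q ∈ connectedComponentIn Cᶜ q := mem_connectedComponentIn hqC
    obtain ⟨y, hy, hyU⟩ := mem_closure_iff.1 hq.1 _
      hC.isClosed.isOpen_compl.connectedComponentIn h1
    have := subset_unboundedPart isPreconnected_connectedComponentIn
      (connectedComponentIn_subset _ _) hy hyU h1
    exact hq.2 (by rwa [hUo.interior_eq])
  obtain ⟨q₀, hq₀⟩ : (frontier U).Nonempty := by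
    rw [nonempty_frontier_iff]
    refine ⟨unboundedPart_nonempty hC.isBounded, fun h => ?_⟩
    obtain ⟨c, hc⟩ := hne
    have : c ∈ U := h ▸ Set.mem_univ c
    exact this.1 hc
  have hloc' : ∀ q ∈ C ∩ closure U, ∃ O : Set Plane, IsOpen O ∧ q ∈ O ∧ C ∩ O ⊆ closure U := by
    rintro q ⟨hq, hqU⟩
    obtain ⟨O, S₁, S₂, hO, hqO, h1, h2, h1C, h2C, hsub, hc1, hc2⟩ := hloc q hq
    refine ⟨O, hO, hqO, ?_⟩
    obtain ⟨y, hyO, hyU⟩ := mem_closure_iff.1 hqU _ hO hqO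
    rcases hsub ⟨hyO, hyU.1⟩ with hy | hy
    · exact hc1.trans (closure_mono (subset_unboundedPart h1 h1C hy hyU))
    · exact hc2.trans (closure_mono (subset_unboundedPart h2 h2C hy hyU))
  choose! O hO hqO hCO using hloc'
  by_contra hcon
  obtain ⟨c, hc, hcU⟩ := Set.not_subset.1 hcon
  -- The part of C in the closure of U is nonempty, closed in C and, by `hloc'`, open in C;
  -- connectedness makes it all of C.
  obtain ⟨z, hzC, hz1, hz2⟩ := hconn (⋃ q ∈ C ∩ closure U, O q) (closure U)ᶜ
    (isOpen_biUnion fun q hq => hO q hq) isClosed_closure.isOpen_compl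
    (fun q hq => by
      by_cases h : q ∈ closure U
      · exact Or.inl (Set.mem_biUnion ⟨hq, h⟩ (hqO q ⟨hq, h⟩))
      · exact Or.inr h)
    ⟨q₀, hfr hq₀, Set.mem_biUnion ⟨hfr hq₀, hq₀.1⟩ (hqO q₀ ⟨hfr hq₀, hq₀.1⟩)⟩ ⟨c, hc, hcU⟩
  simp only [Set.mem_iUnion] at hz1
  obtain ⟨q, hq, hzq⟩ := hz1
  exact hz2 (hCO q hq ⟨hzC, hzq⟩)

lemma mem_closure_of_ray {S : Set Plane} {z v : Plane} {O : Set Plane} (hO : IsOpen O)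
    (hz : z ∈ O) (h : ∀ t : ℝ, 0 < t → z + t • v ∈ O → z + t • v ∈ S) : z ∈ closure S := by
  have hg : Continuous fun t : ℝ => z + t • v := by fun_prop
  have hO' : ∀ᶠ t in 𝓝[>] (0 : ℝ), z + t • v ∈ O :=
    (hg.continuousAt.eventually (by simpa using hO.mem_nhds hz)).filter_mono nhdsWithin_le_nhds
  have ht : Filter.Tendsto (fun t : ℝ => z + t • v) (𝓝[>] 0) (𝓝 z) := by
    have := (hg.tendsto 0).mono_left (nhdsWithin_le_nhds (s := Set.Ioi 0))
    simpa using this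
  refine mem_closure_of_tendsto ht ?_
  filter_upwards [hO', self_mem_nhdsWithin] with t h1 h2 using h t h2 h1

lemma convex_cr_pos (a b : Plane) : Convex ℝ {y | 0 < cr a b y} := by
  intro y hy z hz s t hs ht hst
  simp only [Set.mem_ofPred_eq] at *
  rw [cr_comb _ _ _ _ hst]
  rcases eq_or_lt_of_le hs with rfl | hs
  · simp_all
  · nlinarith [mul_pos hs hy, mul_nonneg ht hz.le]

lemma convex_cr_neg (a b : Plane) : Convex ℝ {y | cr a b y < 0} := by
  have : {y | cr a b y < 0} = {y | 0 < cr b a y} := by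
    ext y; simp only [Set.mem_ofPred_eq]; rw [cr_swap]; constructor <;> intro h <;> linarith
  rw [this]; exact convex_cr_pos b a

lemma mem_segment_of_coord {q a y : Plane} {s : ℝ} (h0 : 0 ≤ s) (h1 : s ≤ 1)
    (h : y = q + s • (a - q)) : y ∈ segment ℝ q a := by
  refine ⟨1 - s, s, by linarith, h0, by ring, ?_⟩
  rw [h, smul_sub, sub_smul, one_smul]; abel

/-- Near q the curve consists of two rays. The sector between them is convex; the other side is the
union of two overlapping convex pieces. -/
lemma local_split_vertex {C E : Set Plane} {q a b : Plane} (hE : IsClosed E) (hqE : q ∉ E)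
    (hC : C = segment ℝ q a ∪ segment ℝ q b ∪ E) (hD : cr q a b ≠ 0) :
    ∃ O S₁ S₂ : Set Plane, IsOpen O ∧ q ∈ O ∧ IsPreconnected S₁ ∧
      IsPreconnected S₂ ∧ S₁ ⊆ Cᶜ ∧ S₂ ⊆ Cᶜ ∧ O \ C ⊆ S₁ ∪ S₂ ∧ C ∩ O ⊆ closure S₁ ∧
      C ∩ O ⊆ closure S₂ := by
  wlog hpos : 0 < cr q a b generalizing a b
  · refine this (a := b) (b := a) (by rw [hC, Set.union_comm (segment ℝ q b)]) ?_ ?_ <;>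
      rw [show cr q b a = -cr q a b by unfold cr; ring]
    · simpa
    · have := lt_of_le_of_ne (not_lt.1 hpos) hD; linarith
  have hqa : q ≠ a := by rintro rfl; simp [cr] at hD
  have hqb : q ≠ b := by rintro rfl; simp [cr_self_left] at hD
  obtain ⟨r, hr, hrE⟩ := Metric.isOpen_iff.1 hE.isOpen_compl q hqE
  -- The disc avoids the rest of the curve and reaches no farther than a and b, so inside it the
  -- segments look like rays.
  set ρ := min r (min (dist a q) (dist b q)) with hρ
  have hρ0 : 0 < ρ := lt_min hr (lt_min (dist_pos.2 hqa.symm) (dist_pos.2 hqb.symm))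
  set O := Metric.ball q ρ with hO
  have hOE : ∀ y ∈ O, y ∉ E := fun y hy =>
    hrE (Metric.ball_subset_ball (min_le_left _ _) hy)
  -- Coordinates of y along the two rays.
  have hcoord : ∀ y : Plane, y = q + (cr b q y / cr q a b) • (a - q) +
      (cr q a y / cr q a b) • (b - q) := by
    intro y
    apply plane_ext <;>
      simp only [PiLp.add_apply, PiLp.smul_apply, PiLp.sub_apply, smul_eq_mul] <;> field_simp <;>
      unfold cr <;> ring
  have hseg1 : ∀ y ∈ segment ℝ q a, cr q a y = 0 ∧ 0 ≤ cr b q y := by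
    rintro y ⟨s, t, hs, ht, hst, rfl⟩
    rw [cr_comb _ _ _ _ hst, cr_comb _ _ _ _ hst, cr_self_left, cr_self_right, cr_self_right,
      ← cr_rotate b q a]
    exact ⟨by ring, by positivity⟩
  have hseg2 : ∀ y ∈ segment ℝ q b, cr b q y = 0 ∧ 0 ≤ cr q a y := by
    rintro y ⟨s, t, hs, ht, hst, rfl⟩
    rw [cr_comb _ _ _ _ hst, cr_comb _ _ _ _ hst, cr_self_left, cr_self_right, cr_self_left]
    exact ⟨by ring, by positivity⟩
  have hOC : ∀ y ∈ O, y ∈ C → (cr q a y = 0 ∧ 0 ≤ cr b q y) ∨ (cr b q y = 0 ∧ 0 ≤ cr q a y) := by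
    intro y hy hyC
    rw [hC] at hyC
    rcases hyC with (h | h) | h
    · exact Or.inl (hseg1 y h)
    · exact Or.inr (hseg2 y h)
    · exact absurd h (hOE y hy)
  have hlin1 : ∀ (z : Plane) (t : ℝ), cr q a (z + t • ((a - q) + (b - q))) =
      cr q a z + t * cr q a b := by intro z t; simp [cr]; ring
  have hlin2 : ∀ (z : Plane) (t : ℝ), cr b q (z + t • ((a - q) + (b - q))) =
      cr b q z + t * cr q a b := by intro z t; simp [cr]; ring
  have hlin3 : ∀ (z : Plane) (t : ℝ), cr q a (z + t • (-((a - q) + (b - q)))) =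
      cr q a z - t * cr q a b := by intro z t; simp [cr]; ring
  have hlin4 : ∀ (z : Plane) (t : ℝ), cr b q (z + t • (-((a - q) + (b - q)))) =
      cr b q z - t * cr q a b := by intro z t; simp [cr]; ring
  have hqO : q ∈ O := Metric.mem_ball_self hρ0
  have hOc : Convex ℝ O := convex_ball q ρ
  refine ⟨O, O ∩ ({y | 0 < cr b q y} ∩ {y | 0 < cr q a y}),
    O ∩ {y | cr b q y < 0} ∪ O ∩ {y | cr q a y < 0}, Metric.isOpen_ball, hqO, ?_, ?_, ?_, ?_,
    ?_, ?_, ?_⟩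
  · exact (hOc.inter ((convex_cr_pos _ _).inter (convex_cr_pos _ _))).isPreconnected
  · refine IsPreconnected.union' ?_ (hOc.inter (convex_cr_neg _ _)).isPreconnected
      (hOc.inter (convex_cr_neg _ _)).isPreconnected
    -- The two pieces overlap: points just behind q, opposite to the sector, lie in both.
    have : q ∈ closure (O ∩ {y | cr b q y < 0} ∩ (O ∩ {y | cr q a y < 0})) := by
      refine mem_closure_of_ray Metric.isOpen_ball hqO (v := -((a - q) + (b - q))) ?_
      intro t ht hmem
      have := mul_pos ht hpos
      refine ⟨⟨hmem, ?_⟩, hmem, ?_⟩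
      · rw [Set.mem_ofPred_eq, hlin4, cr_self_right]; linarith
      · rw [Set.mem_ofPred_eq, hlin3, cr_self_left]; linarith
    exact closure_nonempty_iff.1 ⟨q, this⟩
  · rintro y ⟨hy, h1, h2⟩ hyC
    simp only [Set.mem_ofPred_eq] at h1 h2
    rcases hOC y hy hyC with h | h <;> linarith [h.1]
  · rintro y (⟨hy, h1⟩ | ⟨hy, h1⟩) hyC <;> simp only [Set.mem_ofPred_eq] at h1 <;>
      rcases hOC y hy hyC with h | h <;> linarith [h.1, h.2]
  · rintro y ⟨hy, hyC⟩
    by_contra hcon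
    simp only [Set.mem_union, Set.mem_inter_iff, Set.mem_ofPred_eq, not_or, not_and, not_lt] at hcon
    obtain ⟨h1, h2, h3⟩ := hcon
    have h2 := h2 hy
    have h3 := h3 hy
    apply hyC
    rw [hC]
    left
    rw [hO, Metric.mem_ball, dist_eq_norm] at hy
    rcases eq_or_lt_of_le h2 with h0 | h0
    · right
      have hc := hcoord y
      rw [← h0, zero_div, zero_smul, add_zero] at hc
      refine mem_segment_of_coord (by positivity) ?_ hc
      by_contra! hgt
      have : y - q = (cr q a y / cr q a b) • (b - q) := by rw [sub_eq_iff_eq_add']; exact hc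
      rw [this, norm_smul, Real.norm_of_nonneg (by positivity), ← dist_eq_norm] at hy
      have hb : ρ ≤ dist b q := (min_le_right _ _).trans (min_le_right _ _)
      nlinarith [dist_nonneg (x := b) (y := q)]
    · left
      have h0' : cr q a y = 0 := le_antisymm (h1 hy h0) h3
      have hc := hcoord y
      rw [h0', zero_div, zero_smul, add_zero] at hc
      refine mem_segment_of_coord (by positivity) ?_ hc
      by_contra! hgt
      have : y - q = (cr b q y / cr q a b) • (a - q) := by rw [sub_eq_iff_eq_add']; exact hc
      rw [this, norm_smul, Real.norm_of_nonneg (by positivity), ← dist_eq_norm] at hy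
      have hb : ρ ≤ dist a q := (min_le_right _ _).trans (min_le_left _ _)
      nlinarith [dist_nonneg (x := a) (y := q)]
  · rintro z ⟨hzC, hzO⟩
    refine mem_closure_of_ray Metric.isOpen_ball hzO (v := ((a - q) + (b - q))) ?_
    intro t ht hmem
    have := mul_pos ht hpos
    refine ⟨hmem, ?_, ?_⟩ <;> rw [Set.mem_ofPred_eq]
    · rw [hlin2]; rcases hOC z hzO hzC with h | h <;> linarith [h.1, h.2]
    · rw [hlin1]; rcases hOC z hzO hzC with h | h <;> linarith [h.1, h.2]
  · rintro z ⟨hzC, hzO⟩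
    refine mem_closure_of_ray Metric.isOpen_ball hzO (v := -((a - q) + (b - q))) ?_
    intro t ht hmem
    have := mul_pos ht hpos
    rcases hOC z hzO hzC with h | h
    · refine Or.inr ⟨hmem, ?_⟩
      rw [Set.mem_ofPred_eq, hlin3]; linarith [h.1]
    · refine Or.inl ⟨hmem, ?_⟩
      rw [Set.mem_ofPred_eq, hlin4]; linarith [h.1]

lemma local_split_side {C E : Set Plane} {q a b : Plane} (hE : IsClosed E) (hqE : q ∉ E)
    (hC : C = segment ℝ a b ∪ E) (hab : a ≠ b) (hq : q ∈ openSegment ℝ a b) :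
    ∃ O S₁ S₂ : Set Plane, IsOpen O ∧ q ∈ O ∧ IsPreconnected S₁ ∧
      IsPreconnected S₂ ∧ S₁ ⊆ Cᶜ ∧ S₂ ⊆ Cᶜ ∧ O \ C ⊆ S₁ ∪ S₂ ∧ C ∩ O ⊆ closure S₁ ∧
      C ∩ O ⊆ closure S₂ := by
  obtain ⟨r, hr, hrE⟩ := Metric.isOpen_iff.1 hE.isOpen_compl q hqE
  set N : ℝ := (b 0 - a 0) ^ 2 + (b 1 - a 1) ^ 2 with hN
  have hNpos : 0 < N := by
    by_contra! h
    have h0 : b 0 - a 0 = 0 := by nlinarith [sq_nonneg (b 0 - a 0), sq_nonneg (b 1 - a 1)]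
    have h1 : b 1 - a 1 = 0 := by nlinarith [sq_nonneg (b 0 - a 0), sq_nonneg (b 1 - a 1)]
    exact hab (plane_ext (by linarith) (by linarith))
  -- The scaled coordinate along ab. Restricting to 0 < d < N cuts off the ends, so that within O
  -- the curve is exactly the line ab.
  let d : Plane → ℝ := fun y => (y 0 - a 0) * (b 0 - a 0) + (y 1 - a 1) * (b 1 - a 1)
  have hdc : Continuous d := by fun_prop
  have hdcomb : ∀ (y z : Plane) (s t : ℝ), s + t = 1 → d (s • y + t • z) = s * d y + t * d z := by
    intro y z s t hst
    obtain rfl : t = 1 - s := by linarith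
    simp [d]; ring
  have hda : d a = 0 := by simp [d]
  have hdb : d b = N := by simp [d, hN]; ring
  set O := Metric.ball q r ∩ {y | 0 < d y ∧ d y < N} with hO
  have hOo : IsOpen O := Metric.isOpen_ball.inter
    ((isOpen_lt continuous_const hdc).inter (isOpen_lt hdc continuous_const))
  have hOc : Convex ℝ O := by
    refine (convex_ball q r).inter ?_
    rintro y ⟨hy1, hy2⟩ z ⟨hz1, hz2⟩ s t hs ht hst
    obtain rfl : s = 1 - t := by linarith
    simp only [Set.mem_ofPred_eq]
    rw [hdcomb _ _ _ _ hst]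
    rcases eq_or_lt_of_le ht with rfl | ht
    · simp; exact ⟨hy1, hy2⟩
    · constructor <;> nlinarith
  have hqO : q ∈ O := by
    refine ⟨Metric.mem_ball_self hr, ?_⟩
    obtain ⟨s, t, hs, ht, hst, rfl⟩ := hq
    simp only [Set.mem_ofPred_eq]
    rw [hdcomb _ _ _ _ hst, hda, hdb]
    obtain rfl : s = 1 - t := by linarith
    constructor <;> nlinarith [mul_pos ht hNpos, mul_pos hs hNpos]
  have hOC : ∀ y ∈ O, y ∈ C → cr a b y = 0 := by
    intro y hy hyC
    rw [hC] at hyC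
    rcases hyC with ⟨s, t, hs, ht, hst, rfl⟩ | h
    · rw [cr_comb _ _ _ _ hst, cr_self_left, cr_self_right]; ring
    · exact absurd h (hrE hy.1)
  have hOC' : ∀ y ∈ O, cr a b y = 0 → y ∈ C := by
    intro y hy h0
    rw [hC]
    left
    refine mem_segment_of_coord (s := d y / N) (div_nonneg hy.2.1.le hNpos.le)
      (by rw [div_le_one hNpos]; exact hy.2.2.le) ?_
    apply plane_ext <;>
      simp only [PiLp.add_apply, PiLp.smul_apply, PiLp.sub_apply, smul_eq_mul] <;> field_simp <;>
      simp only [hN, d] <;> unfold cr at h0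
    · linear_combination -(b 1 - a 1) * h0
    · linear_combination (b 0 - a 0) * h0
  let v : Plane := !₂[-(b 1 - a 1), b 0 - a 0]
  have hlin : ∀ (z : Plane) (t : ℝ), cr a b (z + t • v) = cr a b z + t * N := by
    intro z t; simp [cr, v, hN]; ring
  have hlin' : ∀ (z : Plane) (t : ℝ), cr a b (z + t • -v) = cr a b z - t * N := by
    intro z t; simp [cr, v, hN]; ring
  refine ⟨O, O ∩ {y | 0 < cr a b y}, O ∩ {y | cr a b y < 0}, hOo, hqO,
    (hOc.inter (convex_cr_pos _ _)).isPreconnected,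
    (hOc.inter (convex_cr_neg _ _)).isPreconnected, ?_, ?_, ?_, ?_, ?_⟩
  · rintro y ⟨hy, h⟩ hyC; exact h.ne' (hOC y hy hyC)
  · rintro y ⟨hy, h⟩ hyC; exact h.ne (hOC y hy hyC)
  · rintro y ⟨hy, hyC⟩
    rcases lt_trichotomy (cr a b y) 0 with h | h | h
    · exact Or.inr ⟨hy, h⟩
    · exact absurd (hOC' y hy h) hyC
    · exact Or.inl ⟨hy, h⟩
  · rintro z ⟨hzC, hzO⟩
    refine mem_closure_of_ray hOo hzO (v := v) fun t ht hmem => ⟨hmem, ?_⟩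
    have := mul_pos ht hNpos
    rw [Set.mem_ofPred_eq, hlin, hOC z hzO hzC]; linarith
  · rintro z ⟨hzC, hzO⟩
    refine mem_closure_of_ray hOo hzO (v := -v) fun t ht hmem => ⟨hmem, ?_⟩
    have := mul_pos ht hNpos
    rw [Set.mem_ofPred_eq, hlin', hOC z hzO hzC]; linarith

end PolyTri

/-! ### Boundary and interior of a simple polygon. -/

namespace PolyTri

open Topology

variable {n : ℕ} {P : Polygon Plane n}

lemma edgeSet_eq (P : Polygon Plane n) (i : Fin n) :
    P.edgeSet ℝ i = segment ℝ (P i) (P (finRotate n i)) := affineSegment_eq_segment ℝ _ _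

lemma mem_boundary {x : Plane} :
    x ∈ P.boundary ℝ ↔ ∃ i, x ∈ segment ℝ (P i) (P (finRotate n i)) := by
  simp [Polygon.boundary, edgeSet_eq]

lemma isCompact_segment (a b : Plane) : IsCompact (segment ℝ a b) := by
  rw [segment_eq_image_lineMap]
  exact isCompact_Icc.image AffineMap.lineMap_continuous

lemma isCompact_boundary (P : Polygon Plane n) : IsCompact (P.boundary ℝ) := by
  unfold Polygon.boundary
  exact isCompact_iUnion fun i => by rw [edgeSet_eq]; exact isCompact_segment _ _

lemma vertex_mem_boundary (P : Polygon Plane n) (i : Fin n) : P i ∈ P.boundary ℝ :=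
  mem_boundary.2 ⟨i, left_mem_segment _ _ _⟩

lemma finRotate_ne {n : ℕ} (hn : 3 ≤ n) (i : Fin n) :
    finRotate n i ≠ i ∧ finRotate n (finRotate n i) ≠ i := by
  obtain ⟨m, rfl⟩ : ∃ m, n = m + 1 := ⟨n - 1, by omega⟩
  have hi := i.2
  constructor <;> intro h <;> have h := congrArg Fin.val h <;>
    simp only [coe_finRotate, Fin.ext_iff, Fin.val_last] at h <;> split_ifs at h <;> omega

lemma isPreconnected_boundary (hn : 3 ≤ n) (P : Polygon Plane n) :
    IsPreconnected (P.boundary ℝ) := by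
  unfold Polygon.boundary
  obtain ⟨m, rfl⟩ : ∃ m, n = m + 1 := ⟨n - 1, by omega⟩
  refine IsPreconnected.iUnion_of_chain (fun i => ?_) (fun i => ?_)
  · rw [edgeSet_eq]; exact (convex_segment _ _).isPreconnected
  · rw [edgeSet_eq, edgeSet_eq]
    -- `Order.succ` fixes the last index, where the chain condition is trivial; the closing pair of
    -- sides is not needed for connectedness.
    by_cases hi : i = Fin.last m
    · have : Order.succ i = i := by
        rw [Order.succ_eq_iff_isMax, hi]; exact fun j _ => Fin.le_last j
      rw [this, Set.inter_self]; exact ⟨_, left_mem_segment _ _ _⟩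
    · have : Order.succ i = finRotate (m + 1) i := by
        have hlt : i < Fin.last m := lt_of_le_of_ne (Fin.le_last i) hi
        rw [finRotate_apply]
        refine (Order.succ_eq_of_covBy ?_)
        have hv : (i + 1).val = i.val + 1 := Fin.val_add_one_of_lt hlt
        constructor
        · rw [Fin.lt_def]; omega
        · intro c h1 h2; rw [Fin.lt_def] at h1 h2; omega
      rw [this]
      exact ⟨_, right_mem_segment _ _ _, left_mem_segment _ _ _⟩

/-- A simple polygon in general position. -/
structure Good (P : Polygon Plane n) : Prop where
  simple : IsSimple P
  general : InGeneralPosition P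

namespace Good

lemma noThree (hP : Good P) : NoThree (Set.range P.vertices) := by
  rintro _ ⟨i, rfl⟩ _ ⟨j, rfl⟩ _ ⟨k, rfl⟩ hij hik hjk h
  refine hP.general i j k ?_ ?_ ?_ (collinear_of_cr_eq_zero h) <;> rintro rfl <;> simp at *

/-- Near a relative interior point of a side there is no other side, and near a vertex only its two
sides, so the curve splits the plane locally as `subset_closure_unboundedPart` requires. -/
lemma boundary_subset_closure (hP : Good P) :
    P.boundary ℝ ⊆ closure (unboundedPart (P.boundary ℝ)) := by
  have hn := hP.simple.three_le
  have hclosed : ∀ J : Set (Fin n), IsClosed (⋃ j ∈ J, P.edgeSet ℝ j) := fun J =>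
    J.toFinite.isClosed_biUnion fun j _ => by rw [edgeSet_eq]; exact (isCompact_segment _ _).isClosed
  refine subset_closure_unboundedPart (isCompact_boundary P)
    ⟨_, vertex_mem_boundary P ⟨0, by omega⟩⟩ (isPreconnected_boundary hn P) fun q hq => ?_
  have hvertex : ∀ i, q = P (finRotate n i) → ∃ O S₁ S₂ : Set Plane, IsOpen O ∧ q ∈ O ∧
      IsPreconnected S₁ ∧ IsPreconnected S₂ ∧ S₁ ⊆ (P.boundary ℝ)ᶜ ∧ S₂ ⊆ (P.boundary ℝ)ᶜ ∧
      O \ P.boundary ℝ ⊆ S₁ ∪ S₂ ∧ P.boundary ℝ ∩ O ⊆ closure S₁ ∧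
      P.boundary ℝ ∩ O ⊆ closure S₂ := by
    rintro i rfl
    set j := finRotate n i with hj
    set k := finRotate n j with hk
    have hij : i ≠ j := (finRotate_ne hn i).1.symm
    have hik : i ≠ k := (finRotate_ne hn i).2.symm
    have hjk : j ≠ k := (finRotate_ne hn j).1.symm
    refine local_split_vertex (a := P i) (b := P k) (E := ⋃ l ∈ ({i, j}ᶜ : Set (Fin n)),
      P.edgeSet ℝ l) (hclosed _) ?_ ?_ ?_
    · simp only [Set.mem_iUnion, not_exists]
      rintro l hl hql
      simp only [Set.mem_compl_iff, Set.mem_insert_iff, Set.mem_singleton_iff, not_or] at hl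
      have := (hP.simple.inter_subset i l (Ne.symm hl.1)
        ⟨by rw [edgeSet_eq]; exact right_mem_segment _ _ _, hql⟩).2
      simp only [Set.mem_insert_iff, Set.mem_singleton_iff] at this
      rcases this with h | h
      · exact hl.2 (hP.simple.injective h).symm
      · exact hl.1 ((finRotate n).injective (hP.simple.injective h)).symm
    · rw [Polygon.boundary, segment_symm, ← edgeSet_eq, ← edgeSet_eq]
      ext x
      simp only [Set.mem_iUnion, Set.mem_union, Set.mem_compl_iff, Set.mem_insert_iff,
        Set.mem_singleton_iff, not_or]
      constructor
      · rintro ⟨l, hl⟩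
        by_cases h1 : l = i
        · subst h1; exact Or.inl (Or.inl hl)
        by_cases h2 : l = j
        · subst h2; exact Or.inl (Or.inr hl)
        exact Or.inr ⟨l, ⟨h1, h2⟩, hl⟩
      · rintro ((h | h) | ⟨l, -, h⟩) <;> exact ⟨_, h⟩
    · exact fun h => hP.general j i k hij.symm hjk hik (collinear_of_cr_eq_zero h)
  obtain ⟨i, hi⟩ := mem_boundary.1 hq
  rw [← insert_endpoints_openSegment] at hi
  rcases hi with rfl | rfl | hi
  · exact hvertex ((finRotate n).symm i) (by rw [Equiv.apply_symm_apply])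
  · exact hvertex i rfl
  · have hne : P i ≠ P (finRotate n i) := fun h =>
      (finRotate_ne hn i).1.symm (hP.simple.injective h)
    refine local_split_side (a := P i) (b := P (finRotate n i))
      (E := ⋃ l ∈ ({i}ᶜ : Set (Fin n)), P.edgeSet ℝ l) (hclosed _) ?_ ?_ hne hi
    · simp only [Set.mem_iUnion, not_exists]
      rintro l hl hql
      have := (hP.simple.inter_subset i l (Ne.symm hl)
        ⟨by rw [edgeSet_eq]; exact openSegment_subset_segment _ _ _ hi, hql⟩).1
      simp only [Set.mem_insert_iff, Set.mem_singleton_iff] at this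
      rcases this with h | h <;> rw [h] at hi
      · exact hne (left_mem_openSegment_iff.1 hi)
      · exact hne (right_mem_openSegment_iff.1 hi)
    · rw [Polygon.boundary, ← edgeSet_eq]
      ext x
      simp only [Set.mem_iUnion, Set.mem_union, Set.mem_compl_iff, Set.mem_singleton_iff]
      constructor
      · rintro ⟨l, hl⟩
        by_cases h1 : l = i
        · subst h1; exact Or.inl hl
        exact Or.inr ⟨l, h1, hl⟩
      · rintro (h | ⟨l, -, h⟩) <;> exact ⟨_, h⟩

end Good

lemma mem_interiorRegion_or {x : Plane} (hx : x ∉ P.boundary ℝ) :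
    x ∈ interiorRegion P ∨ x ∈ unboundedPart (P.boundary ℝ) := by
  by_cases h : Bornology.IsBounded (connectedComponentIn (P.boundary ℝ)ᶜ x)
  · exact Or.inl ⟨hx, h⟩
  · exact Or.inr ⟨hx, h⟩

lemma disjoint_unboundedPart {x : Plane} (hx : x ∈ interiorRegion P) :
    x ∉ unboundedPart (P.boundary ℝ) := fun h => h.2 hx.2

/-- A bounded set whose frontier consists of boundary points and interior points of the polygon
contains no point of the unbounded part in its interior. -/
lemma not_mem_unboundedPart_of_frontier {K : Set Plane} (hK : Bornology.IsBounded K)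
    (hfr : ∀ x ∈ frontier K, x ∈ P.boundary ℝ ∨ x ∈ interiorRegion P) {x : Plane}
    (hx : x ∈ interior K) : x ∉ unboundedPart (P.boundary ℝ) := by
  intro hU
  set S := connectedComponentIn (P.boundary ℝ)ᶜ x with hS
  have hxS : x ∈ S := mem_connectedComponentIn hU.1
  have hSU : S ⊆ unboundedPart (P.boundary ℝ) := subset_unboundedPart
    isPreconnected_connectedComponentIn (connectedComponentIn_subset _ _) hxS hU
  have hSK : S ⊆ interior K := by
    refine isPreconnected_connectedComponentIn.subset_of_closure_inter_subset isOpen_interior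
      ⟨x, hxS, hx⟩ ?_
    rintro y ⟨hy, hyS⟩
    by_contra hyi
    have hyf : y ∈ frontier K := ⟨closure_mono interior_subset hy, hyi⟩
    rcases hfr y hyf with h | h
    · exact (hSU hyS).1 h
    · exact disjoint_unboundedPart h (hSU hyS)
  exact hU.2 (hK.subset (hSK.trans interior_subset))

/-- The interior of K contains no point of the unbounded part. Being open, it also contains no
boundary point of P, since those are limits of the unbounded part. -/
lemma Good.interior_subset_interiorRegion (hP : Good P) {K : Set Plane}
    (hK : Bornology.IsBounded K)
    (hfr : ∀ x ∈ frontier K, x ∈ P.boundary ℝ ∨ x ∈ interiorRegion P) :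
    interior K ⊆ interiorRegion P := by
  intro x hx
  refine (mem_interiorRegion_or fun hxb => ?_).resolve_right
    (not_mem_unboundedPart_of_frontier hK hfr hx)
  obtain ⟨y, hy, hyU⟩ := mem_closure_iff.1 (hP.boundary_subset_closure hxb) _ isOpen_interior hx
  exact not_mem_unboundedPart_of_frontier hK hfr hy hyU

end PolyTri

/-! ### Edges of a triangulation and the convex regions they bound. -/

namespace PolyTri

variable {n : ℕ} {P : Polygon Plane n} {T : Finset (Sym2 Plane)}

@[simp] lemma openSeg_mk (a b : Plane) : openSeg s(a, b) = openSegment ℝ a b := rfl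

lemma openSeg_nonempty (e : Sym2 Plane) : (openSeg e).Nonempty := by
  induction e with | _ a b => exact openSegment_nonempty a b

lemma cross_iff_not_disjoint {a b c d : Plane} :
    Cross a b c d ↔ ¬ Disjoint (openSeg s(a, b)) (openSeg s(c, d)) := by
  rw [Set.not_disjoint_iff_nonempty_inter]; rfl

lemma mem_diagonals_iff (hP : Good P) {a b : Plane} : s(a, b) ∈ diagonals P ↔
    a ∈ Set.range P.vertices ∧ b ∈ Set.range P.vertices ∧ a ≠ b ∧
      openSegment ℝ a b ⊆ interiorRegion P := by
  constructor
  · rintro ⟨i, j, hij, he, h⟩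
    have hne : P i ≠ P j := fun h => hij (hP.simple.injective h)
    rcases Sym2.eq_iff.1 he with ⟨rfl, rfl⟩ | ⟨rfl, rfl⟩
    · exact ⟨⟨i, rfl⟩, ⟨j, rfl⟩, hne, h⟩
    · exact ⟨⟨j, rfl⟩, ⟨i, rfl⟩, hne.symm, h⟩
  · rintro ⟨⟨i, rfl⟩, ⟨j, rfl⟩, hne, h⟩
    exact ⟨i, j, fun h => hne (h ▸ rfl), rfl, h⟩

lemma range_subset_boundary : Set.range P.vertices ⊆ P.boundary ℝ := by
  rintro _ ⟨i, rfl⟩; exact vertex_mem_boundary P i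

lemma openSeg_side_subset {e : Sym2 Plane} (he : e ∈ sides P) : openSeg e ⊆ P.boundary ℝ := by
  obtain ⟨i, rfl⟩ := he
  exact fun x hx => mem_boundary.2 ⟨i, openSegment_subset_segment _ _ _ hx⟩

lemma not_mem_sides_of_diagonal {e : Sym2 Plane} (he : e ∈ diagonals P) : e ∉ sides P := by
  intro hs
  obtain ⟨x, hx⟩ := openSeg_nonempty e
  obtain ⟨i, j, -, rfl, h⟩ := he
  exact (h hx).1 (openSeg_side_subset hs hx)

lemma mem_openSegment_trans {p q x y : Plane} (hx : x ∈ openSegment ℝ p q)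
    (hy : y ∈ openSegment ℝ x p) : y ∈ openSegment ℝ p q := by
  obtain ⟨u, v, hu, hv, huv, rfl⟩ := hx
  obtain ⟨s, t, hs, ht, hst, rfl⟩ := hy
  refine ⟨s * u + t, s * v, by positivity, by positivity, ?_, ?_⟩
  · linear_combination s * huv + hst
  · rw [smul_add, smul_smul, smul_smul, add_smul]; abel

namespace Good

lemma side_ne (hP : Good P) (i : Fin n) : P i ≠ P (finRotate n i) := fun h =>
  (finRotate_ne hP.simple.three_le i).1.symm (hP.simple.injective h)

lemma vertex_not_mem_openSegment (hP : Good P) {a b v : Plane} (ha : a ∈ Set.range P.vertices)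
    (hb : b ∈ Set.range P.vertices) (hv : v ∈ Set.range P.vertices) (hab : a ≠ b) :
    v ∉ openSegment ℝ a b := by
  intro h
  have hva : v ≠ a := by rintro rfl; exact hab (left_mem_openSegment_iff.1 h)
  have hvb : v ≠ b := by rintro rfl; exact hab (right_mem_openSegment_iff.1 h)
  refine hP.noThree a ha b hb v hv hab hva.symm hvb.symm ?_
  obtain ⟨s, t, hs, ht, hst, rfl⟩ := h
  rw [cr_comb _ _ _ _ hst, cr_self_left, cr_self_right]; ring

lemma edge_ends (hP : Good P) (hT : IsNonCrossing P T) {a b : Plane} (h : s(a, b) ∈ edges P T) :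
    a ∈ Set.range P.vertices ∧ b ∈ Set.range P.vertices ∧ a ≠ b := by
  rcases h with ⟨i, h⟩ | h
  · rcases Sym2.eq_iff.1 h with ⟨rfl, rfl⟩ | ⟨rfl, rfl⟩
    · exact ⟨⟨_, rfl⟩, ⟨_, rfl⟩, hP.side_ne i⟩
    · exact ⟨⟨_, rfl⟩, ⟨_, rfl⟩, (hP.side_ne i).symm⟩
  · have := (mem_diagonals_iff hP).1 (hT.subset_diagonals _ h)
    exact ⟨this.1, this.2.1, this.2.2.1⟩

lemma edges_disjoint (hP : Good P) (hT : IsNonCrossing P T) {e f : Sym2 Plane}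
    (he : e ∈ edges P T) (hf : f ∈ edges P T) (hne : e ≠ f) :
    Disjoint (openSeg e) (openSeg f) := by
  have hmix : ∀ e f : Sym2 Plane, e ∈ sides P → f ∈ T → Disjoint (openSeg e) (openSeg f) := by
    intro e f he hf
    obtain ⟨i, j, -, -, h⟩ := hT.subset_diagonals f hf
    exact Set.disjoint_left.2 fun x hx hx' => (h hx').1 (openSeg_side_subset he hx)
  rcases he with he | he <;> rcases hf with hf | hf
  · obtain ⟨i, rfl⟩ := he
    obtain ⟨j, rfl⟩ := hf
    have hij : i ≠ j := by rintro rfl; exact hne rfl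
    refine Set.disjoint_left.2 fun x hx hx' => ?_
    have := (hP.simple.inter_subset i j hij ⟨by
      rw [edgeSet_eq]; exact openSegment_subset_segment _ _ _ hx, by
      rw [edgeSet_eq]; exact openSegment_subset_segment _ _ _ hx'⟩).1
    simp only [Set.mem_insert_iff, Set.mem_singleton_iff] at this
    rcases this with rfl | rfl
    · exact hP.side_ne i (left_mem_openSegment_iff.1 hx)
    · exact hP.side_ne i (right_mem_openSegment_iff.1 hx)
  · exact hmix e f he hf
  · exact (hmix f e hf he).symm
  · exact hT.disjoint e he f hf hne

lemma not_cross_edges (hP : Good P) (hT : IsNonCrossing P T) {a b c d : Plane}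
    (he : s(a, b) ∈ edges P T) (hf : s(c, d) ∈ edges P T) (hne : s(a, b) ≠ s(c, d)) :
    ¬ Cross a b c d := by
  rw [cross_iff_not_disjoint, not_not]; exact hP.edges_disjoint hT he hf hne

/-- The frontier of the hull is covered by vertices, sides of P and diagonals, so it never meets the
unbounded part. -/
lemma region_subset (hP : Good P) (hT : IsNonCrossing P T) {V : Set Plane}
    (hV : V ⊆ Set.range P.vertices) (hs : hullSides V ⊆ edges P T)
    (hi : (interior (convexHull ℝ V)).Nonempty) :
    interior (convexHull ℝ V) ⊆ interiorRegion P := by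
  have hVf : V.Finite := (Set.finite_range _).subset hV
  refine hP.interior_subset_interiorRegion (hVf.isCompact_convexHull (𝕜 := ℝ)).isBounded fun x hx => ?_
  rcases frontier_cases hVf (hP.noThree.mono hV) hi hx with h | ⟨a, b, hab, hx⟩
  · exact Or.inl (range_subset_boundary (hV h))
  · rcases hs hab with h | h
    · exact Or.inl (openSeg_side_subset h hx)
    · exact Or.inr (((mem_diagonals_iff hP).1 (hT.subset_diagonals _ h)).2.2.2 hx)

/-- A diagonal that crosses no side of a convex region but meets its interior joins two of its
vertices. -/
lemma ends_mem_region (hP : Good P) (hT : IsNonCrossing P T) {V : Set Plane}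
    (hV : V ⊆ Set.range P.vertices) (hs : hullSides V ⊆ edges P T) {p q x : Plane}
    (hg : s(p, q) ∈ diagonals P)
    (hgV : ∀ h ∈ hullSides V, h = s(p, q) ∨ Disjoint (openSeg s(p, q)) (openSeg h))
    (hx : x ∈ openSegment ℝ p q) (hxi : x ∈ interior (convexHull ℝ V)) : p ∈ V ∧ q ∈ V := by
  have hVf : V.Finite := (Set.finite_range _).subset hV
  have key : ∀ p q, s(p, q) ∈ diagonals P →
      (∀ h ∈ hullSides V, h = s(p, q) ∨ Disjoint (openSeg s(p, q)) (openSeg h)) →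
      x ∈ openSegment ℝ p q → p ∈ V := by
    intro p q hg hgV hx
    obtain ⟨hp, hq, hpq, hsub⟩ := (mem_diagonals_iff hP).1 hg
    have hpi : p ∉ interior (convexHull ℝ V) := fun h =>
      (hP.region_subset hT hV hs ⟨x, hxi⟩ h).1 (range_subset_boundary hp)
    -- A vertex of P is never interior to the region, so the way from x to p must meet its frontier.
    -- Ruling out all other positions of y leaves y = p, a vertex of the region.
    obtain ⟨y, hy, hyf⟩ : ∃ y ∈ segment ℝ x p, y ∈ frontier (convexHull ℝ V) := by
      by_contra! hcon
      refine hpi ((convex_segment x p).isPreconnected.subset_of_closure_inter_subset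
        isOpen_interior ⟨x, left_mem_segment _ _ _, hxi⟩ ?_ (right_mem_segment _ _ _))
      rintro y ⟨hy, hys⟩
      by_contra hyi
      exact hcon y hys ⟨closure_mono interior_subset hy, hyi⟩
    have hyfr := hyf
    rcases frontier_cases hVf (hP.noThree.mono hV) ⟨x, hxi⟩ hyf with hyV | ⟨a, b, hab, hyab⟩ <;>
    rw [← insert_endpoints_openSegment] at hy <;> rcases hy with rfl | rfl | hy
    · exact absurd hxi hyfr.2
    · exact hyV
    · have hy' : y ∈ openSegment ℝ p q :=
        mem_openSegment_trans hx hy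
      exact absurd hy' (hP.vertex_not_mem_openSegment hp hq (hV hyV) hpq)
    · exact absurd hxi hyfr.2
    · have := mem_hullSides_iff.1 hab
      exact absurd hyab (hP.vertex_not_mem_openSegment (hV this.1) (hV this.2.1) hp this.2.2.1)
    · have hy' : y ∈ openSegment ℝ p q :=
        mem_openSegment_trans hx hy
      rcases hgV _ hab with h | h
      · rw [h] at hab
        exact absurd hxi ((mem_hullSides_iff.1 hab).2.2.2 (openSegment_subset_segment _ _ _ hx)).2
      · exact absurd hyab (Set.disjoint_left.1 h hy')
  refine ⟨key p q hg hgV hx, key q p (by rwa [Sym2.eq_swap]) ?_ (by rwa [openSegment_symm])⟩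
  rwa [Sym2.eq_swap]

lemma edge_ends_mem_region (hP : Good P) (hT : IsNonCrossing P T) {V : Set Plane}
    (hV : V ⊆ Set.range P.vertices) (hs : hullSides V ⊆ edges P T) {p q x : Plane}
    (hg : s(p, q) ∈ edges P T) (hx : x ∈ openSegment ℝ p q)
    (hxi : x ∈ interior (convexHull ℝ V)) : p ∈ V ∧ q ∈ V := by
  rcases hg with hg | hg
  · exact absurd (openSeg_side_subset hg hx) (hP.region_subset hT hV hs ⟨x, hxi⟩ hxi).1
  · refine hP.ends_mem_region hT hV hs (hT.subset_diagonals _ hg) (fun h hh => ?_) hx hxi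
    by_cases he : h = s(p, q)
    · exact Or.inl he
    · exact Or.inr (hP.edges_disjoint hT (Or.inr hg) (hs hh) (Ne.symm he))

lemma hullSides_triple_subset {a b c : Plane} {E : Set (Sym2 Plane)} (hab : s(a, b) ∈ E)
    (hac : s(a, c) ∈ E) (hbc : s(b, c) ∈ E) : hullSides {a, b, c} ⊆ E := by
  rintro _ ⟨p, hp, q, hq, hne, rfl, -⟩
  have hba : s(b, a) ∈ E := by rwa [Sym2.eq_swap]
  have hca : s(c, a) ∈ E := by rwa [Sym2.eq_swap]
  have hcb : s(c, b) ∈ E := by rwa [Sym2.eq_swap]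
  rcases hp with rfl | rfl | rfl <;> rcases hq with rfl | rfl | rfl <;>
    first | assumption | exact absurd rfl hne

/-- The apex of a triangle over a chord of a convex region lies in the region. -/
lemma apex_mem_region (hP : Good P) (hT : IsNonCrossing P T) {W : Set Plane}
    (hW : W ⊆ Set.range P.vertices) (hs : hullSides W ⊆ edges P T) {a b c p : Plane}
    (ha : a ∈ W) (hb : b ∈ W) (hp : p ∈ W) (hab : s(a, b) ∈ edges P T)
    (hac : s(a, c) ∈ edges P T) (hbc : s(b, c) ∈ edges P T)
    (hside : 0 < cr a b c * cr a b p) : c ∈ W := by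
  by_contra hc
  obtain ⟨har, hcr, hac'⟩ := hP.edge_ends hT hac
  obtain ⟨hbr, -, hbc'⟩ := hP.edge_ends hT hbc
  have hcp : c ≠ p := by rintro rfl; exact hc hp
  have hpr := hW hp
  have hc0 : cr a b c ≠ 0 := left_ne_zero_of_mul hside.ne'
  have hp0 : cr a b p ≠ 0 := right_ne_zero_of_mul hside.ne'
  have hap : a ≠ p := by rintro rfl; simp [cr_self_left] at hp0
  have hbp : b ≠ p := by rintro rfl; simp [cr_self_right] at hp0
  have hi : (interior (convexHull ℝ W)).Nonempty := interior_nonempty_of_cr_ne ha hb hp hp0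
  have hcross : ∀ a b, a ∈ W → a ≠ p → b ≠ p → a ≠ b → s(b, c) ∈ edges P T → ¬ Cross a p b c := by
    rintro a b ha hap hbp hab hbc ⟨x, hx1, hx2⟩
    rcases hullSide_or_hullDiagonal ((Set.finite_range _).subset hW) hi ha hp hap with h | h
    · refine hP.not_cross_edges hT (hs h) hbc ?_ ⟨x, hx1, hx2⟩
      intro he
      rcases Sym2.eq_iff.1 he with ⟨h1, -⟩ | ⟨-, h2⟩
      · exact hab h1
      · exact hbp h2.symm
    · exact hc (hP.edge_ends_mem_region hT hW hs hbc hx2 ((mem_hullDiagonals_iff.1 h).2.2.2 hx1)).2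
  have hab' : a ≠ b := by rintro rfl; simp [cr] at hc0
  -- Nesting would put a vertex of P into the interior of P. In the crossing cases, a side of W
  -- cannot be crossed by an edge, and an edge that crosses a diagonal of W has its ends in W.
  rcases same_side_cases hside (hP.noThree b hbr c hcr p hpr hbc' hbp hcp)
    (hP.noThree a har c hcr p hpr hac' hap hcp) with h | h | h | h
  · refine (hP.region_subset hT (V := {a, b, c}) ?_ (hullSides_triple_subset hab hac hbc) ⟨_, h⟩
      h).1 (range_subset_boundary hpr)
    rintro x (rfl | rfl | rfl) <;> assumption
  · refine (hP.region_subset hT hW hs hi (interior_mono (convexHull_mono ?_) h)).1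
      (range_subset_boundary hcr)
    rintro x (rfl | rfl | rfl) <;> assumption
  · exact hcross a b ha hap hbp hab' hbc h
  · exact hcross b a hb hbp hap hab'.symm hac h

/-- The triangle over an edge on a given side is unique. -/
lemma apex_unique (hP : Good P) (hT : IsNonCrossing P T) {a b c p : Plane}
    (hab : s(a, b) ∈ edges P T) (hac : s(a, c) ∈ edges P T) (hbc : s(b, c) ∈ edges P T)
    (hap : s(a, p) ∈ edges P T) (hbp : s(b, p) ∈ edges P T)
    (hside : 0 < cr a b c * cr a b p) : c = p := by
  obtain ⟨har, hbr, -⟩ := hP.edge_ends hT hab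
  obtain ⟨-, hpr, -⟩ := hP.edge_ends hT hap
  -- The triangle abp is itself a convex region.
  have := hP.apex_mem_region hT (W := {a, b, p})
    (by rintro x (rfl | rfl | rfl) <;> assumption) (hullSides_triple_subset hab hap hbp)
    (by simp) (by simp) (by simp) hab hac hbc hside
  simp only [Set.mem_insert_iff, Set.mem_singleton_iff] at this
  rcases this with rfl | rfl | h
  · simp [cr_self_left] at hside
  · simp [cr_self_right] at hside
  · exact h

end Good

lemma IsConvexPolygon.not_mem_interior {W : Set Plane} (hW : IsConvexPolygon W) {a : Plane}
    (ha : a ∈ W) {S : Set Plane} (hS : S ⊆ W) (haS : a ∉ S) : a ∉ interior (convexHull ℝ S) := by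
  intro h
  refine (convexIndependent_set_iff_notMem_convexHull_sdiff.1 hW.2.2) a ha
    (convexHull_mono ?_ (interior_subset h))
  exact fun x hx => ⟨hS hx, fun hxa => haS (hxa ▸ hx)⟩

lemma IsConvexPolygon.cross {W : Set Plane} (hW : IsConvexPolygon W) (h3 : NoThree W)
    {a b c d : Plane} (ha : a ∈ W) (hb : b ∈ W) (hc : c ∈ W) (hd : d ∈ W)
    (h : cr a b c * cr a b d < 0) : Cross a b c d := by
  have hc0 : cr a b c ≠ 0 := left_ne_zero_of_mul h.ne
  have hd0 : cr a b d ≠ 0 := right_ne_zero_of_mul h.ne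
  have hab : a ≠ b := by rintro rfl; simp [cr] at hc0
  have hac : a ≠ c := by rintro rfl; simp [cr_self_left] at hc0
  have hbc : b ≠ c := by rintro rfl; simp [cr_self_right] at hc0
  have had : a ≠ d := by rintro rfl; simp [cr_self_left] at hd0
  have hbd : b ≠ d := by rintro rfl; simp [cr_self_right] at hd0
  have hcd : c ≠ d := by rintro rfl; nlinarith [mul_self_nonneg (cr a b c)]
  refine cross_of_opposite h (hW.not_mem_interior ha ?_ ?_) (hW.not_mem_interior hb ?_ ?_)
    (h3 c hc d hd a ha hcd hac.symm had.symm) (h3 c hc d hd b hb hcd hbc.symm hbd.symm)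
  · rintro x (rfl | rfl | rfl) <;> assumption
  · simp [hab, hac, had]
  · rintro x (rfl | rfl | rfl) <;> assumption
  · simp [hab.symm, hbc, hbd]

end PolyTri

/-! ### Flips. -/

namespace PolyTri

open Classical in
/-- Replace the diagonal `ab` by the diagonal `cd`. -/
noncomputable def flip (T : Finset (Sym2 Plane)) (a b c d : Plane) : Finset (Sym2 Plane) :=
  insert s(c, d) (T.erase s(a, b))

lemma mem_flip {T : Finset (Sym2 Plane)} {a b c d : Plane} {e : Sym2 Plane} :
    e ∈ flip T a b c d ↔ e = s(c, d) ∨ e ≠ s(a, b) ∧ e ∈ T := by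
  simp [flip]

variable {n : ℕ} {P : Polygon Plane n} {T : Finset (Sym2 Plane)} {a b c d : Plane}

/-- The diagonal `ab` is shared by the triangles `abc` and `abd`, and it crosses `cd`. -/
structure IsFlip (P : Polygon Plane n) (T : Finset (Sym2 Plane)) (a b c d : Plane) : Prop where
  mem : s(a, b) ∈ T
  ac : s(a, c) ∈ edges P T
  bc : s(b, c) ∈ edges P T
  ad : s(a, d) ∈ edges P T
  bd : s(b, d) ∈ edges P T
  cross : Cross a b c d

lemma IsTriangulation.nonCrossing (hT : IsTriangulation P T) : IsNonCrossing P T := hT.1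

lemma IsNonCrossing.not_mem_of_cross (hT : IsNonCrossing P T) (hab : s(a, b) ∈ T)
    (h : Cross a b c d) (hne : s(a, b) ≠ s(c, d)) : s(c, d) ∉ T := fun hcd =>
  cross_iff_not_disjoint.1 h (hT.disjoint _ hab _ hcd hne)

lemma edges_flip {e : Sym2 Plane} (he : e ∈ edges P T) (hne : e ≠ s(a, b)) :
    e ∈ edges P (flip T a b c d) := by
  rcases he with he | he
  · exact Or.inl he
  · exact Or.inr (mem_flip.2 (Or.inr ⟨hne, he⟩))

/-- ac is a side of the convex quadrilateral with diagonals ab and cd, so the other two vertices lie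
on one side of it. -/
lemma same_side_of_signs {a b c d : Plane} (h1 : cr a b c * cr a b d < 0)
    (h2 : cr c d a * cr c d b < 0) : 0 < cr a c b * cr a c d := by
  have e : cr a b c - cr a b d = cr c d b - cr c d a := by unfold cr; ring
  rw [show cr a c b = -cr a b c by unfold cr; ring, ← cr_rotate a c d]
  rcases lt_or_gt_of_ne (left_ne_zero_of_mul h1.ne) with g1 | g1 <;>
  rcases lt_or_gt_of_ne (left_ne_zero_of_mul h2.ne) with g2 | g2 <;> nlinarith

lemma hullSides_disjoint_hullDiagonals {V : Set Plane} {e : Sym2 Plane} (h1 : e ∈ hullSides V)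
    (h2 : e ∈ hullDiagonals V) : False := by
  induction e with | _ p q
  obtain ⟨y, hy⟩ := openSegment_nonempty p q
  exact ((mem_hullSides_iff.1 h1).2.2.2 (openSegment_subset_segment _ _ _ hy)).2
    ((mem_hullDiagonals_iff.1 h2).2.2.2 hy)

namespace IsFlip

lemma swap_left (h : IsFlip P T a b c d) : IsFlip P T b a c d :=
  ⟨Sym2.eq_swap ▸ h.mem, h.bc, h.ac, h.bd, h.ad, h.cross.swap_left⟩

lemma swap_right (h : IsFlip P T a b c d) : IsFlip P T a b d c :=
  ⟨h.mem, h.ad, h.bd, h.ac, h.bc, h.cross.swap_right⟩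

lemma flip_swap_left : flip T b a c d = flip T a b c d := by
  unfold flip; rw [Sym2.eq_swap (a := b)]

lemma flip_swap_right : flip T a b d c = flip T a b c d := by
  unfold flip; rw [Sym2.eq_swap (a := d)]

lemma ne (hP : Good P) (hT : IsNonCrossing P T) (h : IsFlip P T a b c d) :
    a ≠ b ∧ a ≠ c ∧ a ≠ d ∧ b ≠ c ∧ b ≠ d ∧ c ≠ d := by
  have h1 := hP.edge_ends hT (Or.inr h.mem)
  have h2 := hP.edge_ends hT h.ac
  refine ⟨h1.2.2, h2.2.2, (hP.edge_ends hT h.ad).2.2, (hP.edge_ends hT h.bc).2.2,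
    (hP.edge_ends hT h.bd).2.2, ?_⟩
  rintro rfl
  obtain ⟨x, hx, hx'⟩ := h.cross
  rw [openSegment_same] at hx'
  rw [Set.mem_singleton_iff.1 hx'] at hx
  exact hP.vertex_not_mem_openSegment h1.1 h1.2.1 h2.2.1 h1.2.2 hx

lemma range (hP : Good P) (hT : IsNonCrossing P T) (h : IsFlip P T a b c d) :
    a ∈ Set.range P.vertices ∧ b ∈ Set.range P.vertices ∧ c ∈ Set.range P.vertices ∧
    d ∈ Set.range P.vertices :=
  ⟨(hP.edge_ends hT h.ac).1, (hP.edge_ends hT h.bc).1, (hP.edge_ends hT h.ac).2.1,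
    (hP.edge_ends hT h.ad).2.1⟩

lemma signs (hP : Good P) (hT : IsNonCrossing P T) (h : IsFlip P T a b c d) :
    cr a b c * cr a b d < 0 ∧ cr c d a * cr c d b < 0 := by
  obtain ⟨ha, hb, hc, hd⟩ := h.range hP hT
  obtain ⟨hab, hac, had, hbc, hbd, hcd⟩ := h.ne hP hT
  exact ⟨signs_of_cross h.cross (hP.noThree a ha b hb c hc hab hac hbc),
    signs_of_cross h.cross.symm (hP.noThree c hc d hd a ha hcd hac.symm had.symm)⟩

lemma same_side (hP : Good P) (hT : IsNonCrossing P T) (h : IsFlip P T a b c d) :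
    0 < cr a c b * cr a c d :=
  same_side_of_signs (h.signs hP hT).1 (h.signs hP hT).2

lemma edge_ne (hP : Good P) (hT : IsNonCrossing P T) (h : IsFlip P T a b c d) :
    s(a, b) ≠ s(c, d) := by
  obtain ⟨hab, hac, had, hbc, hbd, hcd⟩ := h.ne hP hT
  simp [hac, had]

lemma not_mem (hP : Good P) (hT : IsNonCrossing P T) (h : IsFlip P T a b c d) :
    s(c, d) ∉ T :=
  hT.not_mem_of_cross h.mem h.cross (h.edge_ne hP hT)

lemma not_mem_flip (hP : Good P) (hT : IsNonCrossing P T) (h : IsFlip P T a b c d) :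
    s(a, b) ∉ flip T a b c d := by
  rw [mem_flip]; simp [h.edge_ne hP hT]

lemma not_hullDiagonal {V : Set Plane} {p q r s : Plane}
    (hV : ∀ v ∈ V, v = p ∨ v = q ∨ v = r ∨ v = s) (h : 0 < cr p q r * cr p q s) :
    s(p, q) ∉ hullDiagonals V := by
  intro hd
  obtain ⟨-, -, hne, hsub⟩ := mem_hullDiagonals_iff.1 hd
  obtain ⟨x, hx⟩ := openSegment_nonempty p q
  obtain ⟨u, hu, hu'⟩ := exists_cr_pos hne hx (hsub hx)
  obtain ⟨v, hv, hv'⟩ := exists_cr_neg hne hx (hsub hx)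
  have hpp := cr_self_left p q
  have hqq := cr_self_right p q
  rcases hV u hu with rfl | rfl | rfl | rfl <;> rcases hV v hv with rfl | rfl | rfl | rfl <;>
    first | linarith | nlinarith

/-- The quadrilateral is an empty convex region, and any diagonal entering it joins two of its
vertices. So cd crosses only ab in T. For maximality, let g be compatible with the flipped set: if g
misses ab, maximality of T gives g ∈ T; if it meets ab, it joins two vertices of the quadrilateral.
-/
lemma triangulation (hP : Good P) (hT : IsTriangulation P T) (h : IsFlip P T a b c d) :
    IsTriangulation P (flip T a b c d) := by
  have hN := hT.nonCrossing
  obtain ⟨ha, hb, hc, hd⟩ := h.range hP hN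
  obtain ⟨hab, hac, had, hbc, hbd, hcd⟩ := h.ne hP hN
  have hcr := hP.noThree a ha b hb c hc hab hac hbc
  set V : Set Plane := {a, b, c, d} with hVdef
  have haV : a ∈ V := by simp [hVdef]
  have hbV : b ∈ V := by simp [hVdef]
  have hcV : c ∈ V := by simp [hVdef]
  have hdV : d ∈ V := by simp [hVdef]
  have hV : V ⊆ Set.range P.vertices := by rintro x (rfl | rfl | rfl | rfl) <;> assumption
  have hVf : V.Finite := (Set.finite_range _).subset hV
  have hi := interior_nonempty_of_cr_ne haV hbV hcV hcr
  obtain ⟨x, hx1, hx2⟩ := h.cross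
  have hxi := crossing_mem_interior hi haV hbV hcV hdV hx1 hx2 hcr
  have hdab := mem_hullDiagonals_of_mem_interior hVf haV hbV hab hx1 hxi
  have hdcd := mem_hullDiagonals_of_mem_interior hVf hcV hdV hcd hx2 hxi
  have hpairs : ∀ p ∈ V, ∀ q ∈ V, p ≠ q → s(p, q) = s(a, b) ∨ s(p, q) = s(c, d) ∨
      (s(p, q) ∈ edges P T ∧ s(p, q) ≠ s(a, b) ∧ s(p, q) ∉ hullDiagonals V) := by
    have e1 : s(a, c) ≠ s(a, b) := by simp [hab, hbc.symm]
    have e2 : s(b, c) ≠ s(a, b) := by simp [hab.symm, hac.symm]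
    have e3 : s(a, d) ≠ s(a, b) := by simp [hab, hbd.symm]
    have e4 : s(b, d) ≠ s(a, b) := by simp [hab.symm, had.symm]
    have n1 : s(a, c) ∉ hullDiagonals V := not_hullDiagonal (r := b) (s := d)
      (by rintro v (rfl | rfl | rfl | rfl) <;> simp) (h.same_side hP hN)
    have n2 : s(b, c) ∉ hullDiagonals V := not_hullDiagonal (r := a) (s := d)
      (by rintro v (rfl | rfl | rfl | rfl) <;> simp) (h.swap_left.same_side hP hN)
    have n3 : s(a, d) ∉ hullDiagonals V := not_hullDiagonal (r := b) (s := c)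
      (by rintro v (rfl | rfl | rfl | rfl) <;> simp) (h.swap_right.same_side hP hN)
    have n4 : s(b, d) ∉ hullDiagonals V := not_hullDiagonal (r := a) (s := c)
      (by rintro v (rfl | rfl | rfl | rfl) <;> simp) (h.swap_left.swap_right.same_side hP hN)
    have s1 : s(b, a) = s(a, b) := Sym2.eq_swap
    have s2 : s(d, c) = s(c, d) := Sym2.eq_swap
    have s3 : s(c, a) = s(a, c) := Sym2.eq_swap
    have s4 : s(d, a) = s(a, d) := Sym2.eq_swap
    have s5 : s(c, b) = s(b, c) := Sym2.eq_swap
    have s6 : s(d, b) = s(b, d) := Sym2.eq_swap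
    rintro p hp q hq hne
    rcases hp with rfl | rfl | rfl | rfl <;> rcases hq with rfl | rfl | rfl | rfl <;>
      first
      | exact absurd rfl hne
      | exact Or.inl rfl
      | exact Or.inl s1
      | exact Or.inr (Or.inl rfl)
      | exact Or.inr (Or.inl s2)
      | exact Or.inr (Or.inr ⟨h.ac, e1, n1⟩)
      | exact Or.inr (Or.inr ⟨h.bc, e2, n2⟩)
      | exact Or.inr (Or.inr ⟨h.ad, e3, n3⟩)
      | exact Or.inr (Or.inr ⟨h.bd, e4, n4⟩)
      | exact Or.inr (Or.inr ⟨s3 ▸ h.ac, s3 ▸ e1, s3 ▸ n1⟩)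
      | exact Or.inr (Or.inr ⟨s5 ▸ h.bc, s5 ▸ e2, s5 ▸ n2⟩)
      | exact Or.inr (Or.inr ⟨s4 ▸ h.ad, s4 ▸ e3, s4 ▸ n3⟩)
      | exact Or.inr (Or.inr ⟨s6 ▸ h.bd, s6 ▸ e4, s6 ▸ n4⟩)
  have hsides : ∀ e ∈ hullSides V, e ∈ edges P T ∧ e ≠ s(a, b) := by
    intro e he
    have he' := he
    obtain ⟨p, hp, q, hq, hne, rfl, -⟩ := he'
    rcases hpairs p hp q hq hne with h | h | h
    · rw [h] at he; exact (hullSides_disjoint_hullDiagonals he hdab).elim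
    · rw [h] at he; exact (hullSides_disjoint_hullDiagonals he hdcd).elim
    · exact ⟨h.1, h.2.1⟩
  have hs : hullSides V ⊆ edges P T := fun e he => (hsides e he).1
  have hcdi := (mem_hullDiagonals_iff.1 hdcd).2.2.2
  have hcdP : s(c, d) ∈ diagonals P := (mem_diagonals_iff hP).2
    ⟨hc, hd, hcd, hcdi.trans (hP.region_subset hN hV hs hi)⟩
  have hnew : ∀ f ∈ T, f ≠ s(a, b) → Disjoint (openSeg s(c, d)) (openSeg f) := by
    intro f
    induction f with | _ p q
    intro hf hne
    refine Set.disjoint_left.2 fun y hy hy' => ?_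
    have hyi := hcdi hy
    obtain ⟨hp, hq⟩ := hP.edge_ends_mem_region hN hV hs (Or.inr hf) hy' hyi
    have hpq := (hP.edge_ends hN (Or.inr hf)).2.2
    have hfd := mem_hullDiagonals_of_mem_interior hVf hp hq hpq hy' hyi
    rcases hpairs p hp q hq hpq with h'' | h'' | h''
    · exact hne h''
    · exact h.not_mem hP hN (h'' ▸ hf)
    · exact h''.2.2 hfd
  have hNC : IsNonCrossing P (flip T a b c d) := by
    constructor
    · intro e he
      rcases mem_flip.1 he with rfl | ⟨-, he⟩
      · exact hcdP
      · exact hN.subset_diagonals e he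
    · intro e he f hf hef
      rcases mem_flip.1 he with rfl | ⟨he1, he⟩ <;> rcases mem_flip.1 hf with rfl | ⟨hf1, hf⟩
      · exact absurd rfl hef
      · exact hnew f hf hf1
      · exact (hnew e he he1).symm
      · exact hN.disjoint e he f hf hef
  refine ⟨hNC, fun S hS hle g hg => ?_⟩
  by_contra hgT
  have hgd := hS.subset_diagonals g hg
  have hcdS : s(c, d) ∈ S := hle (mem_flip.2 (Or.inl rfl))
  have hTS : ∀ f ∈ T, f ≠ s(a, b) → f ∈ S := fun f hf hne => hle (mem_flip.2 (Or.inr ⟨hne, hf⟩))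
  have hne : g ≠ s(a, b) := by
    rintro rfl
    exact hS.not_mem_of_cross hg h.cross (h.edge_ne hP hN) hcdS
  by_cases hdis : Disjoint (openSeg g) (openSeg s(a, b))
  · refine hgT (mem_flip.2 (Or.inr ⟨hne, ?_⟩))
    classical
    have hg' : ∀ f ∈ T, g ≠ f → Disjoint (openSeg g) (openSeg f) := by
      intro f hf hgf
      by_cases hfe : f = s(a, b)
      · rwa [hfe]
      · exact hS.disjoint g hg f (hTS f hf hfe) hgf
    have hins : IsNonCrossing P (insert g T) := by
      constructor
      · intro e he
        rcases Finset.mem_insert.1 he with rfl | he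
        · exact hgd
        · exact hN.subset_diagonals e he
      · intro e he f hf hef
        rcases Finset.mem_insert.1 he with he' | he' <;>
          rcases Finset.mem_insert.1 hf with hf' | hf'
        · exact absurd (he'.trans hf'.symm) hef
        · rw [he'] at hef ⊢; exact hg' f hf' hef
        · rw [hf'] at hef ⊢; exact (hg' e he' hef.symm).symm
        · exact hN.disjoint e he' f hf' hef
    exact hT.2 hins (Finset.subset_insert g T) (Finset.mem_insert_self g T)
  · induction g with | _ p q
    obtain ⟨y, hy, hy'⟩ := Set.not_disjoint_iff.1 hdis
    have hyi := (mem_hullDiagonals_iff.1 hdab).2.2.2 hy'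
    obtain ⟨hp, hq⟩ := hP.ends_mem_region hN hV hs hgd (fun e he => by
      rcases hsides e he with ⟨h1 | h1, h2⟩
      · right
        refine Set.disjoint_left.2 fun z hz hz' => ?_
        exact (((mem_diagonals_iff hP).1 hgd).2.2.2 hz).1 (openSeg_side_subset h1 hz')
      · by_cases heg : e = s(p, q)
        · exact Or.inl heg
        · exact Or.inr (hS.disjoint _ hg _ (hTS e h1 h2) (Ne.symm heg))) hy hyi
    rcases hpairs p hp q hq ((mem_diagonals_iff hP).1 hgd).2.2.1 with h' | h' | h'
    · exact hne h'
    · exact hgT (mem_flip.2 (Or.inl h'))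
    · rcases h'.1 with h1 | h1
      · exact not_mem_sides_of_diagonal hgd h1
      · exact hgT (mem_flip.2 (Or.inr ⟨h'.2.1, h1⟩))

/-- By uniqueness of triangles q is c or d. The flip destroys the triangle abq and provides one over
aq whose third vertex is the other of c and d. -/
lemma exists_apex_aux (hP : Good P) (hT : IsNonCrossing P T) (h : IsFlip P T a b c d) {q : Plane}
    (hq1 : s(a, q) ∈ edges P T) (hq2 : s(b, q) ∈ edges P T) :
    ∃ r, s(a, r) ∈ edges P (flip T a b c d) ∧ s(q, r) ∈ edges P (flip T a b c d) ∧
      0 < cr a q b * cr a q r := by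
  have hab := hP.edge_ends hT (Or.inr h.mem)
  have hE1 := hP.edge_ends hT hq1
  have hE2 := hP.edge_ends hT hq2
  have h0 : cr a b q ≠ 0 := hP.noThree a hab.1 b hab.2.1 q hE1.2.1 hab.2.2 hE1.2.2 hE2.2.2
  have key : ∀ c d, IsFlip P T a b c d → 0 < cr a b c * cr a b q →
      ∃ r, s(a, r) ∈ edges P (flip T a b c d) ∧ s(q, r) ∈ edges P (flip T a b c d) ∧
      0 < cr a q b * cr a q r := by
    intro c d h hs
    obtain rfl := hP.apex_unique hT (Or.inr h.mem) h.ac h.bc hq1 hq2 hs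
    refine ⟨d, edges_flip h.ad ?_, Or.inr (mem_flip.2 (Or.inl rfl)), h.same_side hP hT⟩
    simp [hab.2.2, (h.ne hP hT).2.2.2.2.1.symm]
  have hsg := (h.signs hP hT).1
  by_cases hs : 0 < cr a b c * cr a b q
  · exact key c d h hs
  · obtain ⟨r, h1, h2, h3⟩ := key d c h.swap_right (by
      have : cr a b c * cr a b q < 0 := lt_of_le_of_ne (not_lt.1 hs)
        (mul_ne_zero (left_ne_zero_of_mul hsg.ne) h0)
      by_contra! hcon
      nlinarith [mul_pos_of_neg_of_neg hsg this, mul_self_pos.2 (left_ne_zero_of_mul hsg.ne)])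
    rw [flip_swap_right] at h1 h2
    exact ⟨r, h1, h2, h3⟩

/-- A flip keeps a triangle on each side of every edge other than the flipped one. -/
lemma exists_apex (hP : Good P) (hT : IsNonCrossing P T) (h : IsFlip P T a b c d)
    {p q r : Plane} (hpq : s(p, q) ∈ edges P T) (hpr : s(p, r) ∈ edges P T)
    (hqr : s(q, r) ∈ edges P T) :
    ∃ r', s(p, r') ∈ edges P (flip T a b c d) ∧ s(q, r') ∈ edges P (flip T a b c d) ∧
      0 < cr p q r * cr p q r' := by
  have key : ∀ p q r, s(p, q) ∈ edges P T → s(q, r) ∈ edges P T → s(p, r) = s(a, b) →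
      ∃ r', s(p, r') ∈ edges P (flip T a b c d) ∧ s(q, r') ∈ edges P (flip T a b c d) ∧
      0 < cr p q r * cr p q r' := by
    intro p q r hpq hqr he
    rw [Sym2.eq_swap] at hqr
    rcases Sym2.eq_iff.1 he with ⟨rfl, rfl⟩ | ⟨rfl, rfl⟩
    · exact h.exists_apex_aux hP hT hpq hqr
    · rw [← flip_swap_left]
      exact h.swap_left.exists_apex_aux hP hT hpq hqr
  -- Only triangles that have ab as a side are lost.
  by_cases h1 : s(p, r) = s(a, b)
  · exact key p q r hpq hqr h1
  by_cases h2 : s(q, r) = s(a, b)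
  · obtain ⟨r', h3, h4, h5⟩ := key q p r (by rwa [Sym2.eq_swap]) hpr h2
    refine ⟨r', h4, h3, ?_⟩
    rw [cr_swap p q r, cr_swap p q r', neg_mul_neg] at h5; exact h5
  · have hp := hP.edge_ends hT hpr
    have hq := hP.edge_ends hT hqr
    exact ⟨r, edges_flip hpr h1, edges_flip hqr h2, mul_self_pos.2
      (hP.noThree p hp.1 q hq.1 r hp.2.1 (hP.edge_ends hT hpq).2.2 hp.2.2 hq.2.2)⟩

end IsFlip

/-- The edge `e` has a triangle on each side. -/
def HasApexes (P : Polygon Plane n) (T : Finset (Sym2 Plane)) (e : Sym2 Plane) : Prop :=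
  ∃ a b c d : Plane, e = s(a, b) ∧ cr a b c * cr a b d < 0 ∧
    s(a, c) ∈ edges P T ∧ s(b, c) ∈ edges P T ∧ s(a, d) ∈ edges P T ∧ s(b, d) ∈ edges P T

lemma HasApexes.exists (h : HasApexes P T s(a, b)) :
    ∃ c d : Plane, cr a b c * cr a b d < 0 ∧
    s(a, c) ∈ edges P T ∧ s(b, c) ∈ edges P T ∧ s(a, d) ∈ edges P T ∧ s(b, d) ∈ edges P T := by
  obtain ⟨a', b', c, d, he, hs, h1, h2, h3, h4⟩ := h
  rcases Sym2.eq_iff.1 he with ⟨rfl, rfl⟩ | ⟨rfl, rfl⟩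
  · exact ⟨c, d, hs, h1, h2, h3, h4⟩
  · exact ⟨c, d, by rw [cr_swap a b c, cr_swap a b d, neg_mul_neg] at hs; exact hs, h2, h1, h4, h3⟩

/-- The second triangle on an edge. -/
lemma HasApexes.exists_opposite (hP : Good P) (hT : IsNonCrossing P T)
    (h : HasApexes P T s(a, b)) (hab : s(a, b) ∈ edges P T) {v : Plane}
    (hav : s(a, v) ∈ edges P T) (hbv : s(b, v) ∈ edges P T) :
    ∃ z, cr a b v * cr a b z < 0 ∧ s(a, z) ∈ edges P T ∧ s(b, z) ∈ edges P T := by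
  obtain ⟨c, d, hs, h1, h2, h3, h4⟩ := h.exists
  have hE := hP.edge_ends hT hab
  have hE1 := hP.edge_ends hT hav
  have hE2 := hP.edge_ends hT hbv
  have h0 : cr a b v ≠ 0 := hP.noThree a hE.1 b hE.2.1 v hE1.2.1 hE.2.2 hE1.2.2 hE2.2.2
  by_cases hv : 0 < cr a b c * cr a b v
  · obtain rfl := hP.apex_unique hT hab h1 h2 hav hbv hv
    exact ⟨d, hs, h3, h4⟩
  · refine ⟨c, ?_, h1, h2⟩
    rw [mul_comm]
    exact lt_of_le_of_ne (not_lt.1 hv) (mul_ne_zero (left_ne_zero_of_mul hs.ne) h0)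

/-- The new diagonal cd has the apexes a and b; for an old one, lost triangles are replaced on the
same side by `exists_apex`. -/
lemma IsFlip.hasApexes (hP : Good P) (hT : IsNonCrossing P T) (h : IsFlip P T a b c d)
    {f : Sym2 Plane} (hf : f ∈ flip T a b c d) (hfT : f ∈ T → HasApexes P T f) :
    HasApexes P (flip T a b c d) f := by
  rcases mem_flip.1 hf with rfl | ⟨hne, hf⟩
  · obtain ⟨hab, hac, had, hbc, hbd, hcd⟩ := h.ne hP hT
    refine ⟨c, d, a, b, rfl, (h.signs hP hT).2, edges_flip (by rw [Sym2.eq_swap]; exact h.ac) ?_,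
      edges_flip (by rw [Sym2.eq_swap]; exact h.ad) ?_,
      edges_flip (by rw [Sym2.eq_swap]; exact h.bc) ?_,
      edges_flip (by rw [Sym2.eq_swap]; exact h.bd) ?_⟩ <;>
      simp [hab.symm, hac.symm, had.symm, hbc.symm, hbd.symm]
  · obtain ⟨p, q, r, s, rfl, hs, h1, h2, h3, h4⟩ := hfT hf
    obtain ⟨r', h1', h2', hr⟩ := h.exists_apex hP hT (Or.inr hf) h1 h2
    obtain ⟨s', h3', h4', hs'⟩ := h.exists_apex hP hT (Or.inr hf) h3 h4
    refine ⟨p, q, r', s', rfl, ?_, h1', h2', h3', h4'⟩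
    by_contra! hcon
    have := mul_pos hr hs'
    nlinarith [mul_nonneg_of_nonpos_of_nonpos hs.le (neg_nonpos.2 hcon)]

/-- A flippable diagonal can be flipped. -/
lemma IsFlippable.exists_isFlip (hP : Good P) (hT : IsNonCrossing P T) {e : Sym2 Plane}
    (he : e ∈ T) (h : IsFlippable P T e) : ∃ a b c d, e = s(a, b) ∧ IsFlip P T a b c d := by
  obtain ⟨a, b, c, d, rfl, hcd, hac, hbc, had, hbd, hconv, hd⟩ := h
  refine ⟨a, b, c, d, rfl, he, hac, hbc, had, hbd, ?_⟩
  have hE := hP.edge_ends hT (Or.inr he)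
  have hV : ({a, b, c, d} : Set Plane) ⊆ Set.range P.vertices := by
    rintro x (rfl | rfl | rfl | rfl)
    exacts [hE.1, hE.2.1, (hP.edge_ends hT hac).2.1, (hP.edge_ends hT had).2.1]
  refine hconv.cross (hP.noThree.mono hV) (by simp) (by simp) (by simp) (by simp) ?_
  by_contra! hcon
  have h0 : ∀ v ∈ Set.range P.vertices, s(a, v) ∈ edges P T → s(b, v) ∈ edges P T →
      cr a b v ≠ 0 := fun v hv h1 h2 => hP.noThree a hE.1 b hE.2.1 v hv hE.2.2
        (hP.edge_ends hT h1).2.2 (hP.edge_ends hT h2).2.2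
  refine IsFlip.not_hullDiagonal (r := c) (s := d) (V := {a, b, c, d})
    (fun v hv => by simpa using hv) ?_ hd
  exact lt_of_le_of_ne hcon (mul_ne_zero (h0 c (hV (by simp)) hac hbc)
    (h0 d (hV (by simp)) had hbd)).symm

lemma IsFlip.hasApexes_self (hP : Good P) (hT : IsNonCrossing P T) (h : IsFlip P T a b c d) :
    HasApexes P T s(a, b) :=
  ⟨a, b, c, d, rfl, (h.signs hP hT).1, h.ac, h.bc, h.ad, h.bd⟩

end PolyTri

/-! ### Families of triangulations and injections between them. -/

namespace PolyTri

variable {n : ℕ} {P : Polygon Plane n} {T F A : Finset (Sym2 Plane)}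

/-- `Set.ncard` is 0 on infinite sets, so every counting inequality rests on this. -/
lemma finite_triangulations (P : Polygon Plane n) :
    {S : Finset (Sym2 Plane) | IsTriangulation P S}.Finite := by
  have hD : (diagonals P).Finite := by
    refine (Set.finite_range fun p : Fin n × Fin n => s(P p.1, P p.2)).subset ?_
    rintro _ ⟨i, j, -, rfl, -⟩
    exact ⟨(i, j), rfl⟩
  refine (hD.toFinset.powerset.finite_toSet).subset fun S hS => ?_
  rw [Finset.mem_coe, Finset.mem_powerset]
  exact fun e he => hD.mem_toFinset.2 (hS.nonCrossing.subset_diagonals e he)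

/-- The triangulations that agree with `T` except for the diagonals in `A` and that have triangles
on both sides of each diagonal in `F`. -/
def Fam (P : Polygon Plane n) (T F A : Finset (Sym2 Plane)) : Set (Finset (Sym2 Plane)) :=
  {S | IsTriangulation P S ∧ (∀ e ∈ T, e ∉ A → e ∈ S) ∧ ∀ f ∈ F, f ∈ S → HasApexes P S f}

lemma fam_finite : (Fam P T F A).Finite := (finite_triangulations P).subset fun _ h => h.1

lemma ncard_fam_le : (Fam P T F A).ncard ≤ numTriangulations P :=
  Set.ncard_le_ncard (fun _ h => h.1) (finite_triangulations P)

lemma fam_mono {B : Finset (Sym2 Plane)} (h : A ⊆ B) : Fam P T F A ⊆ Fam P T F B :=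
  fun _ hS => ⟨hS.1, fun e he hB => hS.2.1 e he fun hA => hB (h hA), hS.2.2⟩

lemma self_mem_fam (hT : IsTriangulation P T) (hF : ∀ f ∈ F, f ∈ T → HasApexes P T f) :
    T ∈ Fam P T F A := ⟨hT, fun _ he _ => he, hF⟩

lemma edges_fam {S : Finset (Sym2 Plane)} (hS : S ∈ Fam P T F A) {e : Sym2 Plane}
    (he : e ∈ edges P T) (heA : e ∉ A) : e ∈ edges P S := by
  rcases he with he | he
  · exact Or.inl he
  · exact Or.inr (hS.2.1 e he heA)

lemma flip_mem_fam (hP : Good P) {B S : Finset (Sym2 Plane)} (hS : S ∈ Fam P T F B)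
    {a b c d : Plane} (h : IsFlip P S a b c d)
    (hA : ∀ e ∈ T, e ∉ A → e ≠ s(a, b) ∧ e ∈ S) : flip S a b c d ∈ Fam P T F A :=
  ⟨h.triangulation hP hS.1, fun e he heA => mem_flip.2 (Or.inr (hA e he heA)),
    fun f hf hfS => h.hasApexes hP hS.1.nonCrossing hfS (hS.2.2 f hf)⟩

lemma ncard_add_le {α : Type*} {X Y Z : Set α} (hZ : Z.Finite) (f : α → α) (hX : X ⊆ Z)
    (hf : Set.MapsTo f Y Z) (hinj : Set.InjOn f Y) (hd : ∀ y ∈ Y, f y ∉ X) :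
    X.ncard + Y.ncard ≤ Z.ncard := by
  rw [← hinj.ncard_image, ← Set.ncard_union_eq ?_ (hZ.subset hX)
    (hZ.subset hf.image_subset)]
  · exact Set.ncard_le_ncard (Set.union_subset hX hf.image_subset) hZ
  · rw [Set.disjoint_left]
    rintro _ hx ⟨y, hy, rfl⟩
    exact hd y hy hx

lemma not_mem_of_flip_of_mem (hP : Good P) {S S' : Finset (Sym2 Plane)} {a b c d : Plane}
    (hS : IsNonCrossing P S) (h : IsFlip P S a b c d) (hS' : IsNonCrossing P S')
    (hmem : s(a, b) ∈ S') : s(c, d) ∉ S' :=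
  hS'.not_mem_of_cross hmem h.cross (h.edge_ne hP hS)

open Classical in
/-- Flipping a fixed diagonal. -/
lemma ncard_fam_flip (hP : Good P) {a b c d : Plane}
    (h : IsFlip P T a b c d) (hA : s(a, b) ∈ A) :
    (Fam P T F (A.erase s(a, b))).ncard +
      (Fam P T F (A \ {s(a, b), s(a, c), s(b, c), s(a, d), s(b, d)})).ncard ≤
      (Fam P T F A).ncard := by
  have hfl : ∀ S ∈ Fam P T F (A \ {s(a, b), s(a, c), s(b, c), s(a, d), s(b, d)}),
      IsFlip P S a b c d := fun S hS =>
    ⟨hS.2.1 _ h.mem (by simp), edges_fam hS h.ac (by simp), edges_fam hS h.bc (by simp),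
      edges_fam hS h.ad (by simp), edges_fam hS h.bd (by simp), h.cross⟩
  refine ncard_add_le fam_finite (fun S => flip S a b c d) (fam_mono (Finset.erase_subset _ _))
    (fun S hS => flip_mem_fam hP hS (hfl S hS) ?_) ?_ ?_
  · intro e he heA
    exact ⟨fun h => heA (h ▸ hA), hS.2.1 e he (fun h => heA (Finset.mem_sdiff.1 h).1)⟩
  · have key : ∀ S ∈ Fam P T F (A \ {s(a, b), s(a, c), s(b, c), s(a, d), s(b, d)}),
        ∀ S' ∈ Fam P T F (A \ {s(a, b), s(a, c), s(b, c), s(a, d), s(b, d)}),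
        flip S a b c d = flip S' a b c d → S ⊆ S' := by
      intro S hS S' hS' he e heS
      by_cases h1 : e = s(a, b)
      · rw [h1]; exact (hfl S' hS').mem
      · have : e ∈ flip S' a b c d := he ▸ mem_flip.2 (Or.inr ⟨h1, heS⟩)
        rcases mem_flip.1 this with rfl | h2
        · exact absurd heS ((hfl S hS).not_mem hP hS.1.nonCrossing)
        · exact h2.2
    intro S hS S' hS' he
    exact (key S hS S' hS' he).antisymm (key S' hS' S hS he.symm)
  -- Members of the first family contain ab, and flips never do.
  · intro S hS hmem
    exact (hfl S hS).not_mem_flip hP hS.1.nonCrossing (hmem.2.1 _ h.mem (by simp))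

/-- `uw` is a diagonal in `A` of the convex region `W`, and no further diagonals in `A` bound the
triangle `uwv` on one side of it. -/
structure IsLeaf (P : Polygon Plane n) (T A : Finset (Sym2 Plane)) (W : Set Plane)
    (u w v : Plane) : Prop where
  subset : W ⊆ Set.range P.vertices
  convex : IsConvexPolygon W
  sides : hullSides W ⊆ edges P T
  sides_not_mem : ∀ e ∈ hullSides W, e ∉ A
  mem : s(u, w) ∈ A
  diag : s(u, w) ∈ hullDiagonals W
  apex : v ∈ W
  uv : s(u, v) ∈ edges P T
  wv : s(w, v) ∈ edges P T
  uv_not_mem : s(u, v) ∉ A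
  wv_not_mem : s(w, v) ∉ A

/-- Supplies the vertex of W that `Good.apex_mem_region` needs on the side of a given apex. -/
lemma exists_same_sign {W : Set Plane} {a b z : Plane} (h : s(a, b) ∈ hullDiagonals W)
    (hz : cr a b z ≠ 0) : ∃ p ∈ W, 0 < cr a b z * cr a b p := by
  obtain ⟨-, -, hne, hsub⟩ := mem_hullDiagonals_iff.1 h
  obtain ⟨x, hx⟩ := openSegment_nonempty a b
  rcases lt_or_gt_of_ne hz with hz | hz
  · obtain ⟨p, hp, h⟩ := exists_cr_neg hne hx (hsub hx)
    exact ⟨p, hp, by nlinarith⟩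
  · obtain ⟨p, hp, h⟩ := exists_cr_pos hne hx (hsub hx)
    exact ⟨p, hp, by nlinarith⟩

/-- The triangle on the far side of uw has its apex in W, and convexity of W then makes the two
triangles a convex quadrilateral. -/
lemma exists_flip_aux (hP : Good P) {B S : Finset (Sym2 Plane)} (hS : S ∈ Fam P T F B)
    {W : Set Plane} (hW : W ⊆ Set.range P.vertices) (hconv : IsConvexPolygon W)
    (hs : hullSides W ⊆ edges P S) {u w v : Plane} (huF : s(u, w) ∈ F) (hmem : s(u, w) ∈ S)
    (hd : s(u, w) ∈ hullDiagonals W) (hv : v ∈ W) (huv : s(u, v) ∈ edges P S)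
    (hwv : s(w, v) ∈ edges P S) : ∃ z ∈ W, IsFlip P S u w v z := by
  have hN := hS.1.nonCrossing
  obtain ⟨z, hz, hz1, hz2⟩ := (hS.2.2 _ huF hmem).exists_opposite hP hN (Or.inr hmem) huv hwv
  obtain ⟨p, hp, hpz⟩ := exists_same_sign hd (right_ne_zero_of_mul hz.ne)
  obtain ⟨hu, hw, -, -⟩ := mem_hullDiagonals_iff.1 hd
  have hzW := hP.apex_mem_region hN hW hs hu hw hp (Or.inr hmem) hz1 hz2 hpz
  exact ⟨z, hzW, hmem, huv, hwv, hz1, hz2, hconv.cross (hP.noThree.mono hW) hu hw hv hzW hz⟩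

-- The apex z varies with S. Injectivity holds because each new diagonal vz crosses uw, which all
-- members of the family contain: the inserted diagonal lies in none of them.
open Classical in
lemma IsLeaf.exists_phi (hP : Good P) (hFT : F ⊆ T) (hAF : A ⊆ F) {W : Set Plane} {u w v : Plane}
    (h : IsLeaf P T A W u w v) : ∃ φ : Finset (Sym2 Plane) → Finset (Sym2 Plane),
      Set.MapsTo φ (Fam P T F (A.erase s(u, w))) (Fam P T F A) ∧
      Set.InjOn φ (Fam P T F (A.erase s(u, w))) ∧
      ∀ S ∈ Fam P T F (A.erase s(u, w)), s(u, w) ∉ φ S ∧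
        ∃ z ∈ W, IsFlip P S u w v z ∧ φ S = flip S u w v z := by
  have hex : ∀ S ∈ Fam P T F (A.erase s(u, w)), ∃ z ∈ W, IsFlip P S u w v z := by
    intro S hS
    have hnm : ∀ e, e ∉ A → e ∉ A.erase s(u, w) := fun e he he' => he (Finset.mem_of_mem_erase he')
    refine exists_flip_aux hP hS h.subset h.convex
      (fun e he => edges_fam hS (h.sides he) (hnm e (h.sides_not_mem e he))) (hAF h.mem)
      (hS.2.1 _ (hFT (hAF h.mem)) (by simp)) h.diag h.apex
      (edges_fam hS h.uv (hnm _ h.uv_not_mem)) (edges_fam hS h.wv (hnm _ h.wv_not_mem))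
  choose! z hzW hz using hex
  refine ⟨fun S => flip S u w v (z S), fun S hS => flip_mem_fam hP hS (hz S hS) ?_, ?_,
    fun S hS => ⟨(hz S hS).not_mem_flip hP hS.1.nonCrossing, z S, hzW S hS, hz S hS, rfl⟩⟩
  · intro e he heA
    exact ⟨fun h' => heA (h' ▸ h.mem), hS.2.1 e he (fun h' => heA (Finset.mem_of_mem_erase h'))⟩
  · have key : ∀ S ∈ Fam P T F (A.erase s(u, w)), ∀ S' ∈ Fam P T F (A.erase s(u, w)),
        flip S u w v (z S) = flip S' u w v (z S') → S ⊆ S' := by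
      intro S hS S' hS' he e heS
      by_cases h1 : e = s(u, w)
      · rw [h1]; exact (hz S' hS').mem
      · have : e ∈ flip S' u w v (z S') := he ▸ mem_flip.2 (Or.inr ⟨h1, heS⟩)
        rcases mem_flip.1 this with rfl | h2
        · exact absurd heS (not_mem_of_flip_of_mem hP hS'.1.nonCrossing (hz S' hS')
            hS.1.nonCrossing (hz S hS).mem)
        · exact h2.2
    intro S hS S' hS' he
    exact (key S hS S' hS' he).antisymm (key S' hS' S hS he.symm)

open Classical in
lemma IsLeaf.two_mul_le (hP : Good P) (hFT : F ⊆ T) (hAF : A ⊆ F) {W : Set Plane} {u w v : Plane}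
    (h : IsLeaf P T A W u w v) :
    2 * (Fam P T F (A.erase s(u, w))).ncard ≤ (Fam P T F A).ncard := by
  obtain ⟨φ, h1, h2, h3⟩ := h.exists_phi hP hFT hAF
  rw [two_mul]
  exact ncard_add_le fam_finite φ (fam_mono (Finset.erase_subset _ _)) h1 h2
    fun S hS hm => (h3 S hS).1 (hm.2.1 _ (hFT (hAF h.mem)) (by simp))

-- Besides the triangulations with uw and their flips under φ, a third class comes from those with
-- uw, wz and uz: flip uw to vz, then flip wz, whose triangle is now wzv, to a diagonal from v.
open Classical in
lemma IsLeaf.two_mul_add_le (hP : Good P) (hT : IsTriangulation P T) (hFT : F ⊆ T) (hAF : A ⊆ F)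
    {W : Set Plane} {u w v z : Plane}
    (h : IsLeaf P T A W u w v) (hg : s(w, z) ∈ A) (hz : z ∈ W) (huz : s(u, z) ∈ edges P T)
    (huzA : s(u, z) ∉ A) (hvz : cr u w v * cr u w z < 0) :
    2 * (Fam P T F (A.erase s(u, w))).ncard + (Fam P T F ((A.erase s(u, w)).erase s(w, z))).ncard ≤
      (Fam P T F A).ncard := by
  have hN := hT.nonCrossing
  obtain ⟨hu, hw, huw, -⟩ := mem_hullDiagonals_iff.1 h.diag
  have hgd : s(w, z) ∈ hullDiagonals W := by
    refine (hullSide_or_hullDiagonal ((Set.finite_range _).subset h.subset)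
      (interior_nonempty_of_cr_ne hu hw hz (right_ne_zero_of_mul hvz.ne)) hw hz
      (hP.edge_ends hN (Or.inr (hFT (hAF hg)))).2.2).resolve_left
      fun hside => h.sides_not_mem _ hside hg
  have hwz : w ≠ z := (mem_hullDiagonals_iff.1 hgd).2.2.1
  have hzu : u ≠ z := (hP.edge_ends hN huz).2.2
  have hvw : w ≠ v := (hP.edge_ends hN h.wv).2.2
  set B := (A.erase s(u, w)).erase s(w, z) with hB
  have hnm : ∀ e, e ∉ A → e ∉ B := fun e he he' =>
    he (Finset.mem_of_mem_erase (Finset.mem_of_mem_erase he'))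
  have hfg : s(u, w) ≠ s(w, z) := by simp [huw, hzu]
  have hcrossW := h.convex.cross (hP.noThree.mono h.subset) hu hw h.apex hz hvz
  have hfl1 : ∀ S ∈ Fam P T F B, IsFlip P S u w v z := fun S hS =>
    ⟨hS.2.1 _ (hFT (hAF h.mem)) (by simp [hB]), edges_fam hS h.uv (hnm _ h.uv_not_mem),
      edges_fam hS h.wv (hnm _ h.wv_not_mem), edges_fam hS huz (hnm _ huzA),
      Or.inr (hS.2.1 _ (hFT (hAF hg)) (by simp [hB])), hcrossW⟩
  have hgS : ∀ S ∈ Fam P T F B, s(w, z) ∈ S := fun S hS =>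
    hS.2.1 _ (hFT (hAF hg)) (by simp [hB])
  have hfam1 : ∀ S ∈ Fam P T F B, flip S u w v z ∈ Fam P T F A := by
    intro S hS
    refine flip_mem_fam hP hS (hfl1 S hS) fun e he heA => ⟨fun h' => heA (h' ▸ h.mem), ?_⟩
    exact hS.2.1 e he (hnm e heA)
  have hex : ∀ S ∈ Fam P T F B, ∃ z' ∈ W, IsFlip P (flip S u w v z) w z v z' := by
    intro S hS
    refine exists_flip_aux hP (hfam1 S hS) h.subset h.convex
      (fun e he => edges_fam (hfam1 S hS) (h.sides he) (h.sides_not_mem e he)) (hAF hg)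
      (mem_flip.2 (Or.inr ⟨hfg.symm, hgS S hS⟩)) hgd h.apex
      (edges_fam (hfam1 S hS) h.wv h.wv_not_mem) (Or.inr (mem_flip.2 (Or.inl Sym2.eq_swap)))
  choose! z' hzW' hz' using hex
  let ψ : Finset (Sym2 Plane) → Finset (Sym2 Plane) := fun S =>
    flip (flip S u w v z) w z v (z' S)
  have hψ : Set.MapsTo ψ (Fam P T F B) (Fam P T F A) := fun S hS =>
    flip_mem_fam hP (hfam1 S hS) (hz' S hS) fun e he heA =>
      ⟨fun h' => heA (h' ▸ hg), (hfam1 S hS).2.1 e he heA⟩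
  have hψf : ∀ S ∈ Fam P T F B, s(u, w) ∉ ψ S := by
    intro S hS hm
    rcases mem_flip.1 hm with hm | hm
    · simp only [Sym2.eq_iff] at hm
      have := (hP.edge_ends hN h.uv).2.2
      rcases hm with hm | hm
      · exact this hm.1
      · exact hvw hm.2
    · exact (hfl1 S hS).not_mem_flip hP hS.1.nonCrossing hm.2
  have hψg : ∀ S ∈ Fam P T F B, s(w, z) ∉ ψ S := fun S hS =>
    (hz' S hS).not_mem_flip hP (hfam1 S hS).1.nonCrossing
  have hψv : ∀ S ∈ Fam P T F B, s(v, z) ∈ ψ S := fun S hS =>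
    mem_flip.2 (Or.inr ⟨by simp [hvw.symm, hwz.symm], mem_flip.2 (Or.inl rfl)⟩)
  have hψinj : Set.InjOn ψ (Fam P T F B) := by
    have key : ∀ S ∈ Fam P T F B, ∀ S' ∈ Fam P T F B, ψ S = ψ S' → S ⊆ S' := by
      intro S hS S' hS' he e heS
      by_cases h1 : e = s(u, w)
      · rw [h1]; exact (hfl1 S' hS').mem
      by_cases h2 : e = s(w, z)
      · rw [h2]; exact hgS S' hS'
      have : e ∈ ψ S' := he ▸ mem_flip.2 (Or.inr ⟨h2, mem_flip.2 (Or.inr ⟨h1, heS⟩)⟩)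
      rcases mem_flip.1 this with rfl | ⟨-, h3⟩
      · exact absurd heS (not_mem_of_flip_of_mem hP (hfam1 S' hS').1.nonCrossing (hz' S' hS')
            hS.1.nonCrossing (hgS S hS))
      · rcases mem_flip.1 h3 with rfl | h4
        · exact absurd heS ((hfl1 S hS).not_mem hP hS.1.nonCrossing)
        · exact h4.2
    intro S hS S' hS' he
    exact (key S hS S' hS' he).antisymm (key S' hS' S hS he.symm)
  obtain ⟨φ, h1, h2, h3⟩ := h.exists_phi hP hFT hAF
  have hX : Fam P T F (A.erase s(u, w)) ⊆ Fam P T F A := fam_mono (Finset.erase_subset _ _)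
  have hfin : (Fam P T F A).Finite := fam_finite
  have hmemX : ∀ S ∈ Fam P T F (A.erase s(u, w)), s(u, w) ∈ S := fun S hS =>
    hS.2.1 _ (hFT (hAF h.mem)) (by simp)
  have hXY : (Fam P T F (A.erase s(u, w)) ∪ φ '' Fam P T F (A.erase s(u, w))).ncard =
      2 * (Fam P T F (A.erase s(u, w))).ncard := by
    rw [Set.ncard_union_eq ?_ fam_finite (fam_finite.image _), h2.ncard_image, two_mul]
    rw [Set.disjoint_left]
    rintro _ hx ⟨y, hy, rfl⟩
    exact (h3 y hy).1 (hmemX _ hx)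
  rw [← hXY]
  refine ncard_add_le hfin ψ (Set.union_subset hX h1.image_subset) hψ hψinj ?_
  -- The first class contains uw. A member of the second that contains vz must have inserted it, so
  -- uw was flipped in a quadrilateral with side wz; it still contains wz, while the third class
  -- does not.
  rintro S hS (hm | ⟨S', hS', he⟩)
  · exact hψf S hS (hmemX _ hm)
  · obtain ⟨-, y, -, hy, hφ⟩ := h3 S' hS'
    have hN' := hS'.1.nonCrossing
    have hv : s(v, z) ∈ φ S' := he ▸ hψv S hS
    rw [hφ] at hv
    rcases mem_flip.1 hv with hv | hv
    · have hyz : z = y := by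
        rcases Sym2.eq_iff.1 hv with hv | hv
        · exact hv.2
        · rw [← hv.1, ← hv.2]
      subst hyz
      have hgS' : s(w, z) ∈ S' := by
        rcases hy.bd with hs | hs
        · exact absurd hs (not_mem_sides_of_diagonal (hN.subset_diagonals _ (hFT (hAF hg))))
        · exact hs
      refine hψg S hS (he ▸ ?_)
      rw [hφ]
      exact mem_flip.2 (Or.inr ⟨hfg.symm, hgS'⟩)
    · exact hN'.not_mem_of_cross (hmemX _ hS') hcrossW ((hfl1 S hS).edge_ne hP hS.1.nonCrossing) hv.2

end PolyTri

/-! ### The induction for the lower bound. -/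

namespace PolyTri

variable {n : ℕ} {P : Polygon Plane n} {T F A : Finset (Sym2 Plane)}

/-- Interior-disjoint convex regions bounded by edges of the triangulation, such that each member
of `F` is a diagonal of one of them. -/
structure IsRegionFamily (P : Polygon Plane n) (T F : Finset (Sym2 Plane)) (Q : Set (Set Plane)) :
    Prop where
  region : ∀ W ∈ Q, W ⊆ Set.range P.vertices ∧ IsConvexPolygon W ∧ hullSides W ⊆ edges P T
  disjoint : ∀ W ∈ Q, ∀ W' ∈ Q, W ≠ W' →
    Disjoint (interior (convexHull ℝ W)) (interior (convexHull ℝ W'))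
  exists_diagonal : ∀ e ∈ F, ∃ W ∈ Q, e ∈ hullDiagonals W

/-- A member of F runs inside some region W', whereas a side of W is adherent to the interior of W;
disjointness of interiors forbids both unless W = W', where a side is not a diagonal. -/
lemma IsRegionFamily.side_not_mem {Q : Set (Set Plane)} (hQ : IsRegionFamily P T F Q)
    {W : Set Plane} (hW : W ∈ Q) (hi : (interior (convexHull ℝ W)).Nonempty) {e : Sym2 Plane}
    (he : e ∈ hullSides W) : e ∉ F := by
  intro heF
  obtain ⟨W', hW', hd⟩ := hQ.exists_diagonal e heF
  by_cases hWW : W = W'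
  · subst hWW; exact hullSides_disjoint_hullDiagonals he hd
  induction e with | _ p q
  obtain ⟨y, hy⟩ := openSegment_nonempty p q
  have h1 := (mem_hullSides_iff.1 he).2.2.2 (openSegment_subset_segment _ _ _ hy)
  have h2 := (mem_hullDiagonals_iff.1 hd).2.2.2 hy
  have h3 : y ∈ closure (interior (convexHull ℝ W)) := by
    rw [(convex_convexHull ℝ W).closure_interior_eq_closure_of_nonempty_interior hi]; exact h1.1
  obtain ⟨z, hz, hz'⟩ := mem_closure_iff.1 h3 _ isOpen_interior h2
  exact Set.disjoint_left.1 (hQ.disjoint W hW W' hW' hWW) hz' hz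

lemma interior_nonempty_of_diagonal {W : Set Plane} {e : Sym2 Plane} (h : e ∈ hullDiagonals W) :
    (interior (convexHull ℝ W)).Nonempty := by
  obtain ⟨a, -, b, -, -, -, h⟩ := h
  exact (openSegment_nonempty a b).mono h

/-- If a further side of the triangle uwv is in A, it is a diagonal of W; cross it into the next
triangle and repeat. Fewer vertices of W lie ahead each time, and m counts them. -/
lemma exists_leaf_aux (hP : Good P) (hT : IsTriangulation P T) (hFT : F ⊆ T) (hAF : A ⊆ F)
    (hF : ∀ f ∈ F, HasApexes P T f) {Q : Set (Set Plane)} (hQ : IsRegionFamily P T F Q)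
    {W : Set Plane} (hW : W ∈ Q) (m : ℕ) : ∀ u w v : Plane,
      s(u, w) ∈ A → s(u, w) ∈ hullDiagonals W → v ∈ W → s(u, v) ∈ edges P T →
      s(w, v) ∈ edges P T → {p ∈ W | 0 < cr u w v * cr u w p}.ncard = m →
      ∃ u w v, IsLeaf P T A W u w v := by
  have hN := hT.nonCrossing
  obtain ⟨hWr, hconv, hs⟩ := hQ.region W hW
  have hWf : W.Finite := (Set.finite_range _).subset hWr
  have h3 := hP.noThree.mono hWr
  induction m using Nat.strong_induction_on with | _ m ih
  intro u w v hA hd hv huv hwv hm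
  have hi := interior_nonempty_of_diagonal hd
  have key : ∀ u w : Plane, s(u, w) ∈ A → s(u, w) ∈ hullDiagonals W → s(u, v) ∈ edges P T →
      s(w, v) ∈ edges P T → {p ∈ W | 0 < cr u w v * cr u w p}.ncard = m →
      s(u, v) ∈ A → ∃ u w v, IsLeaf P T A W u w v := by
    intro u w hA hd huv hwv hm huvA
    obtain ⟨hu, hw, huw, -⟩ := mem_hullDiagonals_iff.1 hd
    have hune := (hP.edge_ends hN huv).2.2
    have hvne := (hP.edge_ends hN hwv).2.2
    have huvd : s(u, v) ∈ hullDiagonals W :=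
      (hullSide_or_hullDiagonal hWf hi hu hv hune).resolve_left
        fun h => hQ.side_not_mem hW hi h (hAF huvA)
    obtain ⟨z, hz, hz1, hz2⟩ := (hF _ (hAF huvA)).exists_opposite hP hN huv
      (Or.inr (hFT (hAF hA))) (by rwa [Sym2.eq_swap] at hwv)
    obtain ⟨p, hp, hpz⟩ := exists_same_sign huvd (right_ne_zero_of_mul hz.ne)
    have hzW := hP.apex_mem_region hN hWr hs hu hv hp huv hz1 hz2 hpz
    refine ih _ ?_ u v z huvA huvd hzW hz1 hz2 rfl
    rw [← hm]
    have h0 : cr u w v ≠ 0 := h3 u hu w hw v hv huw hune hvne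
    -- Vertices beyond uv are also beyond uw, by convexity, and v itself drops out.
    refine Set.ncard_lt_ncard ((Set.ssubset_iff_of_subset ?_).2 ⟨v, ⟨hv, mul_self_pos.2 h0⟩, ?_⟩)
      (hWf.subset (Set.sep_subset _ _))
    · rintro q ⟨hq, hqz⟩
      refine ⟨hq, ?_⟩
      have hsg : cr u v w * cr u v q < 0 := by
        by_contra! hcon
        have := mul_nonneg hcon hqz.le
        have h4 : 0 < cr u v q * cr u v q := mul_self_pos.2 (right_ne_zero_of_mul hqz.ne')
        nlinarith
      have hcross := hconv.cross h3 hu hv hw hq hsg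
      have hq0 := right_ne_zero_of_mul hsg.ne
      have hqu : q ≠ u := by rintro rfl; simp [cr_self_left] at hq0
      have hqw : q ≠ w := by rintro rfl; nlinarith [mul_self_nonneg (cr u v q)]
      exact same_side_of_signs hsg (signs_of_cross hcross.symm
        (h3 w hw q hq u hu hqw.symm huw.symm hqu))
    · rintro ⟨-, hlt⟩
      rw [cr_self_right, mul_zero] at hlt
      exact hlt.false
  by_cases h1 : s(u, v) ∈ A
  · exact key u w hA hd huv hwv hm h1
  by_cases h2 : s(w, v) ∈ A
  · refine key w u (by rwa [Sym2.eq_swap]) (by rwa [Sym2.eq_swap]) hwv huv ?_ h2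
    rw [← hm]
    congr 1
    ext p
    simp only [Set.mem_ofPred_eq]
    rw [cr_swap u w v, cr_swap u w p, neg_mul_neg]
  · exact ⟨u, w, v, hWr, hconv, hs, fun e he hA => hQ.side_not_mem hW hi he (hAF hA), hA, hd, hv,
      huv, hwv, h1, h2⟩

lemma exists_leaf (hP : Good P) (hT : IsTriangulation P T) (hFT : F ⊆ T) (hAF : A ⊆ F)
    (hF : ∀ f ∈ F, HasApexes P T f) {Q : Set (Set Plane)} (hQ : IsRegionFamily P T F Q)
    (hA : A.Nonempty) : ∃ W u w v, IsLeaf P T A W u w v := by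
  have hN := hT.nonCrossing
  obtain ⟨f, hf⟩ := hA
  obtain ⟨W, hW, hd⟩ := hQ.exists_diagonal f (hAF hf)
  obtain ⟨u, w, c, d, rfl, hs, h1, h2, -, -⟩ := hF f (hAF hf)
  obtain ⟨p, hp, hpz⟩ := exists_same_sign hd (left_ne_zero_of_mul hs.ne)
  obtain ⟨hWr, hconv, hsd⟩ := hQ.region W hW
  obtain ⟨hu, hw, -, -⟩ := mem_hullDiagonals_iff.1 hd
  exact ⟨W, exists_leaf_aux hP hT hFT hAF hF hQ hW _ u w c hf hd
    (hP.apex_mem_region hN hWr hsd hu hw hp (Or.inr (hFT (hAF hf))) h1 h2 hpz) h1 h2 rfl⟩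

lemma IsLeaf.swap {W : Set Plane} {u w v : Plane} (h : IsLeaf P T A W u w v) :
    IsLeaf P T A W w u v :=
  ⟨h.subset, h.convex, h.sides, h.sides_not_mem, Sym2.eq_swap ▸ h.mem, Sym2.eq_swap ▸ h.diag,
    h.apex, h.wv, h.uv, h.wv_not_mem, h.uv_not_mem⟩

/-- `h` is the third side of a triangle with two sides in `A`. -/
def ClosesTriangle (A : Finset (Sym2 Plane)) (h : Sym2 Plane) : Prop :=
  ∃ a b c, h = s(a, b) ∧ s(a, c) ∈ A ∧ s(b, c) ∈ A

-- A triangle spoilt by removing pq has pq as a side. It is not pqr, which has no other side in A,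
-- so by uniqueness of apexes it lies across pq from r.
open Classical in
lemma exists_apex_of_not_closes (hP : Good P) (hN : IsNonCrossing P T) (hAT : A ⊆ T)
    {p q r : Plane} (hpq : s(p, q) ∈ A) (hpr : s(p, r) ∈ edges P T) (hqr : s(q, r) ∈ edges P T)
    (hpA : s(p, r) ∉ A) (hqA : s(q, r) ∉ A) {h : Sym2 Plane} (hE : h ∈ edges P T)
    (hc : ClosesTriangle A h) (hn : ¬ ClosesTriangle (A.erase s(p, q)) h) :
    ∃ a b c, s(a, c) = s(p, q) ∧ h = s(a, b) ∧ s(c, b) ∈ A ∧ cr p q r * cr p q b < 0 := by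
  obtain ⟨a, b, c, rfl, hac, hbc⟩ := hc
  have key : ∀ a b, s(a, b) ∈ edges P T → s(b, c) ∈ A → s(a, c) = s(p, q) →
      cr p q r * cr p q b < 0 := by
    intro a b hE hbc he
    have hE1 := hP.edge_ends hN (Or.inr (hAT hpq))
    have hE2 := hP.edge_ends hN hpr
    have hE3 := hP.edge_ends hN hqr
    have h0 := hP.noThree p hE1.1 q hE1.2.1 r hE2.2.1 hE1.2.2 hE2.2.2 hE3.2.2
    have hpb : s(p, b) ∈ edges P T ∧ s(q, b) ∈ edges P T ∧ (s(p, b) ∈ A ∨ s(q, b) ∈ A) := by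
      rcases Sym2.eq_iff.1 he with ⟨rfl, rfl⟩ | ⟨rfl, rfl⟩
      · rw [Sym2.eq_swap] at hbc; exact ⟨hE, Or.inr (hAT hbc), Or.inr hbc⟩
      · rw [Sym2.eq_swap] at hbc; exact ⟨Or.inr (hAT hbc), hE, Or.inl hbc⟩
    obtain ⟨h1, h2, h3⟩ := hpb
    have h0' := hP.noThree p hE1.1 q hE1.2.1 b (hP.edge_ends hN h1).2.1 hE1.2.2
      (hP.edge_ends hN h1).2.2 (hP.edge_ends hN h2).2.2
    by_contra! hcon
    have := hP.apex_unique hN (Or.inr (hAT hpq)) hpr hqr h1 h2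
      (lt_of_le_of_ne hcon (mul_ne_zero h0 h0').symm)
    subst this
    exact h3.elim hpA hqA
  by_cases h1 : s(a, c) = s(p, q)
  · exact ⟨a, b, c, h1, rfl, Sym2.eq_swap ▸ hbc, key a b hE hbc h1⟩
  by_cases h2 : s(b, c) = s(p, q)
  · exact ⟨b, a, c, h2, Sym2.eq_swap, Sym2.eq_swap ▸ hac,
      key b a (by rwa [Sym2.eq_swap]) hac h2⟩
  · exact absurd ⟨a, b, c, rfl, Finset.mem_erase.2 ⟨h1, hac⟩, Finset.mem_erase.2 ⟨h2, hbc⟩⟩ hn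

-- Both spoilt triangles are the unique one across pq from r. It has exactly one side outside A, so
-- removing a leaf spoils at most one closing edge.
open Classical in
lemma eq_of_not_closes (hP : Good P) (hN : IsNonCrossing P T) (hAT : A ⊆ T)
    {p q r : Plane} (hpq : s(p, q) ∈ A) (hpr : s(p, r) ∈ edges P T) (hqr : s(q, r) ∈ edges P T)
    (hpA : s(p, r) ∉ A) (hqA : s(q, r) ∉ A) {h h' : Sym2 Plane} (hE : h ∈ edges P T)
    (hE' : h' ∈ edges P T) (hA : h ∉ A)
    (hc : ClosesTriangle A h) (hn : ¬ ClosesTriangle (A.erase s(p, q)) h)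
    (hc' : ClosesTriangle A h') (hn' : ¬ ClosesTriangle (A.erase s(p, q)) h') : h = h' := by
  obtain ⟨a, b, c, he, rfl, hcb, hs⟩ :=
    exists_apex_of_not_closes hP hN hAT hpq hpr hqr hpA hqA hE hc hn
  obtain ⟨a', b', c', he', rfl, hcb', hs'⟩ :=
    exists_apex_of_not_closes hP hN hAT hpq hpr hqr hpA hqA hE' hc' hn'
  have hcb1 : s(c, b) ∈ edges P T := Or.inr (hAT hcb)
  have hcb1' : s(c', b') ∈ edges P T := Or.inr (hAT hcb')
  have hb : s(p, b) ∈ edges P T ∧ s(q, b) ∈ edges P T := by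
    rcases Sym2.eq_iff.1 he with ⟨rfl, rfl⟩ | ⟨rfl, rfl⟩
    · exact ⟨hE, hcb1⟩
    · exact ⟨hcb1, hE⟩
  have hb' : s(p, b') ∈ edges P T ∧ s(q, b') ∈ edges P T := by
    rcases Sym2.eq_iff.1 he' with ⟨rfl, rfl⟩ | ⟨rfl, rfl⟩
    · exact ⟨hE', hcb1'⟩
    · exact ⟨hcb1', hE'⟩
  have hbb : b = b' := by
    refine hP.apex_unique hN (Or.inr (hAT hpq)) hb.1 hb.2 hb'.1 hb'.2 ?_
    have h1 := mul_pos_of_neg_of_neg hs hs'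
    have h2 : 0 < cr p q r * cr p q r := mul_self_pos.2 (left_ne_zero_of_mul hs.ne)
    by_contra! hcon
    nlinarith
  subst hbb
  rcases Sym2.eq_iff.1 (he.trans he'.symm) with ⟨rfl, rfl⟩ | ⟨rfl, rfl⟩
  · rfl
  · exact absurd hcb' hA

open Classical in
/-- A set `A` of ps-flippable diagonals together with edges `B` closing triangles with two sides in
`A`. -/
lemma two_pow_mul_pow_le_fam (hP : Good P) (hT : IsTriangulation P T) (hFT : F ⊆ T)
    (hF : ∀ f ∈ F, HasApexes P T f) {Q : Set (Set Plane)} (hQ : IsRegionFamily P T F Q)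
    {x : ℝ} (hx1 : 1 ≤ x) (hx : x ^ 2 ≤ x + 1 / 4) : ∀ A : Finset (Sym2 Plane), A ⊆ F →
    ∀ B : Finset (Sym2 Plane), (∀ h ∈ B, h ∈ edges P T ∧ h ∉ A ∧ ClosesTriangle A h) →
      2 ^ A.card * x ^ B.card ≤ ((Fam P T F A).ncard : ℝ) := by
  have hN := hT.nonCrossing
  intro A
  induction A using Finset.strongInduction with | _ A ih
  intro hAF B hB
  rcases A.eq_empty_or_nonempty with rfl | hne
  · have hB0 : B = ∅ := by
      refine Finset.eq_empty_of_forall_notMem fun h hh => ?_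
      obtain ⟨a, b, c, -, h1, -⟩ := (hB h hh).2.2
      simp at h1
    rw [hB0]
    have : 0 < (Fam P T F ∅).ncard :=
      (Set.ncard_pos fam_finite).2 ⟨T, self_mem_fam hT fun f hf _ => hF f hf⟩
    simpa using Nat.succ_le_of_lt this
  obtain ⟨W, u, w, v, hL⟩ := exists_leaf hP hT hFT hAF hF hQ hne
  have hAT := hAF.trans hFT
  have hx0 : 0 < x := by linarith
  by_cases hall : ∀ h ∈ B, ClosesTriangle (A.erase s(u, w)) h
  · have h1 := ih _ (Finset.erase_ssubset hL.mem) ((Finset.erase_subset _ _).trans hAF) B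
      fun h hh => ⟨(hB h hh).1, fun h' => (hB h hh).2.1 (Finset.mem_of_mem_erase h'), hall h hh⟩
    have h2 : (2 : ℝ) * (Fam P T F (A.erase s(u, w))).ncard ≤ (Fam P T F A).ncard := by
      exact_mod_cast hL.two_mul_le hP hFT hAF
    rw [← Finset.card_erase_add_one hL.mem, pow_succ]
    linarith
  push Not at hall
  obtain ⟨h₀, hh₀, hn₀⟩ := hall
  have hex : ∃ u w z, IsLeaf P T A W u w v ∧ h₀ = s(u, z) ∧ s(w, z) ∈ A ∧
      cr u w v * cr u w z < 0 ∧ ¬ ClosesTriangle (A.erase s(u, w)) h₀ := by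
    obtain ⟨a, z, c, he, hz, hcz, hs⟩ := exists_apex_of_not_closes hP hN hAT hL.mem hL.uv hL.wv
      hL.uv_not_mem hL.wv_not_mem (hB h₀ hh₀).1 (hB h₀ hh₀).2.2 hn₀
    rcases Sym2.eq_iff.1 he with ⟨rfl, rfl⟩ | ⟨rfl, rfl⟩
    · exact ⟨_, _, z, hL, hz, hcz, hs, hn₀⟩
    · refine ⟨_, _, z, hL.swap, hz, hcz, ?_, he ▸ hn₀⟩
      rwa [cr_swap c a, cr_swap c a, neg_mul_neg]
  clear hL hn₀
  obtain ⟨u, w, z, hL, rfl, hg, hs, hn₀⟩ := hex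
  obtain ⟨huz, huzA, hcl⟩ := hB _ hh₀
  obtain ⟨hu, hw, huw, -⟩ := mem_hullDiagonals_iff.1 hL.diag
  have hzW : z ∈ W := by
    obtain ⟨p, hp, hpz⟩ := exists_same_sign hL.diag (right_ne_zero_of_mul hs.ne)
    exact hP.apex_mem_region hN hL.subset hL.sides hu hw hp (Or.inr (hAT hL.mem)) huz
      (Or.inr (hAT hg)) hpz
  have hzu : u ≠ z := (hP.edge_ends hN huz).2.2
  have hgf : s(w, z) ≠ s(u, w) := by simp [hzu.symm, huw.symm]
  have hle := hL.two_mul_add_le hP hT hFT hAF hg hzW huz huzA hs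
  set A₁ := A.erase s(u, w) with hA₁
  have hg₁ : s(w, z) ∈ A₁ := Finset.mem_erase.2 ⟨hgf, hg⟩
  set A₂ := A₁.erase s(w, z) with hA₂
  have hA₁A : A₁ ⊆ A := Finset.erase_subset _ _
  have hA₂A : A₂ ⊆ A₁ := Finset.erase_subset _ _
  have hB₁ : ∀ h ∈ B.erase s(u, z), h ∈ edges P T ∧ h ∉ A₁ ∧ ClosesTriangle A₁ h := by
    intro h hh
    obtain ⟨hh1, hh2⟩ := Finset.mem_erase.1 hh
    obtain ⟨hE, hA, hc⟩ := hB h hh2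
    refine ⟨hE, fun h' => hA (hA₁A h'), ?_⟩
    by_contra hcon
    exact hh1 (eq_of_not_closes hP hN hAT hL.mem hL.uv hL.wv hL.uv_not_mem hL.wv_not_mem hE huz
      hA hc hcon hcl hn₀)
  have ih₁ := ih A₁ (Finset.erase_ssubset hL.mem) (hA₁A.trans hAF) _ hB₁
  obtain ⟨B₂, hcard, hB₂⟩ : ∃ B₂ : Finset (Sym2 Plane), B.card ≤ B₂.card + 2 ∧
      ∀ h ∈ B₂, h ∈ edges P T ∧ h ∉ A₂ ∧ ClosesTriangle A₂ h := by
    have hBc := Finset.card_erase_add_one hh₀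
    by_cases hall : ∀ h ∈ B.erase s(u, z), ClosesTriangle A₂ h
    · exact ⟨B.erase s(u, z), by omega, fun h hh => ⟨(hB₁ h hh).1,
        fun h' => (hB₁ h hh).2.1 (hA₂A h'), hall h hh⟩⟩
    push Not at hall
    obtain ⟨h₁, hh₁, hn₁⟩ := hall
    refine ⟨(B.erase s(u, z)).erase h₁, ?_, fun h hh => ?_⟩
    · have := Finset.card_erase_add_one hh₁; omega
    · obtain ⟨h1, h2⟩ := Finset.mem_erase.1 hh
      obtain ⟨hE, hA, hc⟩ := hB₁ h h2
      refine ⟨hE, fun h' => hA (hA₂A h'), ?_⟩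
      by_contra hcon
      -- After uw is removed, wz is again a leaf on the side of u: neither uw nor uz lies in `A₁`.
      -- Hence removing it spoils at most one more member of B.
      refine h1 (eq_of_not_closes hP hN (hA₁A.trans hAT) hg₁ (r := u) ?_ ?_ ?_ ?_ hE
        (hB₁ h₁ hh₁).1 hA hc hcon (hB₁ h₁ hh₁).2.2 hn₁)
      · rw [Sym2.eq_swap]; exact Or.inr (hAT hL.mem)
      · rwa [Sym2.eq_swap]
      · rw [Sym2.eq_swap]; exact Finset.notMem_erase _ _
      · rw [Sym2.eq_swap]; exact fun h' => huzA (hA₁A h')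
  have ih₂ := ih A₂ ((Finset.erase_ssubset hg₁).trans (Finset.erase_ssubset hL.mem))
    ((hA₂A.trans hA₁A).trans hAF) B₂ hB₂
  have hle' : (2 : ℝ) * (Fam P T F A₁).ncard + (Fam P T F A₂).ncard ≤ (Fam P T F A).ncard := by
    exact_mod_cast hle
  refine le_trans ?_ hle'
  have c1 : A.card = A₂.card + 2 := by
    rw [← Finset.card_erase_add_one hL.mem, ← Finset.card_erase_add_one hg₁]
  have c2 : A₁.card = A₂.card + 1 := (Finset.card_erase_add_one hg₁).symm
  have c3 := Finset.card_erase_add_one hh₀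
  rw [c2] at ih₁
  rw [c1, ← c3]
  set k := (B.erase s(u, z)).card with hk
  have hp : x ^ k ≤ x * x ^ B₂.card := by
    rw [← pow_succ']
    exact pow_le_pow_right₀ hx1 (by omega)
  have h2p : (0 : ℝ) < 2 ^ A₂.card := by positivity
  have hxk : 0 < x ^ k := by positivity
  have e1 : (2 : ℝ) * (2 ^ (A₂.card + 1) * x ^ k) + 2 ^ A₂.card * x ^ B₂.card ≤
      2 * (Fam P T F A₁).ncard + (Fam P T F A₂).ncard := by linarith
  refine le_trans ?_ e1
  -- With at most two closing edges lost, the recursion needs 4x^2 ≤ 4x + 1.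
  have : 4 * (x * x ^ k) ≤ 4 * x ^ k + x ^ B₂.card := by
    have hy : x ^ k ≤ x * x ^ B₂.card := hp
    have h5 : x * (4 * (x * x ^ k)) ≤ x * (4 * x ^ k + x ^ B₂.card) := by
      have : x * (4 * (x * x ^ k)) = 4 * (x ^ 2 * x ^ k) := by ring
      nlinarith
    exact le_of_mul_le_mul_left h5 hx0
  calc (2 : ℝ) ^ (A₂.card + 2) * x ^ (k + 1) = 2 ^ A₂.card * (4 * (x * x ^ k)) := by ring
    _ ≤ 2 ^ A₂.card * (4 * x ^ k + x ^ B₂.card) := by gcongr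
    _ = _ := by ring

/-- As 1 ≤ x ≤ 2, the largest weight comes from two factors 2 and three factors x. -/
lemma two_pow_mul_pow_le_four {x : ℝ} (hx1 : 1 ≤ x) (hx2 : x ≤ 2) {i j : ℕ} (hi : i ≤ 2)
    (hij : i + j ≤ 5) : 2 ^ i * x ^ j ≤ 4 * x ^ 3 := by
  have h : (2 : ℝ) ^ i * x ^ j ≤ 2 ^ i * x ^ (5 - i) := by
    gcongr
    omega
  refine h.trans ?_
  interval_cases i
  · have : x ^ 2 ≤ 4 := by nlinarith
    calc _ = x ^ 2 * x ^ 3 := by ring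
      _ ≤ 4 * x ^ 3 := by gcongr
  · calc _ = 2 * x * x ^ 3 := by ring
      _ ≤ 4 * x ^ 3 := by gcongr; linarith
  · norm_num

open Classical in
lemma card_inter_pair_le {X : Finset (Sym2 Plane)} {e f : Sym2 Plane} (h : ¬ (e ∈ X ∧ f ∈ X)) :
    (X ∩ {e, f}).card ≤ 1 := by
  by_cases he : e ∈ X
  · refine (Finset.card_le_card (t := {e}) fun g hg => ?_).trans (Finset.card_singleton e).le
    obtain ⟨h1, h2⟩ := Finset.mem_inter.1 hg
    rcases Finset.mem_insert.1 h2 with h2 | h2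
    · exact Finset.mem_singleton.2 h2
    · exact absurd ⟨he, Finset.mem_singleton.1 h2 ▸ h1⟩ h
  · refine (Finset.card_le_card (t := {f}) fun g hg => ?_).trans (Finset.card_singleton f).le
    obtain ⟨h1, h2⟩ := Finset.mem_inter.1 hg
    rcases Finset.mem_insert.1 h2 with h2 | h2
    · exact absurd (h2 ▸ h1) he
    · exact h2

open Classical in
lemma two_pow_mul_pow_le_fam_flippable (hP : Good P) (hT : IsTriangulation P T) (hFT : F ⊆ T)
    (hF : ∀ f ∈ F, HasApexes P T f) {Q : Set (Set Plane)} (hQ : IsRegionFamily P T F Q)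
    {x : ℝ} (hx1 : 1 ≤ x) (hx2 : x ≤ 2) (hx : x ^ 2 ≤ x + 1 / 4) (hx3 : 4 * x ^ 3 ≤ 4 * x ^ 2 + 1) :
    ∀ A : Finset (Sym2 Plane), A ⊆ flippableDiagonals P T →
      2 ^ (A ∩ F).card * x ^ (A \ F).card ≤ ((Fam P T F A).ncard : ℝ) := by
  have hN := hT.nonCrossing
  have hx0 : 0 < x := by linarith
  intro A
  induction A using Finset.strongInduction with | _ A ih
  intro hA
  have hAT : ∀ e ∈ A, e ∈ T ∧ IsFlippable P T e := fun e he => Finset.mem_filter.1 (hA he)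
  by_cases hgood : ∃ a b c d, s(a, b) ∈ A \ F ∧ IsFlip P T a b c d ∧
      ¬ (s(a, c) ∈ A ∩ F ∧ s(b, c) ∈ A ∩ F) ∧ ¬ (s(a, d) ∈ A ∩ F ∧ s(b, d) ∈ A ∩ F)
  · obtain ⟨a, b, c, d, he, hfl, hc, hd⟩ := hgood
    obtain ⟨heA, heF⟩ := Finset.mem_sdiff.1 he
    have hle : ((Fam P T F (A.erase s(a, b))).ncard : ℝ) +
      (Fam P T F (A \ {s(a, b), s(a, c), s(b, c), s(a, d), s(b, d)})).ncard ≤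
      (Fam P T F A).ncard := by exact_mod_cast ncard_fam_flip hP hfl heA
    set N : Finset (Sym2 Plane) := {s(a, b), s(a, c), s(b, c), s(a, d), s(b, d)} with hNdef
    refine le_trans ?_ hle
    have ih₁ := ih _ (Finset.erase_ssubset heA) ((Finset.erase_subset _ _).trans hA)
    have ih₂ := ih (A \ N) (Finset.ssubset_iff_subset_ne.2 ⟨Finset.sdiff_subset,
      fun h => (Finset.mem_sdiff.1 (h ▸ heA)).2 (by simp [hNdef])⟩) (Finset.sdiff_subset.trans hA)
    have e1 : A.erase s(a, b) ∩ F = A ∩ F := by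
      rw [Finset.erase_inter, Finset.erase_eq_of_notMem]
      exact fun h => heF (Finset.mem_inter.1 h).2
    have e2 : A.erase s(a, b) \ F = (A \ F).erase s(a, b) := Finset.erase_sdiff_comm _ _ _
    have c2 := Finset.card_erase_add_one he
    rw [e1, e2] at ih₁
    set i := (A ∩ F).card with hi
    set j := ((A \ F).erase s(a, b)).card with hj
    have c3 : (A \ N ∩ F).card + (A ∩ F ∩ N).card = i := by
      have : A \ N ∩ F = (A ∩ F) \ N := by ext; simp; tauto
      rw [this, hi, Finset.card_sdiff_add_card_inter]
    have c4 : ((A \ N) \ F).card + ((A \ F) ∩ N).card = j + 1 := by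
      have : (A \ N) \ F = (A \ F) \ N := by ext; simp; tauto
      rw [this, hj, c2, Finset.card_sdiff_add_card_inter]
    have c5 : (A ∩ F ∩ N).card + ((A \ F) ∩ N).card ≤ 5 := by
      rw [← Finset.card_union_of_disjoint]
      · refine (Finset.card_le_card (t := N) ?_).trans Finset.card_le_five
        intro e; simp only [Finset.mem_union, Finset.mem_inter]; tauto
      · rw [Finset.disjoint_left]; intro e; simp; tauto
    have c6 : (A ∩ F ∩ N).card ≤ 2 := by
      have hsub : A ∩ F ∩ N ⊆ A ∩ F ∩ {s(a, c), s(b, c)} ∪ A ∩ F ∩ {s(a, d), s(b, d)} := by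
        intro e he
        obtain ⟨h1, h2⟩ := Finset.mem_inter.1 he
        simp only [hNdef, Finset.mem_insert, Finset.mem_singleton] at h2
        have hab : e ≠ s(a, b) := fun h => heF (h ▸ (Finset.mem_inter.1 h1).2)
        rw [Finset.mem_union]
        rcases h2 with h2 | h2 | h2 | h2 | h2
        · exact absurd h2 hab
        · exact Or.inl (Finset.mem_inter.2 ⟨h1, by simp [h2]⟩)
        -- Each triangle on ab contributes at most one side to A ∩ F, whence the bound 2.
        · exact Or.inl (Finset.mem_inter.2 ⟨h1, by simp [h2]⟩)
        · exact Or.inr (Finset.mem_inter.2 ⟨h1, by simp [h2]⟩)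
        · exact Or.inr (Finset.mem_inter.2 ⟨h1, by simp [h2]⟩)
      have := (Finset.card_le_card hsub).trans (Finset.card_union_le _ _)
      have := card_inter_pair_le hc
      have := card_inter_pair_le hd
      omega
    set i₂ := (A \ N ∩ F).card
    set j₂ := ((A \ N) \ F).card
    set p := (A ∩ F ∩ N).card
    set q := ((A \ F) ∩ N).card
    have hpq := two_pow_mul_pow_le_four hx1 hx2 c6 c5
    rw [← c2]
    have key : 2 ^ i * x ^ (j + 1) ≤ 2 ^ i₂ * x ^ j₂ * (4 * x ^ 3) := by
      calc (2 : ℝ) ^ i * x ^ (j + 1) = 2 ^ i₂ * x ^ j₂ * (2 ^ p * x ^ q) := by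
            rw [← c3, ← c4, pow_add, pow_add]; ring
        _ ≤ _ := by gcongr
    have hY : (0 : ℝ) < 2 ^ i * x ^ j := by positivity
    -- This is where 4x^3 ≤ 4x^2 + 1 enters.
    have hk2 : (2 : ℝ) ^ i * x ^ (j + 1) ≤ 2 ^ i * x ^ j + 2 ^ i₂ * x ^ j₂ := by
      rw [pow_succ] at key ⊢
      have h7 : (4 * x ^ 3) * (2 ^ i * (x ^ j * x)) ≤
          (4 * x ^ 3) * (2 ^ i * x ^ j + 2 ^ i₂ * x ^ j₂) := by
        have h8 := mul_le_mul_of_nonneg_right hx3 (by positivity : 0 ≤ 2 ^ i * x ^ j * x)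
        nlinarith
      exact le_of_mul_le_mul_left h7 (by positivity)
    linarith
  -- Now every member of A \ F closes a triangle with two sides in A ∩ F, so it can serve as the set
  -- B of `two_pow_mul_pow_le_fam`.
  · push Not at hgood
    have hsub : A ∩ F ⊆ A := Finset.inter_subset_left
    have h1 := two_pow_mul_pow_le_fam hP hT hFT hF hQ hx1 hx (A ∩ F) Finset.inter_subset_right
      (A \ F) (fun h hh => by
        obtain ⟨h1, h2⟩ := Finset.mem_sdiff.1 hh
        refine ⟨Or.inr (hAT h h1).1, fun h' => h2 (Finset.mem_inter.1 h').2, ?_⟩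
        obtain ⟨a, b, c, d, rfl, hfl⟩ := (hAT h h1).2.exists_isFlip hP hN (hAT h h1).1
        by_cases hc : s(a, c) ∈ A ∩ F ∧ s(b, c) ∈ A ∩ F
        · exact ⟨a, b, c, rfl, hc.1, hc.2⟩
        · have hd := hgood a b c d hh hfl (fun h1 h2 => hc ⟨h1, h2⟩)
          exact ⟨a, b, d, rfl, hd.1, hd.2⟩)
    refine h1.trans ?_
    exact_mod_cast Set.ncard_le_ncard (fam_mono hsub) fam_finite

/-- The lower bound on the number of triangulations. -/
lemma gonProperty_of_le {x : ℝ} (hx1 : 1 ≤ x) (hx2 : x ≤ 2) (hx : x ^ 2 ≤ x + 1 / 4)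
    (hx3 : 4 * x ^ 3 ≤ 4 * x ^ 2 + 1) : GonProperty x := by
  classical
  intro n P hs hg T hT F hF hps
  have hP : Good P := ⟨hs, hg⟩
  obtain ⟨hFT, Q, h1, h2, h3⟩ := hps
  have hap : ∀ f ∈ F, HasApexes P T f := by
    intro f hf
    obtain ⟨a, b, c, d, rfl, hfl⟩ := (Finset.mem_filter.1 (hF hf)).2.exists_isFlip hP
      hT.nonCrossing (hFT hf)
    exact hfl.hasApexes_self hP hT.nonCrossing
  have h := two_pow_mul_pow_le_fam_flippable hP hT hFT hap ⟨h1, h2, h3⟩ hx1 hx2 hx hx3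
    (flippableDiagonals P T) subset_rfl
  rw [Finset.inter_eq_right.2 hF, Finset.card_sdiff_of_subset hF] at h
  exact h.trans (by exact_mod_cast ncard_fam_le)

end PolyTri

/-! ### Convex quadrilaterals and the hexagon. -/

namespace PolyTri

section Quadrilateral

variable {a b c d : Plane}

lemma ne_of_signs (h1 : cr a b c * cr a b d < 0) : a ≠ b ∧ a ≠ c ∧ b ≠ c := by
  have h := left_ne_zero_of_mul h1.ne
  refine ⟨?_, ?_, ?_⟩ <;> rintro rfl
  · simp [cr] at h
  · exact h (cr_self_left _ _)
  · exact h (cr_self_right _ _)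

lemma convex_halfPlane (c d a : Plane) : Convex ℝ {y | cr c d a * cr c d y ≤ 0} := by
  intro y hy z hz s t hs ht hst
  simp only [Set.mem_ofPred_eq] at *
  rw [cr_comb _ _ _ _ hst]
  nlinarith

lemma isConvexPolygon_of_signs (h1 : cr a b c * cr a b d < 0) (h2 : cr c d a * cr c d b < 0) :
    IsConvexPolygon {a, b, c, d} := by
  obtain ⟨hab, hac, hbc⟩ := ne_of_signs h1
  refine ⟨by simp, ?_, ?_⟩
  · have h3 : 2 < ({a, b, c, d} : Set Plane).ncard :=
      (Set.two_lt_ncard_iff (by simp)).2 ⟨a, b, c, by simp, by simp, by simp, hab, hac, hbc⟩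
    exact h3
  · rw [convexIndependent_set_iff_notMem_convexHull_sdiff]
    have key : ∀ (S : Set Plane) (a b c d : Plane), S ⊆ {b, c, d} → cr c d a * cr c d b < 0 →
        a ∉ convexHull ℝ S := by
      intro S a b c d hS h hmem
      have hsub : S ⊆ {y | cr c d a * cr c d y ≤ 0} := by
        intro y hy
        rcases hS hy with rfl | rfl | rfl
        · exact h.le
        · simp [cr_self_left]
        · simp [cr_self_right]
      have := convexHull_min hsub (convex_halfPlane c d a) hmem
      have h0 : 0 < cr c d a * cr c d a := mul_self_pos.2 (left_ne_zero_of_mul h.ne)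
      exact absurd this (not_le.2 h0)
    have h1' : cr a b d * cr a b c < 0 := by rwa [mul_comm]
    have h2' : cr c d b * cr c d a < 0 := by rwa [mul_comm]
    rintro x (rfl | rfl | rfl | rfl)
    · exact key _ _ b c d (by rintro y ⟨rfl | rfl | rfl | rfl, hy⟩ <;> simp_all) h2
    · exact key _ _ a c d (by rintro y ⟨rfl | rfl | rfl | rfl, hy⟩ <;> simp_all) h2'
    · exact key _ _ d a b (by rintro y ⟨rfl | rfl | rfl | rfl, hy⟩ <;> simp_all) h1
    · exact key _ _ c a b (by rintro y ⟨rfl | rfl | rfl | rfl, hy⟩ <;> simp_all) h1'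

lemma diagonals_of_signs (h1 : cr a b c * cr a b d < 0) (h2 : cr c d a * cr c d b < 0) :
    s(a, b) ∈ hullDiagonals {a, b, c, d} ∧ s(c, d) ∈ hullDiagonals {a, b, c, d} := by
  obtain ⟨hab, hac, hbc⟩ := ne_of_signs h1
  obtain ⟨hcd, -, -⟩ := ne_of_signs h2
  have h0 := left_ne_zero_of_mul h1.ne
  obtain ⟨x, hx1, hx2⟩ := cross_of_signs h1 h2
  have hV : ({a, b, c, d} : Set Plane).Finite := by simp
  have ha : a ∈ ({a, b, c, d} : Set Plane) := by simp
  have hb : b ∈ ({a, b, c, d} : Set Plane) := by simp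
  have hc : c ∈ ({a, b, c, d} : Set Plane) := by simp
  have hd : d ∈ ({a, b, c, d} : Set Plane) := by simp
  have hi := crossing_mem_interior (interior_nonempty_of_cr_ne ha hb hc h0) ha hb hc hd hx1 hx2 h0
  exact ⟨mem_hullDiagonals_of_mem_interior hV ha hb hab hx1 hi,
    mem_hullDiagonals_of_mem_interior hV hc hd hcd hx2 hi⟩

lemma hullSides_quad_subset {E : Set (Sym2 Plane)} (h1 : cr a b c * cr a b d < 0)
    (h2 : cr c d a * cr c d b < 0) (hac : s(a, c) ∈ E) (hbc : s(b, c) ∈ E) (had : s(a, d) ∈ E)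
    (hbd : s(b, d) ∈ E) : hullSides {a, b, c, d} ⊆ E := by
  obtain ⟨d1, d2⟩ := diagonals_of_signs h1 h2
  intro e he
  have he' := he
  obtain ⟨p, hp, q, hq, hne, rfl, -⟩ := he'
  have d1' : s(b, a) ∈ hullDiagonals {a, b, c, d} := by rwa [Sym2.eq_swap]
  have d2' : s(d, c) ∈ hullDiagonals {a, b, c, d} := by rwa [Sym2.eq_swap]
  have hca : s(c, a) ∈ E := by rwa [Sym2.eq_swap]
  have hcb : s(c, b) ∈ E := by rwa [Sym2.eq_swap]
  have hda : s(d, a) ∈ E := by rwa [Sym2.eq_swap]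
  have hdb : s(d, b) ∈ E := by rwa [Sym2.eq_swap]
  rcases hp with rfl | rfl | rfl | rfl <;> rcases hq with rfl | rfl | rfl | rfl <;>
    first
    | exact absurd rfl hne
    | assumption
    | exact (hullSides_disjoint_hullDiagonals he d1).elim
    | exact (hullSides_disjoint_hullDiagonals he d2).elim
    | exact (hullSides_disjoint_hullDiagonals he d1').elim
    | exact (hullSides_disjoint_hullDiagonals he d2').elim

lemma isFlippable_of_signs {n : ℕ} {P : Polygon Plane n} {T : Finset (Sym2 Plane)}
    (h1 : cr a b c * cr a b d < 0)
    (h2 : cr c d a * cr c d b < 0) (hac : s(a, c) ∈ edges P T) (hbc : s(b, c) ∈ edges P T)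
    (had : s(a, d) ∈ edges P T) (hbd : s(b, d) ∈ edges P T) : IsFlippable P T s(a, b) :=
  ⟨a, b, c, d, rfl, (ne_of_signs h2).1, hac, hbc, had, hbd, isConvexPolygon_of_signs h1 h2,
    (diagonals_of_signs h1 h2).1⟩

end Quadrilateral

/-- The abscissas of the vertices of the hexagon. -/
def hexX : Fin 6 → ℤ := ![0, 2, -1, -3, -1, 2]

/-- The ordinates of the vertices of the hexagon. -/
def hexY : Fin 6 → ℤ := ![0, 1, 2, 0, -2, -1]

/-- A hexagon with exactly five triangulations: its vertex `0` is reflex. -/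
noncomputable def hex : Polygon Plane 6 := ⟨fun i => !₂[(hexX i : ℝ), (hexY i : ℝ)]⟩

lemma hex_zero (i : Fin 6) : hex i 0 = hexX i := rfl

lemma hex_one (i : Fin 6) : hex i 1 = hexY i := rfl

@[simp] lemma hexX_zero : hexX 0 = 0 := rfl
@[simp] lemma hexX_one : hexX 1 = 2 := rfl
@[simp] lemma hexX_two : hexX 2 = -1 := rfl
@[simp] lemma hexX_three : hexX 3 = -3 := rfl
@[simp] lemma hexX_four : hexX 4 = -1 := rfl
@[simp] lemma hexX_five : hexX 5 = 2 := rfl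
@[simp] lemma hexY_zero : hexY 0 = 0 := rfl
@[simp] lemma hexY_one : hexY 1 = 1 := rfl
@[simp] lemma hexY_two : hexY 2 = 2 := rfl
@[simp] lemma hexY_three : hexY 3 = 0 := rfl
@[simp] lemma hexY_four : hexY 4 = -2 := rfl
@[simp] lemma hexY_five : hexY 5 = -1 := rfl

lemma fin_six_cases (i : Fin 6) : i = 0 ∨ i = 1 ∨ i = 2 ∨ i = 3 ∨ i = 4 ∨ i = 5 := by
  revert i; decide

lemma cr_hex (i j k : Fin 6) : cr (hex i) (hex j) (hex k) =
    (((hexX j - hexX i) * (hexY k - hexY i) - (hexY j - hexY i) * (hexX k - hexX i) : ℤ) : ℝ) := by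
  simp only [cr, hex_zero, hex_one]; push_cast; ring

lemma hex_injective : Function.Injective hex.vertices := by
  intro i j h
  have h0 : hexX i = hexX j := by
    have := congrArg (fun p : Plane => p 0) h
    exact Int.cast_injective (α := ℝ) this
  have h1 : hexY i = hexY j := by
    have := congrArg (fun p : Plane => p 1) h
    exact Int.cast_injective (α := ℝ) this
  clear h
  revert i j; decide

lemma mem_segment_hex {i j : Fin 6} {x : Plane} (h : x ∈ segment ℝ (hex i) (hex j)) :
    ∃ t : ℝ, 0 ≤ t ∧ t ≤ 1 ∧ x 0 = hexX i + t * (hexX j - hexX i) ∧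
      x 1 = hexY i + t * (hexY j - hexY i) := by
  obtain ⟨s, t, hs, ht, hst, rfl⟩ := h
  obtain rfl : s = 1 - t := by linarith
  refine ⟨t, ht, by linarith, ?_, ?_⟩ <;>
    simp only [PiLp.add_apply, PiLp.smul_apply, smul_eq_mul, hex_zero, hex_one] <;> ring

lemma mem_openSegment_hex {i j : Fin 6} {x : Plane} (h : x ∈ openSegment ℝ (hex i) (hex j)) :
    ∃ t : ℝ, 0 < t ∧ t < 1 ∧ x 0 = hexX i + t * (hexX j - hexX i) ∧
      x 1 = hexY i + t * (hexY j - hexY i) := by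
  obtain ⟨s, t, hs, ht, hst, rfl⟩ := h
  obtain rfl : s = 1 - t := by linarith
  refine ⟨t, ht, by linarith, ?_, ?_⟩ <;>
    simp only [PiLp.add_apply, PiLp.smul_apply, smul_eq_mul, hex_zero, hex_one] <;> ring

lemma segment_hex_mem {i j : Fin 6} {x : Plane} (t : ℝ) (h0 : 0 ≤ t) (h1 : t ≤ 1)
    (hx : x 0 = hexX i + t * (hexX j - hexX i)) (hy : x 1 = hexY i + t * (hexY j - hexY i)) :
    x ∈ segment ℝ (hex i) (hex j) := by
  refine ⟨1 - t, t, by linarith, h0, by ring, plane_ext ?_ ?_⟩ <;>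
    simp only [PiLp.add_apply, PiLp.smul_apply, smul_eq_mul, hex_zero, hex_one, hx, hy] <;> ring

lemma openSegment_hex_mem {i j : Fin 6} {x : Plane} (t : ℝ) (h0 : 0 < t) (h1 : t < 1)
    (hx : x 0 = hexX i + t * (hexX j - hexX i)) (hy : x 1 = hexY i + t * (hexY j - hexY i)) :
    x ∈ openSegment ℝ (hex i) (hex j) := by
  refine ⟨1 - t, t, by linarith, h0, by ring, plane_ext ?_ ?_⟩ <;>
    simp only [PiLp.add_apply, PiLp.smul_apply, smul_eq_mul, hex_zero, hex_one, hx, hy] <;> ring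

lemma mem_boundary_hex {x : Plane} : x ∈ hex.boundary ℝ ↔
    ∃ i : Fin 6, x ∈ segment ℝ (hex i) (hex (i + 1)) := by
  simp only [mem_boundary, finRotate_apply]

lemma hex_simple : IsSimple hex := by
  refine ⟨by norm_num, hex_injective, ?_⟩
  intro i j hij x
  rw [edgeSet_eq, edgeSet_eq, finRotate_apply, finRotate_apply]
  rintro ⟨hi, hj⟩
  obtain ⟨t, ht0, ht1, htx, hty⟩ := mem_segment_hex hi
  obtain ⟨s, hs0, hs1, hsx, hsy⟩ := mem_segment_hex hj
  clear hi hj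
  have hx : ∀ k, x 0 = hexX k → x 1 = hexY k → x = hex k := fun k h0 h1 => plane_ext h0 h1
  have hadj : j = i + 1 ∨ i = j + 1 ∨ (j ≠ i + 1 ∧ i ≠ j + 1) := by tauto
  rcases hadj with rfl | rfl | ⟨h1, h2⟩
  · have := hx (i + 1)
    refine ⟨Or.inr (this ?_ ?_), Or.inl (this ?_ ?_)⟩ <;> clear this hx hij <;>
      rcases fin_six_cases i with rfl | rfl | rfl | rfl | rfl | rfl <;>
      simp only [Fin.reduceAdd] at * <;> norm_num at * <;> linarith
  · have := hx (j + 1)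
    refine ⟨Or.inl (this ?_ ?_), Or.inr (this ?_ ?_)⟩ <;> clear this hx hij <;>
      rcases fin_six_cases j with rfl | rfl | rfl | rfl | rfl | rfl <;>
      simp only [Fin.reduceAdd] at * <;> norm_num at * <;> linarith
  · exfalso
    rcases fin_six_cases i with rfl | rfl | rfl | rfl | rfl | rfl <;>
      rcases fin_six_cases j with rfl | rfl | rfl | rfl | rfl | rfl <;> first
      | exact absurd rfl hij
      | exact absurd rfl h1
      | exact absurd rfl h2
      | (simp only [Fin.reduceAdd] at htx hty hsx hsy; norm_num at htx hty hsx hsy; linarith)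

lemma hex_general : InGeneralPosition hex := by
  intro i j k hij hik hjk h
  have h' := cr_eq_zero_of_collinear h
  rw [cr_hex, Int.cast_eq_zero] at h'
  clear h
  revert i j k; decide

lemma hex_good : Good hex := ⟨hex_simple, hex_general⟩

/-- The interior of the hexagon. -/
def hexInterior : Set Plane :=
  {p | p 0 + 3 * p 1 < 5 ∧ p 1 - p 0 < 3 ∧ -p 1 - p 0 < 3 ∧ p 0 - 3 * p 1 < 5 ∧
    (p 0 < 2 * p 1 ∨ p 0 < -2 * p 1)}

lemma isOpen_hexInterior : IsOpen hexInterior := by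
  have c0 : Continuous fun p : Plane => p 0 := by fun_prop
  have c1 : Continuous fun p : Plane => p 1 := by fun_prop
  exact (isOpen_lt (c0.add (c1.const_mul 3)) continuous_const).inter
    ((isOpen_lt (c1.sub c0) continuous_const).inter
    ((isOpen_lt (c1.neg.sub c0) continuous_const).inter
    ((isOpen_lt (c0.sub (c1.const_mul 3)) continuous_const).inter
    ((isOpen_lt c0 (c1.const_mul 2)).union (isOpen_lt c0 (c1.const_mul (-2)))))))

lemma isBounded_hexInterior : Bornology.IsBounded hexInterior := by
  refine (Metric.isBounded_closedBall (x := (0 : Plane)) (r := 9)).subset ?_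
  rintro p ⟨h1, h2, h3, h4, h5⟩
  rw [mem_closedBall_zero_iff, EuclideanSpace.norm_eq, Real.sqrt_le_left (by norm_num)]
  simp only [Fin.sum_univ_two, Real.norm_eq_abs, sq_abs]
  have b1 : -3 ≤ p 0 := by linarith
  have b2 : p 1 ≤ 3 := by linarith
  have b3 : -3 ≤ p 1 := by linarith
  have b4 : p 0 ≤ 6 := by rcases h5 with h5 | h5 <;> linarith
  nlinarith

lemma closure_hexInterior_subset : closure hexInterior ⊆
    {p | p 0 + 3 * p 1 ≤ 5 ∧ p 1 - p 0 ≤ 3 ∧ -p 1 - p 0 ≤ 3 ∧ p 0 - 3 * p 1 ≤ 5 ∧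
      (p 0 ≤ 2 * p 1 ∨ p 0 ≤ -2 * p 1)} := by
  refine closure_minimal ?_ ?_
  · rintro p ⟨h1, h2, h3, h4, h5⟩
    exact ⟨h1.le, h2.le, h3.le, h4.le, h5.imp le_of_lt le_of_lt⟩
  · have c0 : Continuous fun p : Plane => p 0 := by fun_prop
    have c1 : Continuous fun p : Plane => p 1 := by fun_prop
    exact (isClosed_le (c0.add (c1.const_mul 3)) continuous_const).inter
      ((isClosed_le (c1.sub c0) continuous_const).inter
      ((isClosed_le (c1.neg.sub c0) continuous_const).inter
      ((isClosed_le (c0.sub (c1.const_mul 3)) continuous_const).inter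
      ((isClosed_le c0 (c1.const_mul 2)).union (isClosed_le c0 (c1.const_mul (-2)))))))

lemma frontier_hexInterior_subset : frontier hexInterior ⊆ hex.boundary ℝ := by
  rintro p ⟨hp, hpi⟩
  rw [isOpen_hexInterior.interior_eq] at hpi
  obtain ⟨h1, h2, h3, h4, h5⟩ := closure_hexInterior_subset hp
  rw [mem_boundary_hex]
  by_cases e1 : p 0 + 3 * p 1 = 5
  · refine ⟨1, segment_hex_mem (p 1 - 1) ?_ ?_ ?_ ?_⟩ <;>
      simp only [Fin.reduceAdd] <;> norm_num <;> rcases h5 with h5 | h5 <;> linarith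
  by_cases e2 : p 1 - p 0 = 3
  · refine ⟨2, segment_hex_mem ((-p 0 - 1) / 2) ?_ ?_ ?_ ?_⟩ <;>
      simp only [Fin.reduceAdd] <;> norm_num <;> rcases h5 with h5 | h5 <;> linarith
  by_cases e3 : -p 1 - p 0 = 3
  · refine ⟨3, segment_hex_mem (-p 1 / 2) ?_ ?_ ?_ ?_⟩ <;>
      simp only [Fin.reduceAdd] <;> norm_num <;> rcases h5 with h5 | h5 <;> linarith
  by_cases e4 : p 0 - 3 * p 1 = 5
  · refine ⟨4, segment_hex_mem (p 1 + 2) ?_ ?_ ?_ ?_⟩ <;>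
      simp only [Fin.reduceAdd] <;> norm_num <;> rcases h5 with h5 | h5 <;> linarith
  have h6 : ¬ (p 0 < 2 * p 1 ∨ p 0 < -2 * p 1) := fun h => hpi
    ⟨lt_of_le_of_ne h1 e1, lt_of_le_of_ne h2 e2, lt_of_le_of_ne h3 e3, lt_of_le_of_ne h4 e4, h⟩
  push Not at h6
  rcases h5 with h5 | h5
  · refine ⟨0, segment_hex_mem (p 1) ?_ ?_ ?_ ?_⟩ <;>
      simp only [Fin.reduceAdd] <;> norm_num <;> linarith
  · refine ⟨5, segment_hex_mem (1 + p 1) ?_ ?_ ?_ ?_⟩ <;>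
      simp only [Fin.reduceAdd] <;> norm_num <;> linarith

/-- Only this inclusion is needed: the six diagonals are checked against the explicit inequalities,
and the other pairs are excluded by hand. -/
lemma hexInterior_subset : hexInterior ⊆ interiorRegion hex := by
  intro p hp
  refine (mem_interiorRegion_or fun hb => ?_).resolve_right
    (not_mem_unboundedPart_of_frontier isBounded_hexInterior
      (fun x hx => Or.inl (frontier_hexInterior_subset hx))
      (by rwa [isOpen_hexInterior.interior_eq]))
  obtain ⟨h1, h2, h3, h4, h5⟩ := hp
  obtain ⟨i, hi⟩ := mem_boundary_hex.1 hb
  obtain ⟨t, ht0, ht1, hx, hy⟩ := mem_segment_hex hi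
  clear hi
  rcases fin_six_cases i with rfl | rfl | rfl | rfl | rfl | rfl <;> simp only [Fin.reduceAdd] at hx hy <;> norm_num at hx hy <;>
    rcases h5 with h5 | h5 <;> linarith

end PolyTri

/-! ### Triangulations of the hexagon and the upper bound. -/

namespace PolyTri

/-- The signed area of three vertices of the hexagon. -/
def hexCr (i j k : Fin 6) : ℤ :=
  (hexX j - hexX i) * (hexY k - hexY i) - (hexY j - hexY i) * (hexX k - hexX i)

lemma cr_hex_eq (i j k : Fin 6) : cr (hex i) (hex j) (hex k) = hexCr i j k := cr_hex i j k

/-- The pair of vertices of the hexagon with the given indices. -/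
noncomputable def hexPair (e : Sym2 (Fin 6)) : Sym2 Plane := e.map hex.vertices

lemma hexPair_mk (i j : Fin 6) : hexPair s(i, j) = s(hex i, hex j) := rfl

lemma hexPair_injective : Function.Injective hexPair := Sym2.map.injective hex_injective

lemma cr_hex_mul_neg {i j k l : Fin 6} (h : hexCr i j k * hexCr i j l < 0) :
    cr (hex i) (hex j) (hex k) * cr (hex i) (hex j) (hex l) < 0 := by
  rw [cr_hex_eq, cr_hex_eq]; exact_mod_cast h

lemma hexPair_disjoint (i j k l : Fin 6) (h : hexCr i j k ≠ 0)
    (h' : 0 ≤ hexCr i j k * hexCr i j l) :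
    Disjoint (openSeg (hexPair s(i, j))) (openSeg (hexPair s(k, l))) := by
  by_contra hn
  have hc : Cross (hex i) (hex j) (hex k) (hex l) := cross_iff_not_disjoint.2 hn
  have := signs_of_cross hc (by rw [cr_hex_eq]; exact_mod_cast h)
  rw [cr_hex_eq, cr_hex_eq] at this
  exact absurd h' (not_le.2 (by exact_mod_cast this))

lemma IsNonCrossing.hexPair_not_mem {T : Finset (Sym2 Plane)} (hT : IsNonCrossing hex T)
    (i j k l : Fin 6) (h1 : hexCr i j k * hexCr i j l < 0) (h2 : hexCr k l i * hexCr k l j < 0)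
    (hne : s(i, j) ≠ s(k, l)) (h : hexPair s(i, j) ∈ T) : hexPair s(k, l) ∉ T := fun h' =>
  cross_iff_not_disjoint.1 (cross_of_signs (cr_hex_mul_neg h1) (cr_hex_mul_neg h2))
    (hT.disjoint _ h _ h' (hexPair_injective.ne hne))

lemma hexPair_mem_diagonals (i j : Fin 6)
    (h : s(i, j) ∈ ({s(0, 2), s(0, 3), s(0, 4), s(1, 3), s(2, 4), s(3, 5)} : Set (Sym2 (Fin 6)))) :
    hexPair s(i, j) ∈ diagonals hex := by
  have hij : i ≠ j := by
    rintro rfl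
    simp only [Set.mem_insert_iff, Set.mem_singleton_iff] at h
    revert i; decide
  refine ⟨i, j, hij, rfl, fun x hx => hexInterior_subset ?_⟩
  obtain ⟨i', j', he, hx', h'⟩ : ∃ i' j', s(i, j) = s(i', j') ∧
      x ∈ openSegment ℝ (hex i') (hex j') ∧
      ((i' = 0 ∧ j' = 2) ∨ (i' = 0 ∧ j' = 3) ∨ (i' = 0 ∧ j' = 4) ∨ (i' = 1 ∧ j' = 3) ∨
        (i' = 2 ∧ j' = 4) ∨ (i' = 3 ∧ j' = 5)) := by
    rcases h with h | h | h | h | h | h <;> rw [h] at hx <;>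
      exact ⟨_, _, h, hx, by simp⟩
  clear hx he h hij
  obtain ⟨t, ht0, ht1, h0, h1⟩ := mem_openSegment_hex hx'
  rcases h' with ⟨rfl, rfl⟩ | ⟨rfl, rfl⟩ | ⟨rfl, rfl⟩ | ⟨rfl, rfl⟩ | ⟨rfl, rfl⟩ | ⟨rfl, rfl⟩ <;>
    norm_num at h0 h1 <;> refine ⟨by linarith, by linarith, by linarith, by linarith, ?_⟩ <;>
    rcases le_total t (1 / 2) with h2 | h2 <;> first
      | (left; linarith)
      | (right; linarith)

lemma not_mem_diagonals_of_boundary {i j : Fin 6} {x : Plane}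
    (hx : x ∈ openSegment ℝ (hex i) (hex j)) (hb : x ∈ hex.boundary ℝ) :
    hexPair s(i, j) ∉ diagonals hex := fun h =>
  (((mem_diagonals_iff hex_good).1 h).2.2.2 hx).1 hb

lemma hexPair_one_four : hexPair s(1, 4) ∉ diagonals hex := by
  -- The point where the segment meets a side at the reflex vertex.
  refine not_mem_diagonals_of_boundary (x := !₂[2 / 3, -1 / 3])
    (openSegment_hex_mem (4 / 9) (by norm_num) (by norm_num) ?_ ?_)
    (mem_boundary_hex.2 ⟨5, segment_hex_mem (2 / 3) (by norm_num) (by norm_num) ?_ ?_⟩) <;>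
    simp only [Fin.reduceAdd] <;> norm_num

lemma hexPair_two_five : hexPair s(2, 5) ∉ diagonals hex := by
  refine not_mem_diagonals_of_boundary (x := !₂[2 / 3, 1 / 3])
    (openSegment_hex_mem (5 / 9) (by norm_num) (by norm_num) ?_ ?_)
    (mem_boundary_hex.2 ⟨0, segment_hex_mem (1 / 3) (by norm_num) (by norm_num) ?_ ?_⟩) <;>
    simp only [Fin.reduceAdd] <;> norm_num

lemma hexPair_one_five : hexPair s(1, 5) ∉ diagonals hex := by
  intro h
  have hx : !₂[2, 0] ∈ openSegment ℝ (hex 1) (hex 5) := by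
    refine openSegment_hex_mem (1 / 2) (by norm_num) (by norm_num) ?_ ?_ <;> norm_num
  -- The midpoint lies in the notch at the reflex vertex and escapes to infinity along the
  -- horizontal axis.
  refine disjoint_unboundedPart (((mem_diagonals_iff hex_good).1 h).2.2.2 hx)
    (mem_unboundedPart_of_ray (v := !₂[1, 0]) (fun h0 => ?_) fun t ht hb => ?_)
  · have := congrArg (fun p : Plane => p 0) h0
    norm_num at this
  · obtain ⟨i, hi⟩ := mem_boundary_hex.1 hb
    obtain ⟨s, hs0, hs1, hx, hy⟩ := mem_segment_hex hi
    clear hi hb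
    rcases fin_six_cases i with rfl | rfl | rfl | rfl | rfl | rfl <;>
      simp only [Fin.reduceAdd] at hx hy <;> norm_num at hx hy <;> linarith

lemma eq_of_mem_hex_diagonals {e : Sym2 Plane} (he : e ∈ diagonals hex) :
    e = hexPair s(0, 2) ∨ e = hexPair s(0, 3) ∨ e = hexPair s(0, 4) ∨ e = hexPair s(1, 3) ∨
      e = hexPair s(2, 4) ∨ e = hexPair s(3, 5) := by
  have he' := he
  obtain ⟨i, j, hij, rfl, -⟩ := he'
  have key : ∀ i j : Fin 6, i ≠ j → (s(i, j) = s(0, 2) ∨ s(i, j) = s(0, 3) ∨ s(i, j) = s(0, 4) ∨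
      s(i, j) = s(1, 3) ∨ s(i, j) = s(2, 4) ∨ s(i, j) = s(3, 5)) ∨
      s(i, j) = s(1, 4) ∨ s(i, j) = s(2, 5) ∨ s(i, j) = s(1, 5) ∨
      ∃ k, s(i, j) = s(k, finRotate 6 k) := by decide
  rw [← hexPair_mk] at he ⊢
  rcases key i j hij with h | h | h | h | ⟨k, h⟩
  · exact h.imp (congrArg _) (Or.imp (congrArg _) (Or.imp (congrArg _) (Or.imp (congrArg _)
      (Or.imp (congrArg _) (congrArg _)))))
  · exact absurd (h ▸ he) hexPair_one_four
  · exact absurd (h ▸ he) hexPair_two_five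
  · exact absurd (h ▸ he) hexPair_one_five
  · rw [h] at he
    exact absurd ⟨k, rfl⟩ (not_mem_sides_of_diagonal he)

lemma isNonCrossing_triple {n : ℕ} {P : Polygon Plane n} [DecidableEq (Sym2 Plane)]
    {e f g : Sym2 Plane} (he : e ∈ diagonals P) (hf : f ∈ diagonals P) (hg : g ∈ diagonals P)
    (hef : Disjoint (openSeg e) (openSeg f)) (heg : Disjoint (openSeg e) (openSeg g))
    (hfg : Disjoint (openSeg f) (openSeg g)) : IsNonCrossing P {e, f, g} := by
  constructor
  · intro x hx
    simp only [Finset.mem_insert, Finset.mem_singleton] at hx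
    rcases hx with rfl | rfl | rfl <;> assumption
  · intro x hx y hy hxy
    simp only [Finset.mem_insert, Finset.mem_singleton] at hx hy
    rcases hx with rfl | rfl | rfl <;> rcases hy with rfl | rfl | rfl <;> first
      | exact absurd rfl hxy
      | assumption
      | (apply Disjoint.symm; assumption)

open Classical in
/-- The fan triangulation of the hexagon. -/
noncomputable def hexFan : Finset (Sym2 Plane) :=
  {hexPair s(0, 2), hexPair s(0, 3), hexPair s(0, 4)}

lemma hexFan_isNonCrossing : IsNonCrossing hex hexFan :=
  isNonCrossing_triple (hexPair_mem_diagonals _ _ (by simp)) (hexPair_mem_diagonals _ _ (by simp))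
    (hexPair_mem_diagonals _ _ (by simp)) (Sym2.eq_swap (a := (0 : Fin 6)) (b := 3) ▸
      hexPair_disjoint 0 2 3 0 (by decide) (by decide))
    (Sym2.eq_swap (a := (0 : Fin 6)) (b := 4) ▸
      hexPair_disjoint 0 2 4 0 (by decide) (by decide))
    (Sym2.eq_swap (a := (0 : Fin 6)) (b := 4) ▸
      hexPair_disjoint 0 3 4 0 (by decide) (by decide))

lemma numTriangulations_hex_le : numTriangulations hex ≤ 5 := by
  classical
  have e30 : s((3 : Fin 6), 0) = s(0, 3) := by decide
  have e40 : s((4 : Fin 6), 0) = s(0, 4) := by decide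
  have e53 : s((5 : Fin 6), 3) = s(3, 5) := by decide
  have e42 : s((4 : Fin 6), 2) = s(2, 4) := by decide
  have d02 := hexPair_mem_diagonals 0 2 (by simp)
  have d03 := hexPair_mem_diagonals 0 3 (by simp)
  have d04 := hexPair_mem_diagonals 0 4 (by simp)
  have d13 := hexPair_mem_diagonals 1 3 (by simp)
  have d24 := hexPair_mem_diagonals 2 4 (by simp)
  have d35 := hexPair_mem_diagonals 3 5 (by simp)
  have j1 := hexPair_disjoint 0 2 3 0 (by decide) (by decide)
  have j4 := hexPair_disjoint 1 3 0 3 (by decide) (by decide)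
  have j5 := hexPair_disjoint 1 3 0 4 (by decide) (by decide)
  have j6 := hexPair_disjoint 3 5 0 2 (by decide) (by decide)
  have j7 := hexPair_disjoint 3 5 0 3 (by decide) (by decide)
  have j8 := hexPair_disjoint 1 3 5 3 (by decide) (by decide)
  have j2 := hexPair_disjoint 0 2 4 0 (by decide) (by decide)
  have j3 := hexPair_disjoint 0 3 4 0 (by decide) (by decide)
  have j9 := hexPair_disjoint 0 2 4 2 (by decide) (by decide)
  have j10 := hexPair_disjoint 2 4 0 4 (by decide) (by decide)
  rw [e30] at j1
  rw [e40] at j2 j3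
  rw [e53] at j8
  rw [e42] at j9
  have h2 := isNonCrossing_triple d13 d03 d04 j4 j5 j3
  have h3 := isNonCrossing_triple d02 d03 d35 j1 j6.symm j7.symm
  have h4 := isNonCrossing_triple d13 d03 d35 j4 j8 j7.symm
  have h5 := isNonCrossing_triple d02 d24 d04 j9 j2 j10
  have hsub : {T | IsTriangulation hex T} ⊆ (({hexFan,
      {hexPair s(1, 3), hexPair s(0, 3), hexPair s(0, 4)},
      {hexPair s(0, 2), hexPair s(0, 3), hexPair s(3, 5)},
      {hexPair s(1, 3), hexPair s(0, 3), hexPair s(3, 5)},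
      {hexPair s(0, 2), hexPair s(2, 4), hexPair s(0, 4)}} : Finset (Finset (Sym2 Plane))) :
        Set (Finset (Sym2 Plane))) := by
    intro T (hT : Maximal _ T)
    have c1 := hT.prop.hexPair_not_mem 0 2 1 3 (by decide) (by decide) (by decide)
    have c2 := hT.prop.hexPair_not_mem 0 3 2 4 (by decide) (by decide) (by decide)
    have c3 := hT.prop.hexPair_not_mem 0 4 3 5 (by decide) (by decide) (by decide)
    have c4 := hT.prop.hexPair_not_mem 1 3 2 4 (by decide) (by decide) (by decide)
    have c5 := hT.prop.hexPair_not_mem 2 4 3 5 (by decide) (by decide) (by decide)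
    have hcases : ∀ e ∈ T, e = hexPair s(0, 2) ∨ e = hexPair s(0, 3) ∨ e = hexPair s(0, 4) ∨
        e = hexPair s(1, 3) ∨ e = hexPair s(2, 4) ∨ e = hexPair s(3, 5) :=
      fun e he => eq_of_mem_hex_diagonals (hT.prop.subset_diagonals e he)
    have hle : ∀ {S : Finset (Sym2 Plane)}, IsNonCrossing hex S → (∀ e ∈ T, e ∈ S) → T = S :=
      fun hS h => hT.eq_of_le hS h
    simp only [Finset.coe_insert, Finset.coe_singleton, Set.mem_insert_iff, Set.mem_singleton_iff]
    have aux : ∀ {S : Finset (Sym2 Plane)},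
        (hexPair s(0, 2) ∈ T → hexPair s(0, 2) ∈ S) → (hexPair s(0, 3) ∈ T → hexPair s(0, 3) ∈ S) →
        (hexPair s(0, 4) ∈ T → hexPair s(0, 4) ∈ S) → (hexPair s(1, 3) ∈ T → hexPair s(1, 3) ∈ S) →
        (hexPair s(2, 4) ∈ T → hexPair s(2, 4) ∈ S) → (hexPair s(3, 5) ∈ T → hexPair s(3, 5) ∈ S) →
        ∀ e ∈ T, e ∈ S := by
      intro S a1 a2 a3 a4 a5 a6 e he
      rcases hcases e he with rfl | rfl | rfl | rfl | rfl | rfl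
      exacts [a1 he, a2 he, a3 he, a4 he, a5 he, a6 he]
    -- With 24 present the other diagonals are limited to 02 and 04. Without it, the choices 02 or
    -- 13 and 04 or 35 are independent, giving four more triangulations.
    by_cases h24 : hexPair s(2, 4) ∈ T
    · iterate 4 right
      refine hle h5 (aux ?_ ?_ ?_ ?_ ?_ ?_) <;> simp <;> tauto
    · by_cases h13 : hexPair s(1, 3) ∈ T <;> by_cases h35 : hexPair s(3, 5) ∈ T
      · iterate 3 right
        left
        refine hle h4 (aux ?_ ?_ ?_ ?_ ?_ ?_) <;> simp <;> tauto
      · right; left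
        refine hle h2 (aux ?_ ?_ ?_ ?_ ?_ ?_) <;> simp <;> tauto
      · right; right; left
        refine hle h3 (aux ?_ ?_ ?_ ?_ ?_ ?_) <;> simp <;> tauto
      · left
        refine hle hexFan_isNonCrossing (aux ?_ ?_ ?_ ?_ ?_ ?_) <;> simp [hexFan] <;> tauto
  calc numTriangulations hex ≤ _ := Set.ncard_le_ncard hsub (Finset.finite_toSet _)
    _ = _ := Set.ncard_coe_finset _
    _ ≤ 5 := Finset.card_le_five

lemma hexFan_isTriangulation : IsTriangulation hex hexFan := by
  refine ⟨hexFan_isNonCrossing, fun T hT h e he => ?_⟩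
  have h02 : hexPair s(0, 2) ∈ T := h (by simp [hexFan])
  have h03 : hexPair s(0, 3) ∈ T := h (by simp [hexFan])
  have h04 : hexPair s(0, 4) ∈ T := h (by simp [hexFan])
  have c1 := hT.hexPair_not_mem 0 2 1 3 (by decide) (by decide) (by decide) h02
  have c2 := hT.hexPair_not_mem 0 3 2 4 (by decide) (by decide) (by decide) h03
  have c3 := hT.hexPair_not_mem 0 4 3 5 (by decide) (by decide) (by decide) h04
  rcases eq_of_mem_hex_diagonals (hT.subset_diagonals e he) with
    rfl | rfl | rfl | rfl | rfl | rfl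
  · simp [hexFan]
  · simp [hexFan]
  · simp [hexFan]
  exacts [absurd he c1, absurd he c2, absurd he c3]

lemma mem_edges_hexFan (i j : Fin 6) (h : s(i, j) = s(0, 2) ∨ s(i, j) = s(0, 3) ∨
    s(i, j) = s(0, 4) ∨ ∃ k, s(i, j) = s(k, finRotate 6 k)) :
    s(hex i, hex j) ∈ edges hex hexFan := by
  rw [← hexPair_mk]
  rcases h with h | h | h | ⟨k, h⟩ <;> rw [h]
  · exact Or.inr (by simp [hexFan])
  · exact Or.inr (by simp [hexFan])
  · exact Or.inr (by simp [hexFan])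
  · exact Or.inl ⟨k, rfl⟩

lemma flippableDiagonals_hexFan : flippableDiagonals hex hexFan = hexFan := by
  classical
  refine Finset.filter_true_of_mem fun e he => ?_
  simp only [hexFan, Finset.mem_insert, Finset.mem_singleton] at he
  rcases he with rfl | rfl | rfl
  · exact isFlippable_of_signs (c := hex 1) (d := hex 3) (cr_hex_mul_neg (by decide))
      (cr_hex_mul_neg (by decide)) (mem_edges_hexFan _ _ (by decide))
      (mem_edges_hexFan _ _ (by decide)) (mem_edges_hexFan _ _ (by decide))
      (mem_edges_hexFan _ _ (by decide))
  · exact isFlippable_of_signs (c := hex 2) (d := hex 4) (cr_hex_mul_neg (by decide))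
      (cr_hex_mul_neg (by decide)) (mem_edges_hexFan _ _ (by decide))
      (mem_edges_hexFan _ _ (by decide)) (mem_edges_hexFan _ _ (by decide))
      (mem_edges_hexFan _ _ (by decide))
  · exact isFlippable_of_signs (c := hex 3) (d := hex 5) (cr_hex_mul_neg (by decide))
      (cr_hex_mul_neg (by decide)) (mem_edges_hexFan _ _ (by decide))
      (mem_edges_hexFan _ _ (by decide)) (mem_edges_hexFan _ _ (by decide))
      (mem_edges_hexFan _ _ (by decide))

open Classical in
lemma isPsFlippable_hexFan : IsPsFlippable hex hexFan {hexPair s(0, 2), hexPair s(0, 4)} := by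
  have s1 : cr (hex 0) (hex 2) (hex 1) * cr (hex 0) (hex 2) (hex 3) < 0 :=
    cr_hex_mul_neg (by decide)
  have s2 : cr (hex 1) (hex 3) (hex 0) * cr (hex 1) (hex 3) (hex 2) < 0 :=
    cr_hex_mul_neg (by decide)
  have s3 : cr (hex 0) (hex 4) (hex 3) * cr (hex 0) (hex 4) (hex 5) < 0 :=
    cr_hex_mul_neg (by decide)
  have s4 : cr (hex 3) (hex 5) (hex 0) * cr (hex 3) (hex 5) (hex 4) < 0 :=
    cr_hex_mul_neg (by decide)
  have hdis : Disjoint (interior (convexHull ℝ {hex 0, hex 2, hex 1, hex 3}))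
      (interior (convexHull ℝ {hex 0, hex 4, hex 3, hex 5})) := by
    -- The horizontal axis separates the two quadrilaterals; a common interior point could be moved
    -- upwards within both.
    rw [Set.disjoint_iff_inter_eq_empty, ← interior_inter, Set.eq_empty_iff_forall_notMem]
    intro x hx
    have hlin : IsLinearMap ℝ fun p : Plane => p 1 := ⟨fun _ _ => rfl, fun _ _ => rfl⟩
    have hup : convexHull ℝ {hex 0, hex 2, hex 1, hex 3} ⊆ {p : Plane | 0 ≤ p 1} := by
      refine convexHull_min ?_ (convex_halfSpace_ge hlin 0)
      rintro p (rfl | rfl | rfl | rfl) <;> simp [hex_one]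
    have hdown : convexHull ℝ {hex 0, hex 4, hex 3, hex 5} ⊆ {p : Plane | p 1 ≤ 0} := by
      refine convexHull_min ?_ (convex_halfSpace_le hlin 0)
      rintro p (rfl | rfl | rfl | rfl) <;> simp [hex_one]
    have hray : Filter.Tendsto (fun t : ℝ => x + t • (!₂[0, 1] : Plane)) (nhdsWithin 0 (Set.Ioi 0))
        (nhds x) := by
      have : Filter.Tendsto (fun t : ℝ => x + t • (!₂[0, 1] : Plane)) (nhds 0)
          (nhds (x + (0 : ℝ) • (!₂[0, 1] : Plane))) := Continuous.tendsto (by fun_prop) 0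
      rw [zero_smul, add_zero] at this
      exact this.mono_left nhdsWithin_le_nhds
    obtain ⟨t, ht, ht0⟩ := ((hray.eventually (isOpen_interior.mem_nhds hx)).and
      self_mem_nhdsWithin).exists
    have e1 := hup (interior_subset hx).1
    have e2 := hdown (interior_subset ht).2
    simp at e1 e2 ht0
    linarith
  refine ⟨by simp [hexFan, Finset.insert_subset_iff],
    {{hex 0, hex 2, hex 1, hex 3}, {hex 0, hex 4, hex 3, hex 5}}, ?_, ?_, ?_⟩
  · rintro W (rfl | rfl)
    · refine ⟨?_, isConvexPolygon_of_signs s1 s2, hullSides_quad_subset s1 s2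
        (mem_edges_hexFan _ _ (by decide)) (mem_edges_hexFan _ _ (by decide))
        (mem_edges_hexFan _ _ (by decide)) (mem_edges_hexFan _ _ (by decide))⟩
      rintro x (rfl | rfl | rfl | rfl) <;> exact ⟨_, rfl⟩
    · refine ⟨?_, isConvexPolygon_of_signs s3 s4, hullSides_quad_subset s3 s4
        (mem_edges_hexFan _ _ (by decide)) (mem_edges_hexFan _ _ (by decide))
        (mem_edges_hexFan _ _ (by decide)) (mem_edges_hexFan _ _ (by decide))⟩
      rintro x (rfl | rfl | rfl | rfl) <;> exact ⟨_, rfl⟩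
  · rintro W (rfl | rfl) W' (rfl | rfl) h
    exacts [absurd rfl h, hdis, hdis.symm, absurd rfl h]
  · intro e he
    simp only [Finset.mem_insert, Finset.mem_singleton] at he
    rcases he with rfl | rfl
    · exact ⟨_, Or.inl rfl, (diagonals_of_signs s1 s2).1⟩
    · exact ⟨_, Or.inr rfl, (diagonals_of_signs s3 s4).1⟩

lemma GonProperty.le_five_fourths {c : ℝ} (hc : GonProperty c) : c ≤ 5 / 4 := by
  classical
  have h := hc 6 hex hex_simple hex_general hexFan hexFan_isTriangulation
    {hexPair s(0, 2), hexPair s(0, 4)}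
    (by rw [flippableDiagonals_hexFan]; exact isPsFlippable_hexFan.1) isPsFlippable_hexFan
  have c2 : ({hexPair s(0, 2), hexPair s(0, 4)} : Finset (Sym2 Plane)).card = 2 :=
    Finset.card_pair (hexPair_injective.ne (by decide))
  have c3 : hexFan.card = 3 := Finset.card_eq_three.2 ⟨_, _, _, hexPair_injective.ne (by decide),
    hexPair_injective.ne (by decide), hexPair_injective.ne (by decide), rfl⟩
  rw [flippableDiagonals_hexFan, c2, c3] at h
  have h5 : (numTriangulations hex : ℝ) ≤ 5 := by exact_mod_cast numTriangulations_hex_le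
  norm_num at h
  linarith

end PolyTri

/-! ### The root of the cubic and the maximum. -/

namespace PolyTri

/-- For each polygon, triangulation and set F the condition on c is a closed one. -/
lemma isClosed_gonProperty : IsClosed {c : ℝ | GonProperty c} := by
  simp only [GonProperty, Set.ofPred_forall]
  exact isClosed_iInter fun _ => isClosed_iInter fun _ => isClosed_iInter fun _ =>
    isClosed_iInter fun _ => isClosed_iInter fun _ => isClosed_iInter fun _ =>
    isClosed_iInter fun _ => isClosed_iInter fun _ => isClosed_iInter fun _ =>
    isClosed_le (continuous_const.mul (continuous_id.pow _)) continuous_const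

lemma exists_root_cubic : ∃ x : ℝ, 1.179645 < x ∧ x < 1.179655 ∧
    ∀ y : ℝ, 1 + 4 * y ^ 2 - 4 * y ^ 3 = 0 ↔ y = x := by
  have hc : ContinuousOn (fun y : ℝ => 1 + 4 * y ^ 2 - 4 * y ^ 3)
      (Set.Icc 1.179645 1.179655) := by fun_prop
  obtain ⟨x, ⟨h1, h2⟩, h0⟩ := intermediate_value_Ioo' (by norm_num) hc
    (show (0 : ℝ) ∈ _ by constructor <;> norm_num)
  refine ⟨x, h1, h2, fun y => ⟨fun h => ?_, fun h => h ▸ h0⟩⟩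
  simp only at h0
  have hfac : (y - x) * (y ^ 2 + y * x + x ^ 2 - y - x) = 0 := by linear_combination (h0 - h) / 4
  rcases mul_eq_zero.1 hfac with h' | h'
  · linarith
  · exfalso
    -- Four times the cofactor is (2y + x - 1)^2 + (3x + 1)(x - 1), positive since x > 1.
    nlinarith [sq_nonneg (2 * y + x - 1)]

end PolyTri

theorem mainTheorem8 :
    ∃ x : ℝ,
      (∀ y : ℝ, 1 + 4 * y ^ 2 - 4 * y ^ 3 = 0 ↔ y = x) ∧
      |x - 1.17965| < 0.000005 ∧
      (∀ (n : ℕ) (P : Polygon PolyTri.Plane n),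
        PolyTri.IsSimple P → PolyTri.InGeneralPosition P →
        ∀ T : Finset (Sym2 PolyTri.Plane), PolyTri.IsTriangulation P T →
        ∀ F : Finset (Sym2 PolyTri.Plane),
          F ⊆ PolyTri.flippableDiagonals P T → PolyTri.IsPsFlippable P T F →
          (2 : ℝ) ^ F.card * x ^ ((PolyTri.flippableDiagonals P T).card - F.card) ≤
            (PolyTri.numTriangulations P : ℝ)) ∧
      ∃ cgon : ℝ, IsGreatest {c : ℝ | PolyTri.GonProperty c} cgon ∧ x ≤ cgon ∧ cgon ≤ 5 / 4 := by
  obtain ⟨x, h1, h2, hx⟩ := PolyTri.exists_root_cubic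
  have h0 := (hx x).2 rfl
  norm_num at h1 h2
  -- The cubic condition holds with equality by `h0`; x^2 ≤ x + 1/4 holds because x < (1 + √2) / 2.
  have hgon : PolyTri.GonProperty x :=
    PolyTri.gonProperty_of_le (by linarith) (by linarith) (by nlinarith) (by linarith)
  have hbdd : BddAbove {c : ℝ | PolyTri.GonProperty c} :=
    ⟨5 / 4, fun c hc => PolyTri.GonProperty.le_five_fourths hc⟩
  refine ⟨x, hx, by rw [abs_lt]; constructor <;> norm_num <;> linarith, hgon,
    sSup {c : ℝ | PolyTri.GonProperty c},
    ⟨PolyTri.isClosed_gonProperty.csSup_mem ⟨x, hgon⟩ hbdd, fun c hc => le_csSup hbdd hc⟩,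
    le_csSup hbdd hgon, csSup_le ⟨x, hgon⟩ fun c hc => PolyTri.GonProperty.le_five_fourths hc⟩
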